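/- **Proposition 4.5.** Let $a_1,a_2>0$, $\Omega=(0,a_1)\times(0,a_2)$ and let $\omega=(\alpha_1,\beta_1)\times(\alpha_2,\beta_2)$ be a subrectangle, $0\le\alpha_k<\beta_k\le a_k$. Let $\sigma=\gamma([0,1])\subset\Omega$ be a curve that is not a single point, with $\gamma\in C^1([0,1];\mathbb R^2)$, let $b=(b_1,b_2)\in\mathbb R^2$, and suppose that $\sigma$ is symmetric with respect to some straight line through $b$. Consider the diffusion system $$\frac{\partial z}{\partial t}=\Delta z\ \text{ in }\Omega\times(0,\infty),\qquad \frac{\partial z}{\partial \nu}=0\ \text{ on }\partial\Omega\times(0,\infty),\qquad z(\cdot,0)=z_0\in H^1(\Omega),$$ measured by the filament sensor $(\sigma,\delta_\sigma)$, that is, with the output $y(t)=Cz(\cdot,t)$, where $Cf=\int_\sigma f\,d\mathcal H^1$ is the integral with respect to arc length. Let $J$ be any natural number (for instance the number of unstable modes of the system) and suppose that for all $i,j\in\{1,\dots,J\}$ neither $$\frac{i(b_1-\alpha_1)}{\beta_1-\alpha_1}\quad\text{nor}\quad\frac{j(b_2-\alpha_2)}{\beta_2-\alpha_2}$$ is an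 even integer. Then the system is regionally exponentially observable in $\omega$ ($\omega_{E_C}$-observable) by the dynamical system $$\frac{\partial w}{\partial t}=\Delta w+\mathcal H_\omega\bigl(y(t)-Cw(\cdot,t)\bigr)\ \text{ in }\Omega\times(0,\infty),\qquad \frac{\partial w}{\partial \nu}=0\ \text{ on }\partial\Omega\times(0,\infty),\qquad w(\cdot,0)=w_0 .$$ This means the following. The diffusion system is well posed in $H^1(\Omega)$ (for each initial datum in $H^1(\Omega)$ there is exactly one weak solution, continuous in time with values in $H^1(\Omega)$). There is a function $h\in H^1(\Omega)$ vanishing outside $\omega$ such that with the gain $\mathcal H_\omega r=rh$, $r\in\mathbb R$: 1. for every output $y$ of the diffusion system with $z_0\in H^1(\Omega)$, the system for $w$ is well posed in $H^1(\Omega)$; 2. there are constants $M,A$ with $\|w(t)-z(t)\|_{H^1(\Omega)}\le Me^{At}\|w_0-z_0\|_{H^1(\Omega)}$ for all $t\ge0$ and all $z_0,w_0\in H^1(\Omega)$; 3. there are constants $F,\kappa>0$ with $\|w(t)-z(t)\|_{H^1(\omega)}\le Fe^{-\kappa t}\|w_0-z_0\|_{H^1(\Omega)}$ for all $t\ge0$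 and all $z_0,w_0\in H^1(\Omega)$; 4. the domain in $H^1(\Omega)$ of the infinitesimal generator $\Delta$ of the diffusion system is contained in the domain of the infinitesimal generator $\Delta-\mathcal H_\omega C$ of the system for $w$ with $y=0$. -/

import Mathlib

open MeasureTheory Set Filter Topology

noncomputable section

namespace FilamentObs

/-- The Euclidean plane. -/
abbrev Plane : Type := EuclideanSpace ℝ (Fin 2)

/-- The open rectangle with lower left corner `l` and upper right corner `r`. -/
def rect (l r : Plane) : Set Plane := {x | ∀ i, l i < x i ∧ x i < r i}

/-- `g` is the weak gradient of `f` on the open set `U`. -/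
def IsWeakGradient (U : Set Plane) (f : Plane → ℝ) (g : Plane → Plane) : Prop :=
  ∀ φ : Plane → ℝ, ContDiff ℝ (⊤ : ℕ∞) φ → HasCompactSupport φ → tsupport φ ⊆ U →
    ∀ i : Fin 2,
      ∫ x in U, f x * fderiv ℝ φ x (EuclideanSpace.single i 1) = -∫ x in U, g x i * φ x

/-- `g` is a square integrable weak gradient of `f` on `U`. -/
def IsL2Gradient (U : Set Plane) (f : Plane → ℝ) (g : Plane → Plane) : Prop :=
  MemLp g 2 (volume.restrict U) ∧ IsWeakGradient U f g

/-- Membership in the Sobolev space `H¹(U)`. -/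
def MemH1 (U : Set Plane) (f : Plane → ℝ) : Prop :=
  MemLp f 2 (volume.restrict U) ∧ ∃ g, IsL2Gradient U f g

open Classical in
/-- The weak gradient of `f ∈ H¹(U)` (well defined almost everywhere on an open set `U`);
it is `0` if `f` has no square integrable weak gradient. -/
def weakGrad (U : Set Plane) (f : Plane → ℝ) : Plane → Plane :=
  if h : ∃ g, IsL2Gradient U f g then h.choose else 0

/-- The norm of `H¹(U)`. -/
def h1Norm (U : Set Plane) (f : Plane → ℝ) : ℝ :=
  √((∫ x in U, f x ^ 2) + ∫ x in U, ‖weakGrad U f x‖ ^ 2)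

/-- `z : [0, ∞) → H¹(Ω)` is the (weak) solution of
`∂z/∂t = Δz + u(t) h` in `Ω × (0, ∞)`, `∂z/∂ν = 0` on `∂Ω × (0, ∞)`, `z(0) = z₀`.
The Neumann condition is the natural one: the test functions are smooth up to the boundary of `Ω`
and are not required to vanish there. For `t > 0` the state is a continuous function on `Ω`, which
gives a meaning to its integral along a curve. -/
structure IsSolution (Ω : Set Plane) (h : Plane → ℝ) (u : ℝ → ℝ) (z₀ : Plane → ℝ)
    (z : ℝ → Plane → ℝ) : Prop where
  initial : z 0 =ᵐ[volume.restrict Ω] z₀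
  mem_h1 : ∀ t, 0 ≤ t → MemH1 Ω (z t)
  continuous_h1 : ∀ t, 0 ≤ t →
    Tendsto (fun s => h1Norm Ω (fun x => z s x - z t x)) (𝓝[Ici 0] t) (𝓝 0)
  continuousOn : ∀ t, 0 < t → ContinuousOn (z t) Ω
  integrable_input : ∀ t, 0 < t → IntervalIntegrable u volume 0 t
  weak_eq : ∀ φ : Plane → ℝ, ContDiff ℝ (⊤ : ℕ∞) φ → ∀ t, 0 ≤ t →
    (∫ x in Ω, z t x * φ x) - ∫ x in Ω, z₀ x * φ x =
      -(∫ s in (0 : ℝ)..t, ∫ x in Ω, fderiv ℝ φ x (weakGrad Ω (z s) x)) +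
        (∫ s in (0 : ℝ)..t, u s) * ∫ x in Ω, h x * φ x

/-- The measurement of a filament sensor `(σ, δ_σ)`: the integral over `σ` with respect to
arc length. -/
def filamentOutput (σ : Set Plane) (f : Plane → ℝ) : ℝ := ∫ x in σ, f x ∂(μH[1])

/-- The diffusion system `∂z/∂t = Δz`, `∂z/∂ν = 0`, `z(0) = z₀`. -/
def IsState (Ω : Set Plane) (z₀ : Plane → ℝ) (z : ℝ → Plane → ℝ) : Prop :=
  IsSolution Ω 0 0 z₀ z

/-- The observer `∂w/∂t = Δw + H_ω (y(t) - C w)`, `∂w/∂ν = 0`, `w(0) = w₀`, where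
`H_ω r = r h` and `C` is the measurement of the filament sensor on `σ`. -/
def IsObserver (Ω σ : Set Plane) (h : Plane → ℝ) (y : ℝ → ℝ) (w₀ : Plane → ℝ)
    (w : ℝ → Plane → ℝ) : Prop :=
  IsSolution Ω h (fun t => y t - filamentOutput σ (w t)) w₀ w

/-- An evolution problem, given as a relation between initial data and solutions, has a solution
for every initial datum in `H¹(Ω)`, and only one. -/
def WellPosed (Ω : Set Plane) (Sol : (Plane → ℝ) → (ℝ → Plane → ℝ) → Prop) : Prop :=
  ∀ z₀, MemH1 Ω z₀ → (∃ z, Sol z₀ z) ∧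
    ∀ z z', Sol z₀ z → Sol z₀ z' → ∀ t, 0 < t → EqOn (z t) (z' t) Ω

/-- The domain of the infinitesimal generator, in `H¹(Ω)`, of the evolution problem `Sol`. -/
def InDomain (Ω : Set Plane) (Sol : (Plane → ℝ) → (ℝ → Plane → ℝ) → Prop)
    (z₀ : Plane → ℝ) : Prop :=
  MemH1 Ω z₀ ∧ ∃ z, Sol z₀ z ∧ ∃ g, MemH1 Ω g ∧
    Tendsto (fun t : ℝ => h1Norm Ω (fun x => (z t x - z₀ x) / t - g x)) (𝓝[>] 0) (𝓝 0)

/-- The observer with gain `h` is an exponential estimator in `ω` of the state of the diffusion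
system on `Ω` measured by the filament sensor on `σ`: it is well posed for every measured output;
the error `w - z`, which evolves by the semigroup of `L = Δ - H_ω C` (take `z = 0` to see all of
its orbits), is bounded by a strongly continuous semigroup on `H¹(Ω)` and tends to zero
exponentially as a map from `H¹(Ω)` to `H¹(ω)`; and the domain of `Δ` is contained in that
of `L`. -/
def IsExpEstimator (Ω ω σ : Set Plane) (h : Plane → ℝ) : Prop :=
  (∀ z₀ z, MemH1 Ω z₀ → IsState Ω z₀ z →
    WellPosed Ω (IsObserver Ω σ h (fun t => filamentOutput σ (z t)))) ∧
  (∃ M A : ℝ, ∀ z₀ z w₀ w, MemH1 Ω z₀ → IsState Ω z₀ z → MemH1 Ω w₀ →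
    IsObserver Ω σ h (fun t => filamentOutput σ (z t)) w₀ w → ∀ t, 0 ≤ t →
      h1Norm Ω (fun x => w t x - z t x) ≤
        M * Real.exp (A * t) * h1Norm Ω (fun x => w₀ x - z₀ x)) ∧
  (∃ F κ : ℝ, 0 < F ∧ 0 < κ ∧ ∀ z₀ z w₀ w, MemH1 Ω z₀ → IsState Ω z₀ z → MemH1 Ω w₀ →
    IsObserver Ω σ h (fun t => filamentOutput σ (z t)) w₀ w → ∀ t, 0 ≤ t →
      h1Norm ω (fun x => w t x - z t x) ≤
        F * Real.exp (-κ * t) * h1Norm Ω (fun x => w₀ x - z₀ x)) ∧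
  (∀ z₀, InDomain Ω (IsState Ω) z₀ → InDomain Ω (IsObserver Ω σ h 0) z₀)

/-- Regional exponential observability in `ω`, by an observer of the form `IsObserver`, of the
diffusion system on `Ω` measured by the filament sensor on `σ`. The gain `H_ω : ℝ → H¹(ω)` is
`r ↦ r h`; the function `h` vanishes outside `ω` and, as the observer is an equation on `Ω`,
belongs to `H¹(Ω)`. -/
def RegionallyExpObservable (Ω ω σ : Set Plane) : Prop :=
  WellPosed Ω (IsState Ω) ∧
    ∃ h : Plane → ℝ, MemH1 Ω h ∧ (∀ x, x ∉ ω → h x = 0) ∧ IsExpEstimator Ω ω σ h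

/-- `S` is symmetric with respect to a straight line through `b` (with direction `v`). -/
def SymmetricAboutLineThrough (b : Plane) (S : Set Plane) : Prop :=
  ∃ v : Plane, v ≠ 0 ∧
    (fun x => b + (Submodule.span ℝ {v}).reflection (x - b)) '' S = S

/-- The real number `r` is an even integer. -/
def IsEvenInteger (r : ℝ) : Prop := ∃ k : ℤ, r = 2 * k

end FilamentObs

end

/-! The Neumann Laplacian of a rectangle is diagonal in the products of cosines, with eigenvalues
`-eig a k`. All are negative except the simple eigenvalue 0 of the constant mode. The filament sees
that mode: its output is a positive constant times the positive length of `σ`. The only mode that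
does not decay by itself can therefore be stabilised by a weak rank one output feedback. Take a
smooth bump supported in the subrectangle, with positive mean, and scale it down to a gain `h`. The
error `e = w - z` obeys `e' = Δe - h Ce`. To leading order in `h` the zero eigenvalue moves to
`-h₀γ₀`, where `h₀` is the mean coefficient of `h` and `γ₀` the output of the constant mode, while
the spectral gap keeps the other modes stable. The error then decays in `H¹` of the whole rectangle,
and a fortiori in `H¹` of the subrectangle.

Everything is done on coefficients. Completeness of the cosines (Stone–Weierstrass) and Green's
formula against the modes give Parseval's identity in `H¹` with the weights `1 + eig a k`. A weak
solution tested with a mode satisfies a scalar linear equation, so its coefficients are given by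
Duhamel's formula (`IsSolution.coef_eq`). Conversely these coefficients define a solution
(`exists_isSolution`).

The delicate object is the output. In two dimensions the coefficients of an `H¹` function need not
be absolutely summable, so the output series may fail to converge absolutely at time 0. For positive
times the heat flow makes it converge. Integration over time replaces `exp (-l t)` by `1 / l`, and
`∑ |z k| / eig a k` is finite by Cauchy–Schwarz, because `∑ (eig a k)⁻²` converges in dimension two.
Outputs are thus integrable in time, and all estimates of inputs are made in weighted `L¹` norms in
time. The coefficients of `h` are absolutely summable, so the feedback kernel is bounded and the
closed loop reduces to a Volterra equation (`exists_volterra`).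

The decay is `abs_le_of_small_feedback`. The zero mode, the output of the remaining modes and the
input bound one another in weighted norms, and smallness of the gain closes the loop. It is applied
to the difference of two observers of the same output. Equal initial data give uniqueness. A state
is an observer of its own output, which gives the error estimate. -/

noncomputable section

namespace FilamentObs

/-! ### The scalar Duhamel integral -/

/-- Integrability on bounded subintervals of the half line. -/
def LocInt (u : ℝ → ℝ) : Prop := ∀ t, 0 < t → IntervalIntegrable u volume 0 t

lemma LocInt.intervalIntegrable {u : ℝ → ℝ} (hu : LocInt u) {s t : ℝ} (hs : 0 ≤ s) (ht : 0 ≤ t) :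
    IntervalIntegrable u volume s t := by
  have key : ∀ r, 0 ≤ r → IntervalIntegrable u volume 0 r := by
    intro r hr
    rcases hr.eq_or_lt with rfl | h
    · simp
    · exact hu r h
  exact (key s hs).symm.trans (key t ht)

lemma LocInt.mul_continuous {u : ℝ → ℝ} (hu : LocInt u) {g : ℝ → ℝ} (hg : Continuous g) :
    LocInt (fun s => g s * u s) :=
  fun t ht => (hu t ht).continuousOn_mul hg.continuousOn

lemma LocInt.abs {u : ℝ → ℝ} (hu : LocInt u) : LocInt (fun s => |u s|) := fun t ht => (hu t ht).abs

lemma LocInt.of_continuousOn {u : ℝ → ℝ} (hu : ContinuousOn u (Ici 0)) : LocInt u := by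
  intro t ht
  apply ContinuousOn.intervalIntegrable
  rw [uIcc_of_le ht.le]
  exact hu.mono (fun x hx => hx.1)

lemma LocInt.add {u v : ℝ → ℝ} (hu : LocInt u) (hv : LocInt v) : LocInt (fun s => u s + v s) :=
  fun t ht => (hu t ht).add (hv t ht)

lemma LocInt.sub {u v : ℝ → ℝ} (hu : LocInt u) (hv : LocInt v) : LocInt (fun s => u s - v s) :=
  fun t ht => (hu t ht).sub (hv t ht)

lemma LocInt.neg {u : ℝ → ℝ} (hu : LocInt u) : LocInt (fun s => -u s) :=
  fun t ht => (hu t ht).neg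

lemma LocInt.const_mul {u : ℝ → ℝ} (hu : LocInt u) (c : ℝ) : LocInt (fun s => c * u s) :=
  fun t ht => (hu t ht).const_mul c

lemma LocInt.congr {u v : ℝ → ℝ} (hu : LocInt u) (h : ∀ t, 0 < t → u t = v t) : LocInt v := by
  intro t ht
  refine (hu t ht).congr ?_
  intro s hs
  rw [uIoc_of_le ht.le] at hs
  exact h s hs.1

lemma integral_congr_Ioi {u v : ℝ → ℝ} (h : ∀ t, 0 < t → u t = v t) {t : ℝ} (ht : 0 ≤ t) :
    ∫ s in (0 : ℝ)..t, u s = ∫ s in (0 : ℝ)..t, v s := by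
  apply intervalIntegral.integral_congr_ae
  refine Eventually.of_forall fun s hs => ?_
  rw [uIoc_of_le ht] at hs
  exact h s hs.1

lemma integral_mono_Ioi {u v : ℝ → ℝ} (hu : LocInt u) (hv : LocInt v)
    (h : ∀ t, 0 < t → u t ≤ v t) {t : ℝ} (ht : 0 ≤ t) :
    ∫ s in (0 : ℝ)..t, u s ≤ ∫ s in (0 : ℝ)..t, v s := by
  rw [intervalIntegral.integral_of_le ht, intervalIntegral.integral_of_le ht]
  apply setIntegral_mono_on ((hu.intervalIntegrable le_rfl ht).1)
    ((hv.intervalIntegrable le_rfl ht).1) measurableSet_Ioc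
  exact fun s hs => h s hs.1

lemma LocInt.continuousOn_primitive {u : ℝ → ℝ} (hu : LocInt u) :
    ContinuousOn (fun t => ∫ s in (0 : ℝ)..t, u s) (Ici 0) := by
  intro t ht
  have h1 := intervalIntegral.continuousOn_primitive_interval'
    (hu.intervalIntegrable le_rfl (t := t + 1) (by have := mem_Ici.1 ht; linarith)) left_mem_uIcc
  have ht0 : (0 : ℝ) ≤ t := ht
  rw [uIcc_of_le (by linarith)] at h1
  refine (h1 t ⟨ht0, by linarith⟩).mono_of_mem_nhdsWithin ?_
  rw [mem_nhdsWithin]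
  exact ⟨Iio (t + 1), isOpen_Iio, by simp, fun x hx => ⟨hx.2, (mem_Iio.1 hx.1).le⟩⟩

lemma LocInt.abs_integral_le {u : ℝ → ℝ} {t : ℝ} (ht : 0 ≤ t) :
    |∫ s in (0 : ℝ)..t, u s| ≤ ∫ s in (0 : ℝ)..t, |u s| :=
  intervalIntegral.abs_integral_le_integral_abs ht

lemma LocInt.integral_abs_mono {u : ℝ → ℝ} (hu : LocInt u) {s t : ℝ} (hs : 0 ≤ s) (hst : s ≤ t) :
    ∫ r in (0 : ℝ)..s, |u r| ≤ ∫ r in (0 : ℝ)..t, |u r| :=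
  intervalIntegral.integral_mono_interval le_rfl hs hst
    (Eventually.of_forall fun _ => abs_nonneg _)
    (hu.abs.intervalIntegrable le_rfl (hs.trans hst))

/-- The response at time `t` of the equation `c' = -l c + u`, `c 0 = 0`. -/
def duhamel (l : ℝ) (u : ℝ → ℝ) (t : ℝ) : ℝ := ∫ s in (0 : ℝ)..t, Real.exp (-l * (t - s)) * u s

lemma duhamel_zero_right (l : ℝ) (u : ℝ → ℝ) : duhamel l u 0 = 0 := by simp [duhamel]

lemma duhamel_zero_left (u : ℝ → ℝ) (t : ℝ) : duhamel 0 u t = ∫ s in (0 : ℝ)..t, u s := by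
  simp [duhamel]

/-- Here `t` enters the integral only through its upper limit, which is the form needed for
continuity and differentiation. -/
lemma duhamel_eq (l : ℝ) (u : ℝ → ℝ) (t : ℝ) :
    duhamel l u t = Real.exp (-l * t) * ∫ s in (0 : ℝ)..t, Real.exp (l * s) * u s := by
  rw [duhamel, ← intervalIntegral.integral_const_mul]
  congr 1; ext s
  rw [← mul_assoc, ← Real.exp_add]; congr 2; ring

lemma LocInt.duhamel_kernel {u : ℝ → ℝ} (hu : LocInt u) (l t : ℝ) :
    LocInt (fun s => Real.exp (-l * (t - s)) * u s) :=
  hu.mul_continuous (by fun_prop)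

lemma duhamel_add {u v : ℝ → ℝ} (hu : LocInt u) (hv : LocInt v) (l : ℝ) {t : ℝ} (ht : 0 ≤ t) :
    duhamel l (fun s => u s + v s) t = duhamel l u t + duhamel l v t := by
  simp only [duhamel]
  rw [← intervalIntegral.integral_add ((hu.duhamel_kernel l t).intervalIntegrable le_rfl ht)
    ((hv.duhamel_kernel l t).intervalIntegrable le_rfl ht)]
  simp only [mul_add]

lemma duhamel_const_mul (u : ℝ → ℝ) (c l : ℝ) (t : ℝ) :
    duhamel l (fun s => c * u s) t = c * duhamel l u t := by
  simp only [duhamel]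
  rw [← intervalIntegral.integral_const_mul]
  congr 1; ext s; ring

lemma duhamel_neg (u : ℝ → ℝ) (l : ℝ) (t : ℝ) :
    duhamel l (fun s => -u s) t = -duhamel l u t := by
  have := duhamel_const_mul u (-1) l t
  simpa using this

lemma duhamel_sub {u v : ℝ → ℝ} (hu : LocInt u) (hv : LocInt v) (l : ℝ) {t : ℝ} (ht : 0 ≤ t) :
    duhamel l (fun s => u s - v s) t = duhamel l u t - duhamel l v t := by
  have := duhamel_add hu hv.neg l ht
  rw [duhamel_neg] at this
  simpa [sub_eq_add_neg] using this

lemma continuousOn_duhamel {u : ℝ → ℝ} (hu : LocInt u) (l : ℝ) :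
    ContinuousOn (duhamel l u) (Ici 0) := by
  have h : duhamel l u =
      fun t => Real.exp (-l * t) * ∫ s in (0 : ℝ)..t, Real.exp (l * s) * u s :=
    funext fun t => duhamel_eq l u t
  rw [h]
  exact (by fun_prop : Continuous fun t : ℝ => Real.exp (-l * t)).continuousOn.mul
    (hu.mul_continuous (by fun_prop)).continuousOn_primitive

/-- Weighted pointwise bound of the response. -/
lemma exp_mul_abs_duhamel_le (u : ℝ → ℝ) (l κ : ℝ) {t : ℝ} (ht : 0 ≤ t) :
    Real.exp (κ * t) * |duhamel l u t| ≤
      duhamel (l - κ) (fun s => Real.exp (κ * s) * |u s|) t := by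
  rw [duhamel]
  refine (mul_le_mul_of_nonneg_left (LocInt.abs_integral_le ht) (Real.exp_pos _).le).trans ?_
  rw [← intervalIntegral.integral_const_mul, duhamel]
  apply le_of_eq
  congr 1; ext s
  rw [abs_mul, abs_of_pos (Real.exp_pos _), ← mul_assoc, ← mul_assoc, ← Real.exp_add,
    ← Real.exp_add]
  congr 2; ring

lemma duhamel_le_integral {m : ℝ → ℝ} (hm : LocInt m) (hm0 : ∀ s, 0 ≤ m s) {l : ℝ} (hl : 0 ≤ l)
    {t : ℝ} (ht : 0 ≤ t) : duhamel l m t ≤ ∫ s in (0 : ℝ)..t, m s := by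
  apply intervalIntegral.integral_mono_on ht
    ((hm.duhamel_kernel l t).intervalIntegrable le_rfl ht) (hm.intervalIntegrable le_rfl ht)
  intro s hs
  have : Real.exp (-l * (t - s)) ≤ 1 := by
    rw [Real.exp_le_one_iff]; nlinarith [hs.2]
  exact mul_le_of_le_one_left (hm0 s) this

lemma duhamel_nonneg {m : ℝ → ℝ} (hm0 : ∀ s, 0 ≤ m s) (l : ℝ) {t : ℝ} (ht : 0 ≤ t) :
    0 ≤ duhamel l m t :=
  intervalIntegral.integral_nonneg ht fun s _ => mul_nonneg (Real.exp_pos _).le (hm0 s)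

/-- The weight lowers the decay rate from `l` to `l - κ`, which is still nonnegative, so the kernel
remains at most one. -/
lemma exp_mul_abs_duhamel_le_integral {u : ℝ → ℝ} (hu : LocInt u) {l κ : ℝ} (h : κ ≤ l) {t : ℝ}
    (ht : 0 ≤ t) :
    Real.exp (κ * t) * |duhamel l u t| ≤ ∫ s in (0 : ℝ)..t, Real.exp (κ * s) * |u s| :=
  (exp_mul_abs_duhamel_le u l κ ht).trans
    (duhamel_le_integral (hu.abs.mul_continuous (by fun_prop))
      (fun s => mul_nonneg (Real.exp_pos _).le (abs_nonneg _)) (sub_nonneg.2 h) ht)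

lemma abs_duhamel_le {u : ℝ → ℝ} (hu : LocInt u) {l : ℝ} (hl : 0 ≤ l) {t : ℝ} (ht : 0 ≤ t) :
    |duhamel l u t| ≤ ∫ s in (0 : ℝ)..t, |u s| := by
  simpa using exp_mul_abs_duhamel_le_integral hu (κ := 0) hl ht

/-- The response solves the integrated equation. -/
lemma duhamel_integral_eq {u : ℝ → ℝ} (hu : LocInt u) (l : ℝ) {t : ℝ} (ht : 0 ≤ t) :
    duhamel l u t = -l * (∫ s in (0 : ℝ)..t, duhamel l u s) + ∫ s in (0 : ℝ)..t, u s := by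
  have hu' : LocInt (fun s => Real.exp (l * s) * u s) := hu.mul_continuous (by fun_prop)
  have hi := hu'.intervalIntegrable le_rfl ht
  -- As `u` is merely integrable, the product rule holds only almost everywhere. Absolute continuity
  -- is what allows the derivative to be integrated back.
  have hac := hi.absolutelyContinuousOnInterval_intervalIntegral (c := 0) left_mem_uIcc
  have hexp : ContDiff ℝ 1 (fun t : ℝ => Real.exp (-l * t)) := by fun_prop
  have hac2 : AbsolutelyContinuousOnInterval (fun t : ℝ => Real.exp (-l * t)) 0 t :=
    hexp.contDiffOn.absolutelyContinuousOnInterval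
  have hac3 : AbsolutelyContinuousOnInterval (duhamel l u) 0 t := by
    have h := hac2.fun_mul hac
    rwa [← funext (fun t => duhamel_eq l u t)] at h
  have h1 := hac3.integral_deriv_eq_sub
  rw [duhamel_zero_right, sub_zero] at h1
  rw [← h1, ← intervalIntegral.integral_const_mul, ← intervalIntegral.integral_add
    ((LocInt.of_continuousOn (continuousOn_duhamel hu l)).const_mul _ |>.intervalIntegrable
      le_rfl ht) (hu.intervalIntegrable le_rfl ht)]
  apply intervalIntegral.integral_congr_ae
  filter_upwards [hi.ae_hasDerivAt_integral] with x hx hx'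
  have hx2 := hx (uIoc_subset_uIcc hx') 0 left_mem_uIcc
  have hx3 : HasDerivAt (fun t : ℝ => Real.exp (-l * t)) (Real.exp (-l * x) * -l) x := by
    simpa using ((hasDerivAt_id x).const_mul (-l)).exp
  have hx4 := hx3.mul hx2
  have h5 : ((fun t : ℝ => Real.exp (-l * t)) * fun t => ∫ s in (0 : ℝ)..t, Real.exp (l * s) * u s)
      = duhamel l u := by
    ext t; simp [duhamel_eq]
  rw [h5] at hx4
  rw [hx4.deriv, duhamel_eq, ← mul_assoc, ← Real.exp_add]
  have : -l * x + l * x = 0 := by ring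
  rw [this, Real.exp_zero]; ring

/-- The integrated equation `c(t) = c₀ - l ∫ c + ∫ v` has only the solution given by Duhamel's
formula. -/
lemma eq_duhamel_of_integral_eq {c v : ℝ → ℝ} (hc : ContinuousOn c (Ici 0)) (hv : LocInt v)
    {l c₀ : ℝ}
    (h : ∀ t, 0 ≤ t → c t = c₀ - l * (∫ s in (0 : ℝ)..t, c s) + ∫ s in (0 : ℝ)..t, v s)
    {t : ℝ} (ht : 0 ≤ t) : c t = Real.exp (-l * t) * c₀ + duhamel l v t := by
  have hcI := LocInt.of_continuousOn hc
  have hg : LocInt (fun s => -l * c s + v s) := (hcI.const_mul _).add hv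
  have hi := hg.intervalIntegrable le_rfl ht
  have hac := hi.absolutelyContinuousOnInterval_intervalIntegral (c := 0) left_mem_uIcc
  have hexp : ContDiff ℝ 1 (fun t : ℝ => Real.exp (l * t)) := by fun_prop
  have hac2 : AbsolutelyContinuousOnInterval (fun t : ℝ => Real.exp (l * t)) 0 t :=
    hexp.contDiffOn.absolutelyContinuousOnInterval
  have hconst : ContDiff ℝ 1 (fun _ : ℝ => c₀) := contDiff_const
  have hac4 : AbsolutelyContinuousOnInterval (fun _ : ℝ => c₀) 0 t :=
    hconst.contDiffOn.absolutelyContinuousOnInterval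
  -- Integrating factor: `exp (l x) * c x` is absolutely continuous, and almost everywhere its
  -- derivative is `exp (l x) * v x`.
  have hac5 := hac2.fun_mul (hac4.fun_add hac)
  have hcG : ∀ r, 0 ≤ r → c r = c₀ + ∫ s in (0 : ℝ)..r, (-l * c s + v s) := by
    intro r hr
    rw [h r hr, intervalIntegral.integral_add ((hcI.const_mul _).intervalIntegrable le_rfl hr)
      (hv.intervalIntegrable le_rfl hr), intervalIntegral.integral_const_mul]
    ring
  have h1 := hac5.integral_deriv_eq_sub
  rw [intervalIntegral.integral_same, mul_zero, Real.exp_zero, add_zero, one_mul, ← hcG t ht] at h1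
  have h2 : ∫ x in (0 : ℝ)..t, deriv (fun x => Real.exp (l * x) *
      (c₀ + ∫ s in (0 : ℝ)..x, (-l * c s + v s))) x = ∫ x in (0 : ℝ)..t, Real.exp (l * x) * v x := by
    apply intervalIntegral.integral_congr_ae
    filter_upwards [hi.ae_hasDerivAt_integral] with x hx hx'
    have hx2 := hx (uIoc_subset_uIcc hx') 0 left_mem_uIcc
    have hx3 : HasDerivAt (fun t : ℝ => Real.exp (l * t)) (Real.exp (l * x) * l) x := by
      simpa using ((hasDerivAt_id x).const_mul l).exp
    have hx4 := hx3.mul (hx2.const_add c₀)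
    rw [uIoc_of_le ht] at hx'
    refine hx4.deriv.trans ?_
    simp only [← hcG x hx'.1.le]
    ring
  rw [h2] at h1
  rw [duhamel_eq, h1, mul_sub, ← mul_assoc, ← Real.exp_add]
  have : -l * t + l * t = 0 := by ring
  rw [this, Real.exp_zero]; ring

/-- Weighted `L¹` bound of the response. -/
lemma integral_exp_mul_abs_duhamel_le {u : ℝ → ℝ} (hu : LocInt u) {l κ : ℝ} (h : κ < l) {T : ℝ}
    (hT : 0 ≤ T) :
    ∫ t in (0 : ℝ)..T, Real.exp (κ * t) * |duhamel l u t| ≤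
      (l - κ)⁻¹ * ∫ s in (0 : ℝ)..T, Real.exp (κ * s) * |u s| := by
  set m : ℝ → ℝ := fun s => Real.exp (κ * s) * |u s| with hm
  have hmI : LocInt m := hu.abs.mul_continuous (by fun_prop)
  have hm0 : ∀ s, 0 ≤ m s := fun s => mul_nonneg (Real.exp_pos _).le (abs_nonneg _)
  have hpos : 0 < l - κ := sub_pos.2 h
  have h1 : ∫ t in (0 : ℝ)..T, Real.exp (κ * t) * |duhamel l u t| ≤
      ∫ t in (0 : ℝ)..T, duhamel (l - κ) m t :=
    integral_mono_Ioi ((LocInt.of_continuousOn (continuousOn_duhamel hu l)).abs.mul_continuous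
      (by fun_prop)) (LocInt.of_continuousOn (continuousOn_duhamel hmI _))
      (fun t ht => exp_mul_abs_duhamel_le u l κ ht.le) hT
  -- The integrated equation says `(l - κ) ∫ response = ∫ m - response T`, and the last term is
  -- nonnegative. This replaces an exchange of integrals.
  have h2 := duhamel_integral_eq hmI (l - κ) hT
  have h3 := duhamel_nonneg hm0 (l - κ) hT
  refine h1.trans ?_
  rw [inv_mul_eq_div, le_div_iff₀ hpos]
  linarith

/-! ### Sums of Duhamel integrals and a Volterra equation -/

/-- A weighted sum of Duhamel integrals with decay rates `l`. -/
def response {ι : Type*} (a l : ι → ℝ) (u : ℝ → ℝ) (t : ℝ) : ℝ := ∑' k, a k * duhamel (l k) u t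

section response

variable {ι : Type*} {a l : ι → ℝ}

lemma summable_response (hl : ∀ k, 0 ≤ l k) (ha : Summable fun k => |a k|) {u : ℝ → ℝ}
    (hu : LocInt u) {t : ℝ} (ht : 0 ≤ t) : Summable fun k => a k * duhamel (l k) u t := by
  refine (ha.mul_right (∫ s in (0 : ℝ)..t, |u s|)).of_norm_bounded fun k => ?_
  rw [Real.norm_eq_abs, abs_mul]
  exact mul_le_mul_of_nonneg_left (abs_duhamel_le hu (hl k) ht) (abs_nonneg _)

lemma abs_response_le (hl : ∀ k, 0 ≤ l k) (ha : Summable fun k => |a k|) {u : ℝ → ℝ}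
    (hu : LocInt u) {t : ℝ} (ht : 0 ≤ t) :
    |response a l u t| ≤ (∑' k, |a k|) * ∫ s in (0 : ℝ)..t, |u s| := by
  rw [← tsum_mul_right]
  refine (Real.norm_eq_abs _).symm.trans_le
    (tsum_of_norm_bounded (ha.mul_right (∫ s in (0 : ℝ)..t, |u s|)).hasSum fun k => ?_)
  rw [Real.norm_eq_abs, abs_mul]
  exact mul_le_mul_of_nonneg_left (abs_duhamel_le hu (hl k) ht) (abs_nonneg _)

lemma response_sub (hl : ∀ k, 0 ≤ l k) (ha : Summable fun k => |a k|) {u v : ℝ → ℝ}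
    (hu : LocInt u) (hv : LocInt v) {t : ℝ} (ht : 0 ≤ t) :
    response a l (fun s => u s - v s) t = response a l u t - response a l v t := by
  simp only [response]
  rw [← (summable_response hl ha hu ht).tsum_sub (summable_response hl ha hv ht)]
  congr 1; ext k; rw [duhamel_sub hu hv _ ht]; ring

lemma continuousOn_response (hl : ∀ k, 0 ≤ l k) (ha : Summable fun k => |a k|) {u : ℝ → ℝ}
    (hu : LocInt u) : ContinuousOn (response a l u) (Ici 0) := by
  intro t ht
  have ht0 : (0 : ℝ) ≤ t := ht
  have h1 : ContinuousOn (response a l u) (Icc 0 (t + 1)) := by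
    refine continuousOn_tsum (u := fun k => |a k| * ∫ s in (0 : ℝ)..(t + 1), |u s|)
      (fun k => ((continuousOn_duhamel hu (l k)).mono Icc_subset_Ici_self).const_mul _)
      (ha.mul_right _) ?_
    intro k s hs
    rw [Real.norm_eq_abs, abs_mul]
    exact mul_le_mul_of_nonneg_left ((abs_duhamel_le hu (hl k) hs.1).trans
      (hu.integral_abs_mono hs.1 hs.2)) (abs_nonneg _)
  refine (h1 t ⟨ht0, by linarith⟩).mono_of_mem_nhdsWithin ?_
  rw [mem_nhdsWithin]
  exact ⟨Iio (t + 1), isOpen_Iio, by simp, fun x hx => ⟨hx.2, (mem_Iio.1 hx.1).le⟩⟩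

lemma duhamel_anti {m : ℝ → ℝ} (hm : LocInt m) (hm0 : ∀ s, 0 ≤ m s) {r s : ℝ} (h : r ≤ s)
    {t : ℝ} (ht : 0 ≤ t) : duhamel s m t ≤ duhamel r m t := by
  apply intervalIntegral.integral_mono_on ht
    ((hm.duhamel_kernel s t).intervalIntegrable le_rfl ht)
    ((hm.duhamel_kernel r t).intervalIntegrable le_rfl ht)
  intro x hx
  refine mul_le_mul_of_nonneg_right (Real.exp_le_exp.2 ?_) (hm0 x)
  nlinarith [hx.2]

lemma integral_duhamel_le {m : ℝ → ℝ} (hm : LocInt m) (hm0 : ∀ s, 0 ≤ m s) {d : ℝ} (hd : 0 < d)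
    {T : ℝ} (hT : 0 ≤ T) :
    ∫ t in (0 : ℝ)..T, duhamel d m t ≤ d⁻¹ * ∫ s in (0 : ℝ)..T, m s := by
  have h2 := duhamel_integral_eq hm d hT
  have h3 := duhamel_nonneg hm0 d hT
  rw [inv_mul_eq_div, le_div_iff₀ hd]
  linarith

/-- Weighted `L¹` bound of the response. -/
lemma integral_exp_mul_abs_response_le {κ d : ℝ} (hd : 0 < d) (hl : ∀ k, 0 ≤ l k)
    (hld : ∀ k, a k ≠ 0 → κ + d ≤ l k)
    (ha : Summable fun k => |a k|) {u : ℝ → ℝ} (hu : LocInt u) {T : ℝ} (hT : 0 ≤ T) :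
    ∫ t in (0 : ℝ)..T, Real.exp (κ * t) * |response a l u t| ≤
      (∑' k, |a k|) * d⁻¹ * ∫ s in (0 : ℝ)..T, Real.exp (κ * s) * |u s| := by
  set m : ℝ → ℝ := fun s => Real.exp (κ * s) * |u s| with hm
  have hmI : LocInt m := hu.abs.mul_continuous (by fun_prop)
  have hm0 : ∀ s, 0 ≤ m s := fun s => mul_nonneg (Real.exp_pos _).le (abs_nonneg _)
  have hpt : ∀ t, 0 < t → Real.exp (κ * t) * |response a l u t| ≤
      (∑' k, |a k|) * duhamel d m t := by
    intro t ht
    rw [← tsum_mul_right, ← abs_of_pos (Real.exp_pos (κ * t)), ← abs_mul, response, ← tsum_mul_left]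
    refine (Real.norm_eq_abs _).symm.trans_le
      (tsum_of_norm_bounded (ha.mul_right _).hasSum fun k => ?_)
    rw [Real.norm_eq_abs, abs_mul, abs_mul, abs_of_pos (Real.exp_pos (κ * t)), mul_left_comm]
    -- The rate bound is required only where the weight is nonzero, so the constant mode may stay in
    -- the index set with weight zero.
    by_cases hk : a k = 0
    · simp [hk]
    refine mul_le_mul_of_nonneg_left ((exp_mul_abs_duhamel_le u (l k) κ ht.le).trans ?_)
      (abs_nonneg _)
    exact duhamel_anti hmI hm0 (by linarith [hld k hk]) ht.le
  refine (integral_mono_Ioi ((LocInt.of_continuousOn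
    (continuousOn_response hl ha hu)).abs.mul_continuous (by fun_prop))
    ((LocInt.of_continuousOn (continuousOn_duhamel hmI d)).const_mul _) hpt hT).trans ?_
  rw [intervalIntegral.integral_const_mul, mul_assoc]
  exact mul_le_mul_of_nonneg_left (integral_duhamel_le hmI hm0 hd hT)
    (tsum_nonneg fun k => abs_nonneg _)

lemma integral_exp_mul {A : ℝ} (hA : A ≠ 0) (t : ℝ) :
    ∫ s in (0 : ℝ)..t, Real.exp (A * s) = (Real.exp (A * t) - 1) / A := by
  rw [intervalIntegral.integral_comp_mul_left _ hA, integral_exp, smul_eq_mul, mul_zero,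
    Real.exp_zero, inv_mul_eq_div]

/-- The Volterra equation `u = f - response u`. -/
theorem exists_volterra (hl : ∀ k, 0 ≤ l k) (ha : Summable fun k => |a k|) {f : ℝ → ℝ}
    (hf : LocInt f) {C : ℝ} (hC : ∀ t, 0 ≤ t → ∫ s in (0 : ℝ)..t, |f s| ≤ C * (1 + t)) :
    ∃ u, LocInt u ∧ ∀ t, 0 < t → u t = f t - response a l u t := by
  set K := ∑' k, |a k| with hK
  have hK0 : 0 ≤ K := tsum_nonneg fun k => abs_nonneg _
  -- The kernel is bounded by `K`, so under the weight `exp (-A t)` the map contracts by `K / A ≤ 1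
  -- / 2`. Also `A ≥ 1` lets the weight absorb the growth `1 + t` of the integral of `|f|`.
  set A := 2 * K + 1 with hA
  have hA1 : 1 ≤ A := by linarith
  have hA0 : 0 < A := by linarith
  have hC0 : 0 ≤ C := by simpa using hC 0 le_rfl
  -- The unknown is `u - f`, which is continuous although `f` is only integrable. Divided by `exp (A
  -- s)` it becomes the bounded continuous function `p`.
  let m : BoundedContinuousFunction ℝ ℝ → ℝ → ℝ := fun p s => Real.exp (A * s) * p s
  have hm : ∀ p, LocInt (m p) := fun p =>
    LocInt.of_continuousOn (by fun_prop : Continuous fun s => Real.exp (A * s) * p s).continuousOn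
  have hmb : ∀ (p : BoundedContinuousFunction ℝ ℝ) (b : ℝ), (∀ s, |p s| ≤ b) → ∀ t, 0 ≤ t →
      ∫ s in (0 : ℝ)..t, |m p s| ≤ b * (Real.exp (A * t) / A) := by
    intro p b hb t ht
    have hb0 : 0 ≤ b := (abs_nonneg _).trans (hb 0)
    have h1 : ∫ s in (0 : ℝ)..t, |m p s| ≤ ∫ s in (0 : ℝ)..t, b * Real.exp (A * s) := by
      refine integral_mono_Ioi (hm p).abs (LocInt.of_continuousOn (by fun_prop)) ?_ ht
      intro s _
      simp only [m, abs_mul, abs_of_pos (Real.exp_pos _)]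
      rw [mul_comm]
      exact mul_le_mul_of_nonneg_right (hb s) (Real.exp_pos _).le
    refine h1.trans ?_
    rw [intervalIntegral.integral_const_mul, integral_exp_mul hA0.ne']
    refine mul_le_mul_of_nonneg_left ?_ hb0
    gcongr; linarith
  -- Freezing negative times at 0 by `max t 0` makes the image a function on the whole line.
  let T : BoundedContinuousFunction ℝ ℝ → ℝ → ℝ := fun p t =>
    -(Real.exp (-A * max t 0) * response a l (fun s => f s + m p s) (max t 0))
  have hTc : ∀ p, Continuous (T p) := by
    intro p
    have h1 : Continuous fun t : ℝ => response a l (fun s => f s + m p s) (max t 0) :=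
      (continuousOn_response hl ha (hf.add (hm p))).comp_continuous (by fun_prop)
        (fun t => mem_Ici.2 (le_max_right _ _))
    exact ((by fun_prop : Continuous fun t : ℝ => Real.exp (-A * max t 0)).mul h1).neg
  have hexp : ∀ t : ℝ, Real.exp (-A * t) * Real.exp (A * t) = 1 := by
    intro t; rw [← Real.exp_add]; simp
  have hTb : ∀ (p : BoundedContinuousFunction ℝ ℝ) t, ‖T p t‖ ≤ K * (C + ‖p‖ / A) := by
    intro p t
    have ht : 0 ≤ max t 0 := le_max_right _ _
    generalize hr : max t 0 = r at ht
    simp only [T, hr, norm_neg, Real.norm_eq_abs, abs_mul, abs_of_pos (Real.exp_pos _)]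
    have h1 := abs_response_le hl ha (hf.add (hm p)) ht
    have h2 : ∫ s in (0 : ℝ)..r, |f s + m p s| ≤
        (∫ s in (0 : ℝ)..r, |f s|) + ∫ s in (0 : ℝ)..r, |m p s| := by
      rw [← intervalIntegral.integral_add (hf.abs.intervalIntegrable le_rfl ht)
        ((hm p).abs.intervalIntegrable le_rfl ht)]
      exact integral_mono_Ioi (hf.add (hm p)).abs (hf.abs.add (hm p).abs)
        (fun s _ => abs_add_le _ _) ht
    have h3 := hmb p ‖p‖ (fun s => p.norm_coe_le_norm s) r ht
    have h4 : 1 + r ≤ Real.exp (A * r) := by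
      have := Real.add_one_le_exp (A * r)
      nlinarith
    have h5 : ∫ s in (0 : ℝ)..r, |f s + m p s| ≤ (C + ‖p‖ / A) * Real.exp (A * r) := by
      have := hC r ht
      have h6 : C * (1 + r) ≤ C * Real.exp (A * r) := mul_le_mul_of_nonneg_left h4 hC0
      calc _ ≤ C * Real.exp (A * r) + ‖p‖ * (Real.exp (A * r) / A) := by linarith
        _ = _ := by ring
    calc Real.exp (-A * r) * |response a l (fun s => f s + m p s) r|
        ≤ Real.exp (-A * r) * (K * ((C + ‖p‖ / A) * Real.exp (A * r))) :=
          mul_le_mul_of_nonneg_left (h1.trans (mul_le_mul_of_nonneg_left h5 hK0))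
            (Real.exp_pos _).le
      _ = K * (C + ‖p‖ / A) * (Real.exp (-A * r) * Real.exp (A * r)) := by ring
      _ = _ := by rw [hexp, mul_one]
  let Φ : BoundedContinuousFunction ℝ ℝ → BoundedContinuousFunction ℝ ℝ := fun p =>
    BoundedContinuousFunction.ofNormedAddCommGroup (T p) (hTc p) _ (hTb p)
  have hΦ : ContractingWith (1 / 2) Φ := by
    refine ⟨by rw [← NNReal.coe_lt_coe]; norm_num, LipschitzWith.of_dist_le_mul fun p q => ?_⟩
    rw [BoundedContinuousFunction.dist_le (by positivity)]
    intro t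
    have ht : 0 ≤ max t 0 := le_max_right _ _
    change dist (T p t) (T q t) ≤ _
    generalize hr : max t 0 = r at ht
    simp only [T, hr]
    rw [Real.dist_eq, neg_sub_neg, ← mul_sub, ← response_sub hl ha (hf.add (hm q))
      (hf.add (hm p)) ht, abs_mul, abs_of_pos (Real.exp_pos _)]
    have e : (fun s => f s + m q s - (f s + m p s)) = m (q - p) := by
      ext s; simp only [m, BoundedContinuousFunction.coe_sub, Pi.sub_apply]; ring
    rw [e]
    have h1 := abs_response_le hl ha (hm (q - p)) ht
    have h3 := hmb (q - p) (dist p q) (fun s => by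
      rw [dist_comm, dist_eq_norm]; exact (q - p).norm_coe_le_norm s) r ht
    calc Real.exp (-A * r) * |response a l (m (q - p)) r|
        ≤ Real.exp (-A * r) * (K * (dist p q * (Real.exp (A * r) / A))) :=
          mul_le_mul_of_nonneg_left (h1.trans (mul_le_mul_of_nonneg_left h3 hK0))
            (Real.exp_pos _).le
      _ = K / A * dist p q * (Real.exp (-A * r) * Real.exp (A * r)) := by ring
      _ = K / A * dist p q := by rw [hexp, mul_one]
      _ ≤ _ := by
        refine mul_le_mul_of_nonneg_right ?_ dist_nonneg
        rw [div_le_iff₀ hA0]; push_cast; linarith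
  set p := hΦ.fixedPoint Φ with hp
  have hfix : Φ p = p := hΦ.fixedPoint_isFixedPt
  refine ⟨fun s => f s + m p s, hf.add (hm p), fun t ht => ?_⟩
  have h1 : p t = T p t := by
    conv_lhs => rw [← hfix]
    rfl
  have h2 : m p t = -response a l (fun s => f s + m p s) t := by
    simp only [m]
    rw [h1]
    simp only [T, max_eq_left ht.le]
    calc _ = -(Real.exp (-A * t) * Real.exp (A * t)) * response a l (fun s => f s + m p s) t := by
          ring
      _ = _ := by rw [hexp]; ring
  change f t + m p t = _
  rw [h2]; ring

end response

/-! ### Sums of decaying exponentials -/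

section expSum

variable {ι : Type*} [Countable ι]

/-- By Tonelli each exponential may be integrated separately, and its integral is at most `b k / d
k`. Rates are unconstrained where `b k = 0`, so that a mode of rate zero can be switched off. -/
lemma locInt_exp_sum {b d : ι → ℝ} (hb : ∀ k, 0 ≤ b k) (hd : ∀ k, b k ≠ 0 → 0 < d k)
    (hs : ∀ t, 0 < t → Summable fun k => b k * Real.exp (-d k * t))
    (hbd : Summable fun k => b k / d k) :
    LocInt (fun t => ∑' k, b k * Real.exp (-d k * t)) ∧
      ∀ T, 0 ≤ T → ∫ t in (0 : ℝ)..T, ∑' k, b k * Real.exp (-d k * t) ≤ ∑' k, b k / d k := by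
  have hF0 : ∀ k t, 0 ≤ b k * Real.exp (-d k * t) := fun k t =>
    mul_nonneg (hb k) (Real.exp_pos _).le
  have hint : ∀ k (T : ℝ), 0 ≤ T → ∫ t in (0 : ℝ)..T, b k * Real.exp (-d k * t) ≤ b k / d k := by
    intro k T hT
    by_cases hk : b k = 0
    · simp [hk]
    have hdk := hd k hk
    rw [intervalIntegral.integral_const_mul, integral_exp_mul (neg_ne_zero.2 hdk.ne'),
      div_eq_mul_inv (b k)]
    refine mul_le_mul_of_nonneg_left ?_ (hb k)
    rw [div_neg, ← neg_div, inv_eq_one_div]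
    gcongr
    linarith [Real.exp_pos (-d k * T)]
  have hFi : ∀ k (T : ℝ), 0 ≤ T →
      IntegrableOn (fun t => b k * Real.exp (-d k * t)) (Ioc 0 T) := by
    intro k T hT
    exact ((LocInt.of_continuousOn (by fun_prop :
      Continuous fun t : ℝ => b k * Real.exp (-d k * t)).continuousOn).intervalIntegrable
        le_rfl hT).1
  have hlin : ∀ T : ℝ, 0 ≤ T → ∫⁻ t in Ioc 0 T, ENNReal.ofReal (∑' k, b k * Real.exp (-d k * t)) ≤
      ENNReal.ofReal (∑' k, b k / d k) := by
    intro T hT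
    have h1 : ∫⁻ t in Ioc 0 T, ENNReal.ofReal (∑' k, b k * Real.exp (-d k * t)) =
        ∫⁻ t in Ioc 0 T, ∑' k, ENNReal.ofReal (b k * Real.exp (-d k * t)) := by
      refine setLIntegral_congr_fun measurableSet_Ioc fun t ht => ?_
      exact ENNReal.ofReal_tsum_of_nonneg (fun k => hF0 k t) (hs t ht.1)
    rw [h1, lintegral_tsum (fun k => by fun_prop), ENNReal.ofReal_tsum_of_nonneg (fun k => by
      by_cases hk : b k = 0
      · simp [hk]
      · exact div_nonneg (hb k) (hd k hk).le) hbd]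
    refine ENNReal.tsum_le_tsum fun k => ?_
    rw [← ofReal_integral_eq_lintegral_ofReal (hFi k T hT)
      (Eventually.of_forall fun t => hF0 k t), ← intervalIntegral.integral_of_le hT]
    exact ENNReal.ofReal_le_ofReal (hint k T hT)
  have hmeas : ∀ T : ℝ, AEMeasurable (fun t => ∑' k, b k * Real.exp (-d k * t))
      (volume.restrict (Ioc 0 T)) := by
    intro T
    -- The sum with values in `ENNReal` is measurable whether or not it is finite, and for `t > 0`
    -- it agrees with the real sum.
    have h1 : Measurable fun t => (∑' k, ENNReal.ofReal (b k * Real.exp (-d k * t))).toReal :=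
      (Measurable.tsum fun k => by fun_prop).ennreal_toReal
    refine h1.aemeasurable.congr ?_
    refine (ae_restrict_iff' measurableSet_Ioc).2 (Eventually.of_forall fun t ht => ?_)
    beta_reduce
    rw [← ENNReal.ofReal_tsum_of_nonneg (fun k => hF0 k t) (hs t ht.1),
      ENNReal.toReal_ofReal (tsum_nonneg fun k => hF0 k t)]
  have h0 : ∀ t, 0 ≤ ∑' k, b k * Real.exp (-d k * t) := fun t => tsum_nonneg fun k => hF0 k t
  refine ⟨fun T hT => ?_, fun T hT => ?_⟩
  · rw [intervalIntegrable_iff_integrableOn_Ioc_of_le hT.le]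
    refine ⟨(hmeas T).aestronglyMeasurable, ?_⟩
    rw [hasFiniteIntegral_iff_ofReal (Eventually.of_forall h0)]
    exact (hlin T hT.le).trans_lt ENNReal.ofReal_lt_top
  · rw [intervalIntegral.integral_of_le hT, integral_eq_lintegral_of_nonneg_ae
      (Eventually.of_forall h0) (hmeas T).aestronglyMeasurable]
    refine ENNReal.toReal_le_of_le_ofReal (tsum_nonneg fun k => ?_) (hlin T hT)
    by_cases hk : b k = 0
    · simp [hk]
    · exact div_nonneg (hb k) (hd k hk).le

end expSum

/-! ### The output of a diagonal semigroup -/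

/-- The output, with weights `γ`, of the diagonal semigroup with decay rates `l` at `z`. -/
def freeOutput {ι : Type*} (γ l z : ι → ℝ) (t : ℝ) : ℝ := ∑' k, γ k * (Real.exp (-l k * t) * z k)

section freeOutput

variable {ι : Type*} {γ l z : ι → ℝ}

lemma summable_freeOutput {B : ℝ} (hγ : ∀ k, |γ k| ≤ B) {t : ℝ}
    (hz : Summable fun k => |z k| * Real.exp (-l k * t)) :
    Summable fun k => γ k * (Real.exp (-l k * t) * z k) := by
  refine (hz.mul_left B).of_norm_bounded fun k => ?_
  rw [Real.norm_eq_abs, abs_mul, abs_mul, abs_of_pos (Real.exp_pos _), mul_comm |z k|]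
  exact mul_le_mul_of_nonneg_right (hγ k) (by positivity)

/-- Near `t > 0` the series is dominated by its terms at time `t / 2`. Time 0 is excluded, since `z`
itself need not be summable. -/
lemma continuousOn_freeOutput {B : ℝ} (hγ : ∀ k, |γ k| ≤ B) (hl : ∀ k, 0 ≤ l k)
    (hz : ∀ t, 0 < t → Summable fun k => |z k| * Real.exp (-l k * t)) :
    ContinuousOn (freeOutput γ l z) (Ioi 0) := by
  intro t ht
  have ht0 : (0 : ℝ) < t := ht
  have h1 : ContinuousOn (freeOutput γ l z) (Ici (t / 2)) := by
    refine continuousOn_tsum (fun k => by fun_prop) ((hz (t / 2) (by linarith)).mul_left B) ?_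
    intro k s hs
    have hB : 0 ≤ B := (abs_nonneg _).trans (hγ k)
    rw [Real.norm_eq_abs, abs_mul, abs_mul, abs_of_pos (Real.exp_pos _), mul_comm |z k|]
    refine mul_le_mul (hγ k) (mul_le_mul_of_nonneg_right (Real.exp_le_exp.2 ?_) (abs_nonneg _))
      (by positivity) hB
    have := mem_Ici.1 hs
    nlinarith [hl k]
  exact (h1.continuousAt (Ici_mem_nhds (by linarith))).continuousWithinAt

open Classical in
lemma tsum_mul_eq_add {γ f : ι → ℝ} (k₀ : ι) (h : Summable fun k => γ k * f k) :
    ∑' k, γ k * f k = γ k₀ * f k₀ + ∑' k, Function.update γ k₀ 0 k * f k := by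
  rw [h.tsum_eq_add_tsum_ite k₀]
  congr 2; ext k
  by_cases hk : k = k₀
  · simp [hk]
  · simp [hk]

lemma abs_update_zero_le [DecidableEq ι] (γ : ι → ℝ) (k₀ k : ι) :
    |Function.update γ k₀ 0 k| ≤ |γ k| := by
  by_cases hk : k = k₀
  · subst hk; simp
  · simp [hk]

variable {k₀ : ι}

open Classical in
lemma freeOutput_eq_add {B : ℝ} (hγ : ∀ k, |γ k| ≤ B) (hl0 : l k₀ = 0) {t : ℝ}
    (hz : Summable fun k => |z k| * Real.exp (-l k * t)) :
    freeOutput γ l z t = γ k₀ * z k₀ + freeOutput (Function.update γ k₀ 0) l z t := by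
  rw [freeOutput, tsum_mul_eq_add k₀ (summable_freeOutput hγ hz), hl0]
  simp [freeOutput]

variable [Countable ι]

/-- Since `κ ≤ lam / 2`, half of each decay rate absorbs the weight and the other half is integrated
over time, whence the factor 2. This takes the place of boundedness of the output: `∑ |z k| / l k`
may converge where `∑ |z k|` does not. -/
lemma locInt_freeOutput_tail {B lam κ : ℝ} (hB : 0 ≤ B) (hγ : ∀ k, |γ k| ≤ B) (hγ0 : γ k₀ = 0)
    (hl : ∀ k, 0 ≤ l k) (hlam : 0 < lam)
    (hl1 : ∀ k, k ≠ k₀ → lam ≤ l k) (hκ : 2 * κ ≤ lam)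
    (hz : ∀ t, 0 < t → Summable fun k => |z k| * Real.exp (-l k * t))
    (hz1 : Summable fun k => |z k| / l k) :
    LocInt (freeOutput γ l z) ∧ ∀ T, 0 ≤ T →
      ∫ t in (0 : ℝ)..T, Real.exp (κ * t) * |freeOutput γ l z t| ≤ 2 * B * ∑' k, |z k| / l k := by
  classical
  set b : ι → ℝ := fun k => if k = k₀ then 0 else |z k| with hb
  have hb0 : ∀ k, 0 ≤ b k := by intro k; simp only [hb]; split_ifs <;> simp
  have hbz : ∀ k, b k ≤ |z k| := by intro k; simp only [hb]; split_ifs <;> simp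
  have hd : ∀ k, b k ≠ 0 → 0 < l k / 2 := by
    intro k hk
    have : k ≠ k₀ := fun h => hk (by simp [hb, h])
    have := hl1 k this
    linarith
  have hs : ∀ t, 0 < t → Summable fun k => b k * Real.exp (-(l k / 2) * t) := by
    intro t ht
    refine (hz (t / 2) (by linarith)).of_nonneg_of_le
      (fun k => mul_nonneg (hb0 k) (Real.exp_pos _).le) fun k => ?_
    have : -(l k / 2) * t = -l k * (t / 2) := by ring
    rw [this]
    exact mul_le_mul_of_nonneg_right (hbz k) (Real.exp_pos _).le
  have hle : ∀ k, b k / (l k / 2) ≤ 2 * (|z k| / l k) := by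
    intro k
    have : b k / (l k / 2) = 2 * (b k / l k) := by
      rw [div_div_eq_mul_div]; ring
    rw [this]
    have := hl k
    have := hbz k
    gcongr
  have hbd : Summable fun k => b k / (l k / 2) :=
    (hz1.mul_left 2).of_nonneg_of_le
      (fun k => div_nonneg (hb0 k) (by linarith [hl k])) hle
  obtain ⟨hS, hSi⟩ := locInt_exp_sum hb0 hd hs hbd
  have hpt : ∀ t, 0 < t → Real.exp (κ * t) * |freeOutput γ l z t| ≤
      B * ∑' k, b k * Real.exp (-(l k / 2) * t) := by
    intro t ht
    rw [← abs_of_pos (Real.exp_pos (κ * t)), ← abs_mul, freeOutput, ← tsum_mul_left,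
      ← tsum_mul_left]
    refine (Real.norm_eq_abs _).symm.trans_le
      (tsum_of_norm_bounded ((hs t ht).mul_left B).hasSum fun k => ?_)
    by_cases hk : k = k₀
    · subst hk; rw [hγ0]; simp [hb]
    simp only [hb, if_neg hk]
    rw [Real.norm_eq_abs, abs_mul, abs_mul, abs_mul, abs_of_pos (Real.exp_pos _),
      abs_of_pos (Real.exp_pos _)]
    have h1 : Real.exp (κ * t) * Real.exp (-l k * t) ≤ Real.exp (-(l k / 2) * t) := by
      rw [← Real.exp_add, Real.exp_le_exp]
      have := hl1 k hk
      nlinarith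
    calc Real.exp (κ * t) * (|γ k| * (Real.exp (-l k * t) * |z k|))
        = |γ k| * (|z k| * (Real.exp (κ * t) * Real.exp (-l k * t))) := by ring
      _ ≤ _ := by
        have := hγ k
        gcongr
  have hexp1 : ∀ T, 0 ≤ T → ∀ t ∈ Ioc 0 T, Real.exp (-|κ| * T) ≤ Real.exp (κ * t) := by
    intro T hT t ht
    rw [Real.exp_le_exp]
    have h1 : -|κ| ≤ κ := neg_abs_le κ
    nlinarith [ht.1, ht.2, abs_nonneg κ]
  have hLI : LocInt (freeOutput γ l z) := by
    intro T hT
    rw [intervalIntegrable_iff_integrableOn_Ioc_of_le hT.le]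
    have hgi := (hS.const_mul (B * (Real.exp (-|κ| * T))⁻¹)).intervalIntegrable le_rfl hT.le
    refine Integrable.mono' hgi.1 (((continuousOn_freeOutput hγ hl hz).mono
      Ioc_subset_Ioi_self).aestronglyMeasurable measurableSet_Ioc) ?_
    refine (ae_restrict_iff' measurableSet_Ioc).2 (Eventually.of_forall fun t ht => ?_)
    have h1 := hpt t ht.1
    have h2 := hexp1 T hT.le t ht
    rw [Real.norm_eq_abs, mul_right_comm, ← div_eq_mul_inv, le_div_iff₀ (Real.exp_pos _), mul_comm]
    exact (mul_le_mul_of_nonneg_right h2 (abs_nonneg _)).trans h1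
  refine ⟨hLI, fun T hT => ?_⟩
  refine (integral_mono_Ioi (hLI.abs.mul_continuous (by fun_prop)) (hS.const_mul B) hpt hT).trans ?_
  rw [intervalIntegral.integral_const_mul, mul_comm 2 B, mul_assoc, ← tsum_mul_left]
  refine mul_le_mul_of_nonneg_left ((hSi T hT).trans ?_) hB
  exact hbd.tsum_le_tsum hle (hz1.mul_left 2)

/-- The mode `k₀` contributes a constant output, hence the linear growth; the rest is integrable up
to infinity. -/
lemma locInt_freeOutput {B lam : ℝ} (hγ : ∀ k, |γ k| ≤ B) (hl0 : l k₀ = 0)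
    (hlam : 0 < lam) (hl1 : ∀ k, k ≠ k₀ → lam ≤ l k)
    (hz : ∀ t, 0 < t → Summable fun k => |z k| * Real.exp (-l k * t))
    (hz1 : Summable fun k => |z k| / l k) :
    LocInt (freeOutput γ l z) ∧ ∃ C, ∀ T, 0 ≤ T →
      ∫ t in (0 : ℝ)..T, |freeOutput γ l z t| ≤ C * (1 + T) := by
  classical
  have hB : 0 ≤ B := (abs_nonneg _).trans (hγ k₀)
  have hl : ∀ k, 0 ≤ l k := by
    intro k
    by_cases hk : k = k₀
    · rw [hk, hl0]
    · exact hlam.le.trans (hl1 k hk)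
  obtain ⟨h1, h2⟩ := locInt_freeOutput_tail (γ := Function.update γ k₀ 0) (κ := 0) (k₀ := k₀) hB
    (fun k => (abs_update_zero_le γ k₀ k).trans (hγ k)) (by simp) hl hlam hl1 (by linarith) hz hz1
  have hc : LocInt fun _ => γ k₀ * z k₀ := LocInt.of_continuousOn (by fun_prop)
  have h3 : LocInt (freeOutput γ l z) :=
    (hc.add h1).congr fun t ht => (freeOutput_eq_add hγ hl0 (hz t ht)).symm
  refine ⟨h3, |γ k₀ * z k₀| + 2 * B * ∑' k, |z k| / l k, fun T hT => ?_⟩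
  have h4 : ∫ t in (0 : ℝ)..T, |freeOutput γ l z t| ≤
      ∫ t in (0 : ℝ)..T, (|γ k₀ * z k₀| + |freeOutput (Function.update γ k₀ 0) l z t|) := by
    refine integral_mono_Ioi h3.abs (hc.abs.add h1.abs) (fun t ht => ?_) hT
    rw [freeOutput_eq_add hγ hl0 (hz t ht)]
    exact abs_add_le _ _
  refine h4.trans ?_
  rw [intervalIntegral.integral_add (hc.abs.intervalIntegrable le_rfl hT)
    (h1.abs.intervalIntegrable le_rfl hT), intervalIntegral.integral_const, sub_zero, smul_eq_mul]
  have h5 := h2 T hT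
  simp only [zero_mul, Real.exp_zero, one_mul] at h5
  have h6 : 0 ≤ 2 * B * ∑' k, |z k| / l k :=
    mul_nonneg (by linarith) (tsum_nonneg fun k => div_nonneg (abs_nonneg _) (hl k))
  nlinarith [abs_nonneg (γ k₀ * z k₀)]

end freeOutput

/-! ### Decay under a small output feedback -/

/-- A diagonal system with a single zero eigenvalue `l k₀`, perturbed by a small rank one output
feedback that moves this eigenvalue to the left, is exponentially stable. -/
theorem abs_le_of_small_feedback {ι : Type*} [Countable ι] {l γ h z : ι → ℝ} {k₀ : ι}
    {B lam : ℝ} (hγ : ∀ k, |γ k| ≤ B) (hl0 : l k₀ = 0)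
    (hlam : 0 < lam) (hl1 : ∀ k, k ≠ k₀ → lam ≤ l k)
    (hγ0 : 0 < γ k₀) (hh : Summable fun k => |h k|) (hh0 : 0 < h k₀) (hμ : h k₀ * γ k₀ ≤ lam)
    (hsmall : B * (∑' k, |h k|) * (2 / lam) ≤ 1 / 6)
    (hz : ∀ t, 0 < t → Summable fun k => |z k| * Real.exp (-l k * t))
    (hz1 : Summable fun k => |z k| / l k) {u : ℝ → ℝ} (hu : LocInt u)
    (hueq : ∀ t, 0 < t →
      u t = -∑' k, γ k * (Real.exp (-l k * t) * z k + h k * duhamel (l k) u t))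
    {t : ℝ} (ht : 0 ≤ t) (k : ι) :
    |Real.exp (-l k * t) * z k + h k * duhamel (l k) u t| ≤
      Real.exp (-(h k₀ * γ k₀ / 2) * t) *
        (|z k| + |h k| * (4 / h k₀ * |z k₀| + 12 * B * ∑' k, |z k| / l k)) := by
  classical
  have hB : 0 ≤ B := (abs_nonneg _).trans (hγ k₀)
  have hl : ∀ k, 0 ≤ l k := by
    intro k
    by_cases hk : k = k₀
    · rw [hk, hl0]
    · exact hlam.le.trans (hl1 k hk)
  set μ := h k₀ * γ k₀ with hμdef
  have hμ0 : 0 < μ := mul_pos hh0 hγ0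
  -- The feedback gives the zero mode the rate `μ`. Half of it is the rate of decay that is proved,
  -- the other half makes the weighted integrals converge.
  set κ := μ / 2 with hκ
  set G := ∑' k, |z k| / l k with hG
  have hG0 : 0 ≤ G := tsum_nonneg fun k => div_nonneg (abs_nonneg _) (hl k)
  set γ' := Function.update γ k₀ 0 with hγ'
  have hγ'B : ∀ k, |γ' k| ≤ B := fun k => (abs_update_zero_le γ k₀ k).trans (hγ k)
  set a : ι → ℝ := fun k => γ' k * h k with ha
  have ha_le : ∀ k, |a k| ≤ B * |h k| := fun k => by
    rw [ha, abs_mul]; exact mul_le_mul_of_nonneg_right (hγ'B k) (abs_nonneg _)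
  have haS : Summable fun k => |a k| :=
    (hh.mul_left B).of_nonneg_of_le (fun _ => abs_nonneg _) ha_le
  have haB : ∑' k, |a k| ≤ B * ∑' k, |h k| := by
    rw [← tsum_mul_left]; exact haS.tsum_le_tsum ha_le (hh.mul_left B)
  obtain ⟨hgL, hgI⟩ := locInt_freeOutput_tail (γ := γ') (κ := κ) (k₀ := k₀) hB hγ'B (by simp [hγ'])
    hl hlam hl1 (by rw [hκ]; linarith) hz hz1
  have hRc := continuousOn_response (a := a) hl haS hu
  have hRL := LocInt.of_continuousOn hRc
  -- `F` is the output of all modes but `k₀`, and `c` below is the component along `k₀`, so that `u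
  -- = -γ₀ c - F`.
  set F : ℝ → ℝ := fun t => freeOutput γ' l z t + response a l u t with hF
  have hFL : LocInt F := hgL.add hRL
  set c : ℝ → ℝ := fun t => z k₀ + h k₀ * ∫ s in (0 : ℝ)..t, u s with hc
  have hcc : ContinuousOn c (Ici 0) :=
    continuousOn_const.add (continuousOn_const.mul hu.continuousOn_primitive)
  have hcL := LocInt.of_continuousOn hcc
  have hu2 : ∀ t, 0 < t → u t = -γ k₀ * c t - F t := by
    intro t ht
    have hs1 : Summable fun k => γ k * (Real.exp (-l k * t) * z k + h k * duhamel (l k) u t) := by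
      have e1 := summable_freeOutput hγ (hz t ht)
      have e2 : Summable fun k => (γ k * h k) * duhamel (l k) u t := by
        refine summable_response hl ?_ hu ht.le
        refine (hh.mul_left B).of_nonneg_of_le (fun _ => abs_nonneg _) fun k => ?_
        rw [abs_mul]; exact mul_le_mul_of_nonneg_right (hγ k) (abs_nonneg _)
      refine (e1.add e2).congr fun k => ?_
      ring
    rw [hueq t ht, tsum_mul_eq_add k₀ hs1, hl0, duhamel_zero_left]
    have e3 : ∑' k, γ' k * (Real.exp (-l k * t) * z k + h k * duhamel (l k) u t) = F t := by
      simp only [hF, freeOutput, response]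
      rw [← (summable_freeOutput hγ'B (hz t ht)).tsum_add (summable_response hl haS hu ht.le)]
      congr 1; ext k; simp only [ha]; ring
    rw [e3]; simp only [hc, neg_zero, zero_mul, Real.exp_zero, one_mul]; ring
  -- Inserting `u = -γ₀ c - F` into `c' = h₀ u` gives `c' = -μ c - h₀ F`: the zero eigenvalue has
  -- moved to `-μ`.
  have hceq : ∀ t, 0 ≤ t → c t = Real.exp (-μ * t) * z k₀ + duhamel μ (fun s => -h k₀ * F s) t := by
    intro t ht
    refine eq_duhamel_of_integral_eq hcc (hFL.const_mul _) (fun t ht => ?_) ht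
    have : ∫ s in (0 : ℝ)..t, u s = ∫ s in (0 : ℝ)..t, (-γ k₀ * c s - F s) :=
      integral_congr_Ioi hu2 ht
    simp only [hc] at this ⊢
    rw [this, intervalIntegral.integral_sub ((hcL.const_mul _).intervalIntegrable le_rfl ht)
      (hFL.intervalIntegrable le_rfl ht), intervalIntegral.integral_const_mul,
      intervalIntegral.integral_const_mul]
    simp only [hc, hμdef]; ring
  have hwc : Continuous fun s : ℝ => Real.exp (κ * s) := by fun_prop
  -- the three weighted norms
  have hNc : ∫ s in (0 : ℝ)..t, Real.exp (κ * s) * |c s| ≤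
      2 / μ * |z k₀| + 2 / μ * h k₀ * ∫ s in (0 : ℝ)..t, Real.exp (κ * s) * |F s| := by
    have hD := integral_exp_mul_abs_duhamel_le (hFL.const_mul (-h k₀)) (l := μ) (κ := κ)
      (by rw [hκ]; linarith) ht
    have e1 : ∀ s, |(-h k₀) * F s| = h k₀ * |F s| := fun s => by
      rw [abs_mul, abs_neg, abs_of_pos hh0]
    have e2 : ∫ s in (0 : ℝ)..t, Real.exp (κ * s) * |(-h k₀) * F s| =
        h k₀ * ∫ s in (0 : ℝ)..t, Real.exp (κ * s) * |F s| := by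
      rw [← intervalIntegral.integral_const_mul]
      congr 1; ext s; rw [e1]; ring
    have e3 : (μ - κ)⁻¹ = 2 / μ := by
      rw [hκ]; field_simp; norm_num
    rw [e2, e3, ← mul_assoc] at hD
    have hb1 : LocInt fun s => |z k₀| * Real.exp (-κ * s) := LocInt.of_continuousOn (by fun_prop)
    have hb2 := (LocInt.of_continuousOn (continuousOn_duhamel (hFL.const_mul (-h k₀))
      μ)).abs.mul_continuous hwc
    have e4 : ∫ s in (0 : ℝ)..t, Real.exp (κ * s) * |c s| ≤
        ∫ s in (0 : ℝ)..t, (|z k₀| * Real.exp (-κ * s) +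
          Real.exp (κ * s) * |duhamel μ (fun s => -h k₀ * F s) s|) := by
      refine integral_mono_Ioi (hcL.abs.mul_continuous hwc) (hb1.add hb2) (fun s hs => ?_) ht
      rw [hceq s hs.le]
      refine (mul_le_mul_of_nonneg_left (abs_add_le _ _) (Real.exp_pos _).le).trans ?_
      rw [mul_add, abs_mul, abs_of_pos (Real.exp_pos (-μ * s)), ← mul_assoc, ← Real.exp_add]
      have : κ * s + -μ * s = -κ * s := by rw [hκ]; ring
      rw [this, mul_comm |z k₀|]
    rw [intervalIntegral.integral_add (hb1.intervalIntegrable le_rfl ht)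
      (hb2.intervalIntegrable le_rfl ht), intervalIntegral.integral_const_mul,
      integral_exp_mul (by rw [hκ]; linarith)] at e4
    have e5 : (Real.exp (-κ * t) - 1) / -κ ≤ 2 / μ := by
      rw [div_neg, ← neg_div, hκ, div_le_div_iff₀ (by linarith) hμ0]
      nlinarith [Real.exp_pos (-(μ / 2) * t)]
    have e6 := mul_le_mul_of_nonneg_left e5 (abs_nonneg (z k₀))
    linarith
  -- Only rates at least `lam` enter `F`, and `κ ≤ lam / 2` leaves the rate `lam / 2` for the
  -- integration. Smallness of the gain turns the resulting factor into `1 / 6`.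
  have hNF : ∫ s in (0 : ℝ)..t, Real.exp (κ * s) * |F s| ≤
      2 * B * G + 1 / 6 * ∫ s in (0 : ℝ)..t, Real.exp (κ * s) * |u s| := by
    have hR := integral_exp_mul_abs_response_le (a := a) (κ := κ) (d := lam / 2) (by linarith) hl
      (fun k hk => by
        have : k ≠ k₀ := fun h => hk (by simp [ha, hγ', h])
        have := hl1 k this
        rw [hκ]; linarith) haS hu ht
    have hbb1 := hgL.abs.mul_continuous hwc
    have hbb2 := hRL.abs.mul_continuous hwc
    have e4 : ∫ s in (0 : ℝ)..t, Real.exp (κ * s) * |F s| ≤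
        ∫ s in (0 : ℝ)..t, (Real.exp (κ * s) * |freeOutput γ' l z s| +
          Real.exp (κ * s) * |response a l u s|) := by
      refine integral_mono_Ioi (hFL.abs.mul_continuous hwc) (hbb1.add hbb2) (fun s _ => ?_) ht
      rw [← mul_add]
      exact mul_le_mul_of_nonneg_left (abs_add_le _ _) (Real.exp_pos _).le
    rw [intervalIntegral.integral_add (hbb1.intervalIntegrable le_rfl ht)
      (hbb2.intervalIntegrable le_rfl ht)] at e4
    have hNu0 : 0 ≤ ∫ s in (0 : ℝ)..t, Real.exp (κ * s) * |u s| :=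
      intervalIntegral.integral_nonneg ht fun s _ => by positivity
    have e7 : (∑' k, |a k|) * (lam / 2)⁻¹ ≤ 1 / 6 := by
      rw [inv_div]
      exact (mul_le_mul_of_nonneg_right haB (by positivity)).trans hsmall
    have e8 := mul_le_mul_of_nonneg_right e7 hNu0
    have := hgI t ht
    linarith
  have hNu : ∫ s in (0 : ℝ)..t, Real.exp (κ * s) * |u s| ≤
      γ k₀ * (∫ s in (0 : ℝ)..t, Real.exp (κ * s) * |c s|) +
        ∫ s in (0 : ℝ)..t, Real.exp (κ * s) * |F s| := by
    have hbb1 := (hcL.abs.mul_continuous hwc).const_mul (γ k₀)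
    have hbb2 := hFL.abs.mul_continuous hwc
    rw [← intervalIntegral.integral_const_mul, ← intervalIntegral.integral_add
      (hbb1.intervalIntegrable le_rfl ht) (hbb2.intervalIntegrable le_rfl ht)]
    refine integral_mono_Ioi (hu.abs.mul_continuous hwc) (hbb1.add hbb2) (fun s hs => ?_) ht
    rw [hu2 s hs, mul_left_comm, ← mul_add]
    refine mul_le_mul_of_nonneg_left ?_ (Real.exp_pos _).le
    calc |-γ k₀ * c s - F s| ≤ |-γ k₀ * c s| + |F s| := abs_sub _ _
      _ = _ := by rw [abs_mul, abs_neg, abs_of_pos hγ0]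
  set Nu := ∫ s in (0 : ℝ)..t, Real.exp (κ * s) * |u s| with hNudef
  set NF := ∫ s in (0 : ℝ)..t, Real.exp (κ * s) * |F s| with hNFdef
  have hNF0 : 0 ≤ NF := intervalIntegral.integral_nonneg ht fun s _ => by positivity
  have hkey1 : γ k₀ * (2 / μ) = 2 / h k₀ := by rw [hμdef]; field_simp
  have hkey2 : 2 / h k₀ * h k₀ = 2 := by field_simp
  have hNu' : Nu ≤ 2 / h k₀ * |z k₀| + 3 * NF := by
    have h1 := mul_le_mul_of_nonneg_left hNc hγ0.le
    have h2 : γ k₀ * (2 / μ * |z k₀| + 2 / μ * h k₀ * NF) = 2 / h k₀ * |z k₀| + 2 * NF := by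
      calc _ = (γ k₀ * (2 / μ)) * |z k₀| + (γ k₀ * (2 / μ)) * h k₀ * NF := by ring
        _ = _ := by rw [hkey1, hkey2]
    linarith
  -- The loop closes because `3 * (1 / 6) = 1 / 2`. From `NF ≤ 2BG + Nu / 6` and `Nu ≤ (2 / h₀)|z₀|
  -- + 3 NF` follows `NF ≤ (2 / (3h₀))|z₀| + 4BG`, then `Nu ≤ (4 / h₀)|z₀| + 12BG`.
  set M := 4 / h k₀ * |z k₀| + 12 * B * G with hM
  have h4h : 4 / h k₀ * |z k₀| = 2 * (2 / h k₀ * |z k₀|) := by ring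
  have hzh : 0 ≤ 2 / h k₀ * |z k₀| := by positivity
  have hBG : 0 ≤ B * G := mul_nonneg hB hG0
  have hNuM : Nu ≤ M := by rw [hM, h4h]; linarith
  have hNFM : NF ≤ M := by rw [hM, h4h]; linarith
  have hexp : Real.exp (-κ * t) * Real.exp (κ * t) = 1 := by
    rw [← Real.exp_add]; simp
  -- The original formula for the mode `k₀` shows no decay, so the closed loop formula `hceq` is
  -- used there. For the other modes the weighted bound of `u` suffices.
  by_cases hk : k = k₀
  · subst hk
    rw [hl0, duhamel_zero_left]
    have e1 : Real.exp (-0 * t) * z k + h k * ∫ s in (0 : ℝ)..t, u s = c t := by simp [hc]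
    rw [e1, hceq t ht]
    have e2 := exp_mul_abs_duhamel_le_integral (hFL.const_mul (-h k)) (l := μ) (κ := κ)
      (by rw [hκ]; linarith) ht
    have e3 : ∫ s in (0 : ℝ)..t, Real.exp (κ * s) * |(-h k) * F s| = |h k| * NF := by
      rw [hNFdef, ← intervalIntegral.integral_const_mul]
      congr 1; ext s; rw [abs_mul, abs_neg]; ring
    rw [e3] at e2
    have e4 : |duhamel μ (fun s => -h k * F s) t| ≤ Real.exp (-κ * t) * (|h k| * M) := by
      calc |duhamel μ (fun s => -h k * F s) t|
          = Real.exp (-κ * t) * (Real.exp (κ * t) * |duhamel μ (fun s => -h k * F s) t|) := by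
            rw [← mul_assoc, hexp, one_mul]
        _ ≤ _ := mul_le_mul_of_nonneg_left (e2.trans
            (mul_le_mul_of_nonneg_left hNFM (abs_nonneg _))) (Real.exp_pos _).le
    refine (abs_add_le _ _).trans ?_
    rw [abs_mul, abs_of_pos (Real.exp_pos _), mul_add]
    refine add_le_add (mul_le_mul_of_nonneg_right (Real.exp_le_exp.2 ?_) (abs_nonneg _)) e4
    nlinarith
  · have hlk := hl1 k hk
    have e2 := exp_mul_abs_duhamel_le_integral hu (l := l k) (κ := κ) (by rw [hκ]; linarith) ht
    have e4 : |duhamel (l k) u t| ≤ Real.exp (-κ * t) * M := by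
      calc |duhamel (l k) u t|
          = Real.exp (-κ * t) * (Real.exp (κ * t) * |duhamel (l k) u t|) := by
            rw [← mul_assoc, hexp, one_mul]
        _ ≤ _ := mul_le_mul_of_nonneg_left (e2.trans hNuM) (Real.exp_pos _).le
    refine (abs_add_le _ _).trans ?_
    rw [abs_mul, abs_mul, abs_of_pos (Real.exp_pos _), mul_add, mul_left_comm]
    refine add_le_add (mul_le_mul_of_nonneg_right (Real.exp_le_exp.2 ?_) (abs_nonneg _))
      (mul_le_mul_of_nonneg_left e4 (abs_nonneg _))
    have : κ ≤ l k := by rw [hκ]; linarith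
    nlinarith

/-! ### Tensor products of functions of one variable -/

/-- The function `x ↦ p 0 (x 0) * p 1 (x 1)` on the plane. -/
def tensor (p : Fin 2 → ℝ → ℝ) (x : Plane) : ℝ := ∏ i, p i (x i)

lemma tensor_mul (p q : Fin 2 → ℝ → ℝ) (x : Plane) :
    tensor p x * tensor q x = tensor (fun i y => p i y * q i y) x := by
  simp [tensor, Finset.prod_mul_distrib]

lemma contDiff_tensor {n : WithTop ℕ∞} {p : Fin 2 → ℝ → ℝ} (hp : ∀ i, ContDiff ℝ n (p i)) :
    ContDiff ℝ n (tensor p) := by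
  refine contDiff_prod fun i _ => (hp i).comp ?_
  exact (EuclideanSpace.proj (𝕜 := ℝ) i).contDiff

lemma fderiv_tensor_single {p : Fin 2 → ℝ → ℝ} (hp : ∀ i, Differentiable ℝ (p i)) (x : Plane)
    (i : Fin 2) :
    fderiv ℝ (tensor p) x (EuclideanSpace.single i 1) =
      tensor (Function.update p i (deriv (p i))) x := by
  have h : ∀ j, HasFDerivAt (fun x : Plane => p j (x j))
      (deriv (p j) (x j) • (EuclideanSpace.proj (𝕜 := ℝ) j : Plane →L[ℝ] ℝ)) x := fun j =>
    ((hp j) (x j)).hasDerivAt.comp_hasFDerivAt x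
      (EuclideanSpace.proj (𝕜 := ℝ) j : Plane →L[ℝ] ℝ).hasFDerivAt
  have h1 : tensor p = (fun x : Plane => p 0 (x 0)) * fun x : Plane => p 1 (x 1) := by
    ext x; simp [tensor, Fin.prod_univ_two]
  rw [h1, ((h 0).mul (h 1)).fderiv]
  fin_cases i <;> simp [tensor, Fin.prod_univ_two, Function.update, mul_comm]

lemma abs_tensor_le {p : Fin 2 → ℝ → ℝ} {x : Plane} {C : Fin 2 → ℝ} (h : ∀ i, |p i (x i)| ≤ C i) :
    |tensor p x| ≤ ∏ i, C i := by
  rw [tensor, Finset.abs_prod]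
  exact Finset.prod_le_prod (fun i _ => abs_nonneg _) fun i _ => h i

/-! ### Rectangles -/

lemma isOpen_rect (l r : Plane) : IsOpen (rect l r) := by
  simp only [rect, ofPred_forall, ofPred_and]
  refine isOpen_iInter_of_finite fun i => IsOpen.inter ?_ ?_
  · exact isOpen_lt continuous_const (EuclideanSpace.proj (𝕜 := ℝ) i).continuous
  · exact isOpen_lt (EuclideanSpace.proj (𝕜 := ℝ) i).continuous continuous_const

lemma measurableSet_rect (l r : Plane) : MeasurableSet (rect l r) := (isOpen_rect l r).measurableSet

/-- The closed rectangle. -/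
def crect (l r : Plane) : Set Plane := {x | ∀ i, x i ∈ Icc (l i) (r i)}

lemma rect_subset_crect (l r : Plane) : rect l r ⊆ crect l r :=
  fun _ hx i => ⟨(hx i).1.le, (hx i).2.le⟩

lemma isCompact_crect (l r : Plane) : IsCompact (crect l r) := by
  have h : IsCompact (univ.pi fun i => Icc (l i) (r i)) := isCompact_univ_pi fun i => isCompact_Icc
  have h2 := (PiLp.homeomorph 2 (fun _ : Fin 2 => ℝ)).symm.isCompact_image.2 h
  convert h2 using 1
  ext x
  constructor
  · intro hx
    exact ⟨x.ofLp, fun i _ => hx i, rfl⟩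
  · rintro ⟨y, hy, rfl⟩
    exact fun i => hy i (mem_univ i)

lemma volume_rect_lt_top (l r : Plane) : volume (rect l r) < ⊤ :=
  (measure_mono (rect_subset_crect l r)).trans_lt (isCompact_crect l r).measure_lt_top

instance (l r : Plane) : IsFiniteMeasure (volume.restrict (rect l r)) :=
  ⟨by rw [Measure.restrict_apply_univ]; exact volume_rect_lt_top l r⟩

lemma integral_tensor (p : Fin 2 → ℝ → ℝ) (l r : Plane) :
    ∫ x in rect l r, tensor p x = ∏ i, ∫ y in Ioo (l i) (r i), p i y := by
  have e : ∀ i, ∫ y in Ioo (l i) (r i), p i y = ∫ y, (Ioo (l i) (r i)).indicator (p i) y :=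
    fun i => (integral_indicator measurableSet_Ioo).symm
  simp only [e]
  rw [← integral_fintype_prod_volume_eq_prod, ← integral_indicator (measurableSet_rect l r),
    ← (EuclideanSpace.volume_preserving_symm_measurableEquiv_toLp (Fin 2)).integral_comp'
      (g := fun x : Fin 2 → ℝ => ∏ i, (Ioo (l i) (r i)).indicator (p i) (x i))]
  congr 1; ext x
  by_cases hx : x ∈ rect l r
  · rw [indicator_of_mem hx, tensor]
    refine Finset.prod_congr rfl fun i _ => ?_
    exact (indicator_of_mem (show x i ∈ Ioo (l i) (r i) from hx i) _).symm
  · rw [indicator_of_notMem hx]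
    have : ∃ i, x i ∉ Ioo (l i) (r i) := by
      by_contra hcon
      push Not at hcon
      exact hx fun i => hcon i
    obtain ⟨i, hi⟩ := this
    exact (Finset.prod_eq_zero (Finset.mem_univ i) (indicator_of_notMem hi _)).symm

lemma memLp_of_continuous {E : Type*} [NormedAddCommGroup E] {f : Plane → E} (hf : Continuous f)
    (p : ENNReal) (l r : Plane) :
    MemLp f p (volume.restrict (rect l r)) := by
  obtain ⟨C, hC⟩ := (isCompact_crect l r).exists_bound_of_continuousOn hf.continuousOn
  refine MemLp.of_bound hf.aestronglyMeasurable C ?_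
  exact (ae_restrict_iff' (measurableSet_rect l r)).2
    (Eventually.of_forall fun x hx => hC x (rect_subset_crect l r hx))

/-! ### Cosine modes in one variable -/

/-- The frequency of the `m`-th cosine mode on `(0, a)`. -/
def freq (a : ℝ) (m : ℕ) : ℝ := m * Real.pi / a

/-- The normalizing constant of the `m`-th cosine mode on `(0, a)`. -/
def modeConst (a : ℝ) (m : ℕ) : ℝ := √((if m = 0 then 1 else 2) / a)

/-- The normalized cosine modes on `(0, a)`. -/
def cosMode (a : ℝ) (m : ℕ) (y : ℝ) : ℝ := modeConst a m * Real.cos (freq a m * y)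

/-- The derivatives of the normalized cosine modes on `(0, a)`. -/
def sinMode (a : ℝ) (m : ℕ) (y : ℝ) : ℝ := -(modeConst a m * freq a m) * Real.sin (freq a m * y)

lemma contDiff_cosMode (a : ℝ) (m : ℕ) {n : WithTop ℕ∞} : ContDiff ℝ n (cosMode a m) := by
  unfold cosMode; fun_prop

lemma contDiff_sinMode (a : ℝ) (m : ℕ) {n : WithTop ℕ∞} : ContDiff ℝ n (sinMode a m) := by
  unfold sinMode; fun_prop

lemma deriv_cosMode (a : ℝ) (m : ℕ) : deriv (cosMode a m) = sinMode a m := by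
  ext y
  have h : HasDerivAt (fun y => freq a m * y) (freq a m) y := by
    simpa using (hasDerivAt_id y).const_mul (freq a m)
  have := (h.cos.const_mul (modeConst a m)).deriv
  rw [show cosMode a m = fun y => modeConst a m * Real.cos (freq a m * y) from rfl, this, sinMode]
  ring

lemma deriv_sinMode (a : ℝ) (m : ℕ) (y : ℝ) :
    deriv (sinMode a m) y = -freq a m ^ 2 * cosMode a m y := by
  have h : HasDerivAt (fun y => freq a m * y) (freq a m) y := by
    simpa using (hasDerivAt_id y).const_mul (freq a m)
  have := (h.sin.const_mul (-(modeConst a m * freq a m))).deriv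
  rw [show sinMode a m = fun y => -(modeConst a m * freq a m) * Real.sin (freq a m * y) from rfl,
    this, cosMode]; ring

lemma modeConst_pos {a : ℝ} (ha : 0 < a) (m : ℕ) : 0 < modeConst a m := by
  unfold modeConst; split_ifs <;> positivity

lemma modeConst_le {a : ℝ} (ha : 0 < a) (m : ℕ) : modeConst a m ≤ √(2 / a) := by
  unfold modeConst
  apply Real.sqrt_le_sqrt
  gcongr
  split_ifs <;> norm_num

lemma freq_nonneg {a : ℝ} (ha : 0 < a) (m : ℕ) : 0 ≤ freq a m := by
  unfold freq; positivity

lemma abs_cosMode_le {a : ℝ} (ha : 0 < a) (m : ℕ) (y : ℝ) : |cosMode a m y| ≤ √(2 / a) := by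
  rw [cosMode, abs_mul, abs_of_pos (modeConst_pos ha m)]
  calc modeConst a m * |Real.cos (freq a m * y)| ≤ modeConst a m * 1 :=
        mul_le_mul_of_nonneg_left (Real.abs_cos_le_one _) (modeConst_pos ha m).le
    _ ≤ _ := by rw [mul_one]; exact modeConst_le ha m

/-- The sine vanishes at both endpoints, since `freq a m * a = m π`. The nearer endpoint gives the
bound, and the farther one is at distance at least `a / 2`. -/
lemma abs_sin_freq_le {a : ℝ} (ha : 0 < a) (m : ℕ) {y : ℝ} (hy : y ∈ Ioo 0 a) :
    |Real.sin (freq a m * y)| ≤ 2 * freq a m / a * (y * (a - y)) := by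
  have hf := freq_nonneg ha m
  have h0 : 0 < y := hy.1
  have h1 : 0 < a - y := sub_pos.2 hy.2
  have e1 : |Real.sin (freq a m * y)| ≤ freq a m * y := by
    refine (Real.abs_sin_le_abs).trans_eq ?_
    rw [abs_of_nonneg (by positivity)]
  have e2 : |Real.sin (freq a m * y)| ≤ freq a m * (a - y) := by
    have : freq a m * (a - y) = m * Real.pi - freq a m * y := by
      rw [mul_sub]; congr 1; unfold freq; field_simp
    have h3 : |Real.sin (freq a m * y)| = |Real.sin (freq a m * (a - y))| := by
      rw [this, Real.sin_nat_mul_pi_sub]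
      simp [abs_mul]
    rw [h3]
    refine (Real.abs_sin_le_abs).trans_eq ?_
    rw [abs_of_nonneg (by positivity)]
  rw [div_mul_eq_mul_div, le_div_iff₀ ha]
  rcases le_total y (a / 2) with h | h
  · calc |Real.sin (freq a m * y)| * a ≤ freq a m * y * a := by gcongr
      _ ≤ freq a m * y * (2 * (a - y)) := by gcongr; linarith
      _ = _ := by ring
  · calc |Real.sin (freq a m * y)| * a ≤ freq a m * (a - y) * a := by gcongr
      _ ≤ freq a m * (a - y) * (2 * y) := by gcongr; linarith
      _ = _ := by ring

lemma integral_cos_int_mul {a : ℝ} (ha : 0 < a) (j : ℤ) :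
    ∫ y in (0 : ℝ)..a, Real.cos (j * Real.pi / a * y) = if j = 0 then a else 0 := by
  split_ifs with hj
  · simp [hj]
  · have h : (j : ℝ) * Real.pi / a ≠ 0 := by
      have : (j : ℝ) ≠ 0 := by exact_mod_cast hj
      have := Real.pi_ne_zero
      positivity
    rw [intervalIntegral.integral_comp_mul_left (fun y => Real.cos y) h, integral_cos]
    have : (j : ℝ) * Real.pi / a * a = j * Real.pi := by field_simp
    rw [this, Real.sin_int_mul_pi]; simp

lemma integral_cosMode_mul {a : ℝ} (ha : 0 < a) (m n : ℕ) :
    ∫ y in Ioo 0 a, cosMode a m y * cosMode a n y = if m = n then 1 else 0 := by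
  rw [← integral_Ioc_eq_integral_Ioo, ← intervalIntegral.integral_of_le ha.le]
  have e : ∀ y, cosMode a m y * cosMode a n y = modeConst a m * modeConst a n / 2 *
      (Real.cos (((m - n : ℤ) : ℝ) * Real.pi / a * y) +
        Real.cos (((m + n : ℤ) : ℝ) * Real.pi / a * y)) := by
    intro y
    have e1 : ((m - n : ℤ) : ℝ) * Real.pi / a * y = freq a m * y - freq a n * y := by
      push_cast; unfold freq; ring
    have e2 : ((m + n : ℤ) : ℝ) * Real.pi / a * y = freq a m * y + freq a n * y := by
      push_cast; unfold freq; ring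
    rw [e1, e2, Real.cos_sub, Real.cos_add, cosMode, cosMode]; ring
  simp only [e]
  rw [intervalIntegral.integral_const_mul, intervalIntegral.integral_add
    (by apply Continuous.intervalIntegrable; fun_prop)
    (by apply Continuous.intervalIntegrable; fun_prop), integral_cos_int_mul ha,
    integral_cos_int_mul ha]
  by_cases hmn : m = n
  · subst hmn
    have h2 : modeConst a m * modeConst a m = (if m = 0 then 1 else 2) / a := by
      unfold modeConst
      exact Real.mul_self_sqrt (by split_ifs <;> positivity)
    rw [h2]
    by_cases hm : m = 0
    · subst hm; simp; field_simp; norm_num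
    · have h3 : ¬ ((m : ℤ) + m = 0) := by omega
      simp only [hm, h3, if_false, if_true, sub_self]
      field_simp; norm_num
  · have h3 : ¬ ((m : ℤ) + n = 0) := by omega
    have h4 : ¬ ((m : ℤ) - n = 0) := by omega
    simp [h3, h4, hmn]

/-! ### The modes on the rectangle -/

/-- The normalized eigenfunctions of the Neumann Laplacian on `rect 0 a`. -/
def mode (a : Plane) (k : Fin 2 → ℕ) : Plane → ℝ := tensor fun i => cosMode (a i) (k i)

/-- The eigenvalues of the Neumann Laplacian on `rect 0 a`, up to the sign. -/
def eig (a : Plane) (k : Fin 2 → ℕ) : ℝ := ∑ i, freq (a i) (k i) ^ 2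

/-- A bound of all the modes. -/
def modeBound (a : Plane) : ℝ := ∏ i, √(2 / a i)

lemma contDiff_mode (a : Plane) (k : Fin 2 → ℕ) {n : WithTop ℕ∞} : ContDiff ℝ n (mode a k) :=
  contDiff_tensor fun _ => contDiff_cosMode _ _

lemma continuous_mode (a : Plane) (k : Fin 2 → ℕ) : Continuous (mode a k) :=
  (contDiff_mode a k (n := 0)).continuous

lemma eig_nonneg (a : Plane) (k : Fin 2 → ℕ) : 0 ≤ eig a k := Finset.sum_nonneg fun _ _ => sq_nonneg _

lemma eig_zero (a : Plane) : eig a 0 = 0 := by simp [eig, freq]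

lemma abs_mode_le {a : Plane} (ha : ∀ i, 0 < a i) (k : Fin 2 → ℕ) (x : Plane) :
    |mode a k x| ≤ modeBound a := abs_tensor_le fun i => abs_cosMode_le (ha i) (k i) (x i)

lemma integral_mode_mul {a : Plane} (ha : ∀ i, 0 < a i) (k k' : Fin 2 → ℕ) :
    ∫ x in rect 0 a, mode a k x * mode a k' x = if k = k' then 1 else 0 := by
  simp only [mode, tensor_mul, integral_tensor]
  have e : ∀ i, ∫ y in Ioo ((0 : Plane) i) (a i), cosMode (a i) (k i) y * cosMode (a i) (k' i) y
      = if k i = k' i then 1 else 0 := fun i => integral_cosMode_mul (ha i) _ _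
  simp only [e]
  split_ifs with h
  · simp [h]
  · have : ∃ i, k i ≠ k' i := by
      by_contra hcon
      push Not at hcon
      exact h (funext hcon)
    obtain ⟨i, hi⟩ := this
    exact Finset.prod_eq_zero (Finset.mem_univ i) (if_neg hi)

lemma fderiv_mode_single (a : Plane) (k : Fin 2 → ℕ) (x : Plane) (i : Fin 2) :
    fderiv ℝ (mode a k) x (EuclideanSpace.single i 1) =
      tensor (Function.update (fun i => cosMode (a i) (k i)) i (sinMode (a i) (k i))) x := by
  rw [mode, fderiv_tensor_single fun i => (contDiff_cosMode _ _ (n := 1)).differentiable (by simp),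
    deriv_cosMode]

/-! ### Integration by parts against functions vanishing on two opposite sides -/

/-- A smooth cut-off function on `(0, a)`, equal to one far from the endpoints. -/
def cutoff (a : ℝ) (n : ℕ) (y : ℝ) : ℝ := Real.smoothTransition (n * (y * (a - y)) - 1)

lemma contDiff_cutoff (a : ℝ) (n : ℕ) : ContDiff ℝ (⊤ : ℕ∞) (cutoff a n) := by
  unfold cutoff
  exact Real.smoothTransition.contDiff.comp (by fun_prop)

lemma abs_cutoff_le (a : ℝ) (n : ℕ) (y : ℝ) : |cutoff a n y| ≤ 1 := by
  rw [cutoff, abs_of_nonneg (Real.smoothTransition.nonneg _)]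
  exact Real.smoothTransition.le_one _

lemma one_le_of_cutoff_ne_zero {a : ℝ} {n : ℕ} {y : ℝ} (h : cutoff a n y ≠ 0) :
    1 ≤ n * (y * (a - y)) := by
  by_contra hcon
  exact h (Real.smoothTransition.zero_of_nonpos (by linarith))

lemma mem_Ioo_of_one_le {a : ℝ} (ha : 0 < a) {n : ℕ} {y : ℝ} (h : 1 ≤ n * (y * (a - y))) :
    y ∈ Ioo 0 a := by
  have h2 : 0 < y * (a - y) := by
    by_contra hcon
    have : (n : ℝ) * (y * (a - y)) ≤ 0 :=
      mul_nonpos_of_nonneg_of_nonpos (Nat.cast_nonneg n) (not_lt.1 hcon)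
    linarith
  constructor
  · by_contra hcon
    nlinarith
  · by_contra hcon
    nlinarith

lemma cutoff_mul_eventuallyEq {a : ℝ} (s : ℝ → ℝ) {y : ℝ} (hy : y ∈ Ioo 0 a) :
    ∀ᶠ n : ℕ in atTop, (fun y => cutoff a n y * s y) =ᶠ[𝓝 y] s := by
  have hpos : 0 < y * (a - y) := mul_pos hy.1 (sub_pos.2 hy.2)
  have h1 : Tendsto (fun n : ℕ => (n : ℝ) * (y * (a - y))) atTop atTop :=
    tendsto_natCast_atTop_atTop.atTop_mul_const hpos
  filter_upwards [h1.eventually_gt_atTop 2] with n hn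
  have h2 : ∀ᶠ x in 𝓝 y, 2 < (n : ℝ) * (x * (a - x)) :=
    (by fun_prop : Continuous fun x : ℝ => (n : ℝ) * (x * (a - x))).continuousAt.eventually
      (lt_mem_nhds hn)
  filter_upwards [h2] with x hx
  rw [cutoff, Real.smoothTransition.one_of_one_le (by linarith), one_mul]

lemma exists_bound_deriv_smoothTransition : ∃ D, ∀ x, |deriv Real.smoothTransition x| ≤ D := by
  have hc : Continuous (deriv Real.smoothTransition) :=
    (Real.smoothTransition.contDiff (n := 1)).continuous_deriv (by simp)
  obtain ⟨D, hD⟩ := (isCompact_Icc (a := (0 : ℝ)) (b := 1)).exists_bound_of_continuousOn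
    hc.continuousOn
  refine ⟨D, fun x => ?_⟩
  by_cases hx : x ∈ Icc (0 : ℝ) 1
  · exact hD x hx
  · have hD0 : 0 ≤ D := (norm_nonneg _).trans (hD 0 (by simp))
    rcases lt_or_ge x 0 with h | h
    · have : Real.smoothTransition =ᶠ[𝓝 x] fun _ => 0 := by
        filter_upwards [gt_mem_nhds h] with z hz
        exact Real.smoothTransition.zero_of_nonpos (le_of_lt hz)
      rw [this.deriv_eq]; simpa
    · have h1 : 1 < x := by
        by_contra hcon
        exact hx ⟨h, not_lt.1 hcon⟩
      have : Real.smoothTransition =ᶠ[𝓝 x] fun _ => 1 := by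
        filter_upwards [lt_mem_nhds h1] with z hz
        exact Real.smoothTransition.one_of_one_le (le_of_lt hz)
      rw [this.deriv_eq]; simpa

lemma deriv_smoothTransition_eq_zero {x : ℝ} (hx : 1 < x) : deriv Real.smoothTransition x = 0 := by
  have : Real.smoothTransition =ᶠ[𝓝 x] fun _ => 1 := by
    filter_upwards [lt_mem_nhds hx] with z hz
    exact Real.smoothTransition.one_of_one_le (le_of_lt hz)
  rw [this.deriv_eq]; simp

/-- The derivative of the cut-off is of size `n`, but it lives where `n y (a - y) ≤ 2`, and there
`|s| ≤ 2C / n`. The product is bounded uniformly in `n`. -/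
lemma exists_bound_deriv_cutoff_mul {a : ℝ} (ha : 0 < a) {s : ℝ → ℝ} (hs : ContDiff ℝ 1 s) {C : ℝ}
    (hC : ∀ y ∈ Ioo 0 a, |s y| ≤ C * (y * (a - y))) :
    ∃ M, ∀ n : ℕ, ∀ y ∈ Ioo 0 a, |deriv (fun y => cutoff a n y * s y) y| ≤ M := by
  obtain ⟨D, hD⟩ := exists_bound_deriv_smoothTransition
  have hD0 : 0 ≤ D := (abs_nonneg _).trans (hD 0)
  obtain ⟨E, hE⟩ := (isCompact_Icc (a := (0 : ℝ)) (b := a)).exists_bound_of_continuousOn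
    (hs.continuous_deriv le_rfl).continuousOn
  have hC0 : 0 ≤ C := by
    have h1 := (abs_nonneg _).trans (hC (a / 2) ⟨by linarith, by linarith⟩)
    have : 0 < a / 2 * (a - a / 2) := by nlinarith
    by_contra hcon
    nlinarith
  refine ⟨D * a * (2 * C) + E, fun n y hy => ?_⟩
  have hpos : 0 < y * (a - y) := mul_pos hy.1 (sub_pos.2 hy.2)
  have h1 : HasDerivAt (fun y : ℝ => (n : ℝ) * (y * (a - y)) - 1) (n * (a - 2 * y)) y := by
    have h := (((hasDerivAt_id y).mul ((hasDerivAt_id y).const_sub a)).const_mul (n : ℝ)).sub_const 1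
    refine h.congr_deriv ?_
    simp only [id]; ring
  have h2 : HasDerivAt (cutoff a n)
      (deriv Real.smoothTransition (n * (y * (a - y)) - 1) * (n * (a - 2 * y))) y :=
    ((Real.smoothTransition.contDiff (n := 1)).differentiable (by simp) _).hasDerivAt.comp y h1
  have h3 := h2.mul ((hs.differentiable (by simp)) y).hasDerivAt
  have h4 : deriv (fun y => cutoff a n y * s y) y = _ := h3.deriv
  rw [h4]
  refine (abs_add_le _ _).trans (add_le_add ?_ ?_)
  · by_cases hn : (n : ℝ) * (y * (a - y)) ≤ 2
    · rw [abs_mul, abs_mul, abs_mul, Nat.abs_cast]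
      have e1 : |a - 2 * y| ≤ a := by
        rw [abs_le]; constructor <;> linarith [hy.1, hy.2]
      calc |deriv Real.smoothTransition (n * (y * (a - y)) - 1)| * (n * |a - 2 * y|) * |s y|
          ≤ D * (n * a) * (C * (y * (a - y))) := by
            have := hD (n * (y * (a - y)) - 1)
            have := hC y hy
            gcongr
        _ = D * a * (C * (n * (y * (a - y)))) := by ring
        _ ≤ D * a * (C * 2) := by gcongr
        _ = _ := by ring
    · rw [deriv_smoothTransition_eq_zero (by linarith)]
      simp only [zero_mul, abs_zero]
      positivity
  · rw [abs_mul]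
    calc |cutoff a n y| * |deriv s y| ≤ 1 * E :=
          mul_le_mul (abs_cutoff_le a n y) (hE y ⟨hy.1.le, hy.2.le⟩) (abs_nonneg _) zero_le_one
      _ = E := one_mul E

/-- Cut-offs in both variables make `ψ` an admissible test function, and dominated convergence
removes them. Only the differentiated factor has to vanish at its endpoints, because the derivative
falls on no other cut-off. -/
lemma integral_mul_tensor_deriv {a : Plane} (ha : ∀ i, 0 < a i) {f : Plane → ℝ}
    {g : Plane → Plane} (hf : MemLp f 2 (volume.restrict (rect 0 a)))
    (hg : IsL2Gradient (rect 0 a) f g) {ψ : Fin 2 → ℝ → ℝ} (hψ : ∀ j, ContDiff ℝ (⊤ : ℕ∞) (ψ j))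
    (i : Fin 2) {C : ℝ} (hC : ∀ y ∈ Ioo 0 (a i), |ψ i y| ≤ C * (y * (a i - y))) :
    ∫ x in rect 0 a, f x * tensor (Function.update ψ i (deriv (ψ i))) x =
      -∫ x in rect 0 a, g x i * tensor ψ x := by
  set p : ℕ → Fin 2 → ℝ → ℝ := fun n j y => cutoff (a j) n y * ψ j y with hp
  have hpC : ∀ n j, ContDiff ℝ (⊤ : ℕ∞) (p n j) := fun n j => (contDiff_cutoff (a j) n).mul (hψ j)
  have hpD : ∀ n j, Differentiable ℝ (p n j) := fun n j => (hpC n j).differentiable (by simp)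
  have hsub : ∀ n, tsupport (tensor (p n)) ⊆ {x | ∀ j, 1 ≤ (n : ℝ) * (x j * (a j - x j))} := by
    intro n
    refine closure_minimal ?_ ?_
    · intro x hx j
      have : p n j (x j) ≠ 0 := fun h => hx (Finset.prod_eq_zero (Finset.mem_univ j) h)
      exact one_le_of_cutoff_ne_zero (left_ne_zero_of_mul this)
    · rw [ofPred_forall]
      exact isClosed_iInter fun j => isClosed_le continuous_const (by fun_prop)
  have hsub2 : ∀ n, tsupport (tensor (p n)) ⊆ rect 0 a := fun n x hx j =>
    mem_Ioo_of_one_le (ha j) (hsub n hx j)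
  have hcs : ∀ n, HasCompactSupport (tensor (p n)) := fun n =>
    (isCompact_crect 0 a).of_isClosed_subset (isClosed_tsupport _)
      ((hsub2 n).trans (rect_subset_crect 0 a))
  have heq := fun n => hg.2 (tensor (p n)) (contDiff_tensor (hpC n)) (hcs n) (hsub2 n) i
  simp only [fderiv_tensor_single (hpD _)] at heq
  have hev : ∀ x ∈ rect 0 a, ∀ᶠ n in atTop, ∀ j, p n j =ᶠ[𝓝 (x j)] ψ j := by
    intro x hx
    rw [eventually_all]
    exact fun j => cutoff_mul_eventuallyEq (ψ j) (hx j)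
  choose M hM using fun j => (isCompact_Icc (a := (0 : ℝ)) (b := a j)).exists_bound_of_continuousOn
    (hψ j).continuous.continuousOn
  have hpM : ∀ n j, ∀ y ∈ Ioo 0 (a j), |p n j y| ≤ M j := by
    intro n j y hy
    rw [hp, abs_mul]
    calc |cutoff (a j) n y| * |ψ j y| ≤ 1 * M j :=
          mul_le_mul (abs_cutoff_le _ n y) (hM j y ⟨hy.1.le, hy.2.le⟩) (abs_nonneg _) zero_le_one
      _ = M j := one_mul _
  obtain ⟨N, hN⟩ := exists_bound_deriv_cutoff_mul (ha i) ((hψ i).of_le (by exact_mod_cast le_top)) hC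
  have hgi : MemLp (fun x => g x i) 2 (volume.restrict (rect 0 a)) :=
    (EuclideanSpace.proj (𝕜 := ℝ) i : Plane →L[ℝ] ℝ).comp_memLp' hg.1
  have hf1 : Integrable f (volume.restrict (rect 0 a)) := hf.integrable (by norm_num)
  have hg1 : Integrable (fun x => g x i) (volume.restrict (rect 0 a)) :=
    hgi.integrable (by norm_num)
  have hup : ∀ n j, ContDiff ℝ 0 (Function.update (p n) i (deriv (p n i)) j) := by
    intro n j
    by_cases h : j = i
    · subst h
      simp only [Function.update_self]
      exact contDiff_zero.2 ((hpC n j).continuous_deriv (by simp))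
    · simp only [Function.update_of_ne h]
      exact (hpC n j).of_le (by simp)
  have hL : Tendsto (fun n => ∫ x in rect 0 a,
      f x * tensor (Function.update (p n) i (deriv (p n i))) x) atTop
      (𝓝 (∫ x in rect 0 a, f x * tensor (Function.update ψ i (deriv (ψ i))) x)) := by
    refine tendsto_integral_of_dominated_convergence
      (fun x => |f x| * ∏ j, Function.update M i N j) (fun n => ?_) (hf1.abs.mul_const _)
      (fun n => ?_) ?_
    · exact hf1.1.mul (contDiff_tensor (hup n)).continuous.aestronglyMeasurable
    · refine (ae_restrict_iff' (measurableSet_rect 0 a)).2 (Eventually.of_forall fun x hx => ?_)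
      rw [norm_mul, Real.norm_eq_abs, Real.norm_eq_abs]
      refine mul_le_mul_of_nonneg_left (abs_tensor_le fun j => ?_) (abs_nonneg _)
      by_cases h : j = i
      · subst h
        simp only [Function.update_self]
        exact hN n _ (hx j)
      · simp only [Function.update_of_ne h]
        exact hpM n j _ (hx j)
    · refine (ae_restrict_iff' (measurableSet_rect 0 a)).2 (Eventually.of_forall fun x hx => ?_)
      refine tendsto_const_nhds.congr' ?_
      filter_upwards [hev x hx] with n hn
      congr 1
      refine Finset.prod_congr rfl fun j _ => ?_
      by_cases h : j = i
      · subst h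
        simp only [Function.update_self]
        exact (hn j).deriv_eq.symm
      · simp only [Function.update_of_ne h]
        exact (hn j).eq_of_nhds.symm
  have hR : Tendsto (fun n => ∫ x in rect 0 a, g x i * tensor (p n) x) atTop
      (𝓝 (∫ x in rect 0 a, g x i * tensor ψ x)) := by
    refine tendsto_integral_of_dominated_convergence
      (fun x => |g x i| * ∏ j, M j) (fun n => ?_) (hg1.abs.mul_const _) (fun n => ?_) ?_
    · exact hg1.1.mul (contDiff_tensor (hpC n)).continuous.aestronglyMeasurable
    · refine (ae_restrict_iff' (measurableSet_rect 0 a)).2 (Eventually.of_forall fun x hx => ?_)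
      rw [norm_mul, Real.norm_eq_abs, Real.norm_eq_abs]
      exact mul_le_mul_of_nonneg_left (abs_tensor_le fun j => hpM n j _ (hx j)) (abs_nonneg _)
    · refine (ae_restrict_iff' (measurableSet_rect 0 a)).2 (Eventually.of_forall fun x hx => ?_)
      refine tendsto_const_nhds.congr' ?_
      filter_upwards [hev x hx] with n hn
      congr 1
      exact Finset.prod_congr rfl fun j _ => (hn j).eq_of_nhds.symm
  exact tendsto_nhds_unique hL (by simpa only [heq] using hR.neg)

/-- Green's formula for a function in `H¹` and one component of the gradient of a mode. -/
lemma integral_mul_fderiv_mode {a : Plane} (ha : ∀ i, 0 < a i) {f : Plane → ℝ}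
    {g : Plane → Plane} (hf : MemLp f 2 (volume.restrict (rect 0 a)))
    (hg : IsL2Gradient (rect 0 a) f g) (k : Fin 2 → ℕ) (i : Fin 2) :
    ∫ x in rect 0 a, g x i * fderiv ℝ (mode a k) x (EuclideanSpace.single i 1) =
      freq (a i) (k i) ^ 2 * ∫ x in rect 0 a, f x * mode a k x := by
  -- The `i`-th partial derivative of the mode has a sine as its `i`-th factor, which vanishes on
  -- the two sides orthogonal to that direction. This is the Neumann condition of the mode.
  set ψ : Fin 2 → ℝ → ℝ :=
    Function.update (fun i => cosMode (a i) (k i)) i (sinMode (a i) (k i)) with hψ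
  have h1 : ∀ j, ContDiff ℝ (⊤ : ℕ∞) (ψ j) := by
    intro j
    by_cases h : j = i
    · subst h; simp only [hψ, Function.update_self]; exact contDiff_sinMode _ _
    · simp only [hψ, Function.update_of_ne h]; exact contDiff_cosMode _ _
  have h2 : ∀ y ∈ Ioo 0 (a i), |ψ i y| ≤
      (modeConst (a i) (k i) * freq (a i) (k i) * (2 * freq (a i) (k i) / a i)) *
        (y * (a i - y)) := by
    intro y hy
    simp only [hψ, Function.update_self, sinMode, abs_mul, abs_neg]
    rw [abs_of_pos (modeConst_pos (ha i) _), abs_of_nonneg (freq_nonneg (ha i) _), mul_assoc _ _ (_ * _)]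
    exact mul_le_mul_of_nonneg_left (abs_sin_freq_le (ha i) (k i) hy)
      (mul_nonneg (modeConst_pos (ha i) _).le (freq_nonneg (ha i) _))
  have h3 := integral_mul_tensor_deriv ha hf hg h1 i h2
  have h4 : ∀ x, tensor (Function.update ψ i (deriv (ψ i))) x =
      -freq (a i) (k i) ^ 2 * mode a k x := by
    intro x
    have h5 : deriv (ψ i) = fun y => -freq (a i) (k i) ^ 2 * cosMode (a i) (k i) y := by
      ext y; simp only [hψ, Function.update_self]; exact deriv_sinMode _ _ y
    rw [h5, hψ, Function.update_idem, mode, tensor, tensor]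
    fin_cases i <;> simp [Fin.prod_univ_two] <;> ring
  simp only [fderiv_mode_single]
  rw [← neg_inj, ← h3, ← neg_mul, ← integral_const_mul]
  congr 1; ext x; rw [h4]; ring

/-! ### Completeness of the modes -/

/-- By `2 cos A cos B = cos (A + B) + cos (A - B)` the span absorbs products with the generators of
the algebra to which Stone–Weierstrass is applied. -/
lemma mul_mem_span_modes (a : Plane) (i : Fin 2) {w : Plane → ℝ}
    (hw : w ∈ Submodule.span ℝ (range fun (k : Fin 2 → ℕ) (x : Plane) =>
      ∏ i, Real.cos (freq (a i) (k i) * x i))) :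
    (fun x : Plane => Real.cos (freq (a i) 1 * x i) * w x) ∈
      Submodule.span ℝ (range fun (k : Fin 2 → ℕ) (x : Plane) =>
        ∏ i, Real.cos (freq (a i) (k i) * x i)) := by
  induction hw using Submodule.span_induction with
  | mem w hw =>
    obtain ⟨k, rfl⟩ := hw
    set e : (Fin 2 → ℕ) → Plane → ℝ := fun k x => ∏ i, Real.cos (freq (a i) (k i) * x i) with he
    have hmem : ∀ k, e k ∈ Submodule.span ℝ (range e) := fun k => Submodule.subset_span ⟨k, rfl⟩
    have hfac : ∀ m x, e (Function.update k i m) x =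
        Real.cos (freq (a i) m * x i) * ∏ j ∈ Finset.univ.erase i, Real.cos (freq (a j) (k j) * x j) := by
      intro m x
      simp only [he]
      rw [← Finset.mul_prod_erase _ _ (Finset.mem_univ i), Function.update_self]
      congr 1
      exact Finset.prod_congr rfl fun j hj => by
        rw [Function.update_of_ne (Finset.ne_of_mem_erase hj)]
    have hk : ∀ x, e k x = Real.cos (freq (a i) (k i) * x i) *
        ∏ j ∈ Finset.univ.erase i, Real.cos (freq (a j) (k j) * x j) := fun x => by
      have := hfac (k i) x
      rwa [Function.update_eq_self] at this
    have hcos : ∀ t : ℝ, Real.cos (freq (a i) 1 * t) * Real.cos (freq (a i) (k i) * t) =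
        1 / 2 * Real.cos (freq (a i) (k i + 1) * t) +
          -- For `k i = 0` the lower index would be `-1`; the cosine is even, so the index 1 serves
          -- instead.
          1 / 2 * Real.cos (freq (a i) (if k i = 0 then 1 else k i - 1) * t) := by
      intro t
      have e1 : freq (a i) (k i + 1) * t = freq (a i) (k i) * t + freq (a i) 1 * t := by
        unfold freq; push_cast; ring
      have e2 : Real.cos (freq (a i) (if k i = 0 then 1 else k i - 1) * t) =
          Real.cos (freq (a i) (k i) * t - freq (a i) 1 * t) := by
        split_ifs with h0
        · rw [h0]
          have : freq (a i) 0 * t - freq (a i) 1 * t = -(freq (a i) 1 * t) := by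
            simp [freq]
          rw [this, Real.cos_neg]
        · congr 1
          unfold freq
          rw [Nat.cast_sub (Nat.one_le_iff_ne_zero.2 h0)]; push_cast; ring
      rw [e1, e2, Real.cos_add, Real.cos_sub]; ring
    have hsum : (fun x : Plane => Real.cos (freq (a i) 1 * x i) * e k x) =
        (1 / 2 : ℝ) • e (Function.update k i (k i + 1)) +
          (1 / 2 : ℝ) • e (Function.update k i (if k i = 0 then 1 else k i - 1)) := by
      ext x
      simp only [Pi.add_apply, Pi.smul_apply, smul_eq_mul]
      rw [hk, hfac, hfac, ← mul_assoc, hcos]; ring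
    rw [hsum]
    exact Submodule.add_mem _ (Submodule.smul_mem _ _ (hmem _)) (Submodule.smul_mem _ _ (hmem _))
  | zero =>
    simp only [Pi.zero_apply, mul_zero]
    exact Submodule.zero_mem _
  | add v w _ _ hv hw =>
    convert Submodule.add_mem _ hv hw using 1
    ext x; simp [mul_add]
  | smul c w _ hw =>
    convert Submodule.smul_mem _ c hw using 1
    ext x; simp; ring

/-- Stone–Weierstrass for the algebra generated by the first cosine in each variable: it separates
points because the cosine is injective on `[0, π]`. Its elements are restrictions of elements of the
span, since the span contains 1 and absorbs the generators. -/
lemma exists_span_modes_near {a : Plane} (ha : ∀ i, 0 < a i) {φ : Plane → ℝ} (hφ : Continuous φ)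
    {ε : ℝ} (hε : 0 < ε) :
    ∃ w ∈ Submodule.span ℝ (range fun (k : Fin 2 → ℕ) (x : Plane) =>
      ∏ i, Real.cos (freq (a i) (k i) * x i)), ∀ x ∈ crect 0 a, |w x - φ x| < ε := by
  set W := Submodule.span ℝ (range fun (k : Fin 2 → ℕ) (x : Plane) =>
      ∏ i, Real.cos (freq (a i) (k i) * x i)) with hW
  have : CompactSpace (crect 0 a) := isCompact_iff_compactSpace.1 (isCompact_crect 0 a)
  let X : Fin 2 → C(crect 0 a, ℝ) := fun i =>
    ⟨fun x => Real.cos (freq (a i) 1 * (x : Plane) i), by fun_prop⟩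
  let A := Algebra.adjoin ℝ (range X)
  have hsep : A.SeparatesPoints := by
    intro x y hxy
    have : ∃ i, (x : Plane) i ≠ (y : Plane) i := by
      by_contra hcon
      push Not at hcon
      exact hxy (Subtype.ext (PiLp.ext hcon))
    obtain ⟨i, hi⟩ := this
    refine ⟨X i, ⟨X i, Algebra.subset_adjoin ⟨i, rfl⟩, rfl⟩, fun h => hi ?_⟩
    have hmem : ∀ z : crect 0 a, freq (a i) 1 * (z : Plane) i ∈ Icc 0 Real.pi := by
      intro z
      have hz := z.2 i
      have h0 : 0 ≤ (z : Plane) i := hz.1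
      refine ⟨mul_nonneg (freq_nonneg (ha i) 1) h0, ?_⟩
      calc freq (a i) 1 * (z : Plane) i ≤ freq (a i) 1 * a i :=
            mul_le_mul_of_nonneg_left hz.2 (freq_nonneg (ha i) 1)
        _ = Real.pi := by unfold freq; have := (ha i).ne'; field_simp; simp
    have h2 := Real.injOn_cos (hmem x) (hmem y) h
    have hf : freq (a i) 1 ≠ 0 := by
      unfold freq; have := ha i; have := Real.pi_pos; positivity
    exact mul_left_cancel₀ hf h2
  have hA : ∀ g ∈ A, ∀ w ∈ W, ∃ w' ∈ W, ∀ x : crect 0 a, g x * w x = w' x := by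
    intro g hg
    induction hg using Algebra.adjoin_induction with
    | mem g hg =>
      obtain ⟨i, rfl⟩ := hg
      exact fun w hw => ⟨_, mul_mem_span_modes a i hw, fun x => rfl⟩
    | algebraMap r =>
      exact fun w hw => ⟨r • w, Submodule.smul_mem _ _ hw, fun x => rfl⟩
    | add g g' _ _ h h' =>
      intro w hw
      obtain ⟨v, hv, e⟩ := h w hw
      obtain ⟨v', hv', e'⟩ := h' w hw
      refine ⟨v + v', Submodule.add_mem _ hv hv', fun x => ?_⟩
      rw [ContinuousMap.add_apply, add_mul, e, e', Pi.add_apply]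
    | mul g g' _ _ h h' =>
      intro w hw
      obtain ⟨v', hv', e'⟩ := h' w hw
      obtain ⟨v, hv, e⟩ := h v' hv'
      refine ⟨v, hv, fun x => ?_⟩
      rw [ContinuousMap.mul_apply, mul_assoc, e', e]
  let Φ : C(crect 0 a, ℝ) := ⟨fun x => φ x, by fun_prop⟩
  obtain ⟨g, hg⟩ :=
    ContinuousMap.exists_mem_subalgebra_near_continuousMap_of_separatesPoints A hsep Φ ε hε
  have h1 : (fun _ => 1 : Plane → ℝ) ∈ W := by
    refine Submodule.subset_span ⟨0, ?_⟩
    ext x; simp [freq]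
  obtain ⟨w, hw, e⟩ := hA g g.2 _ h1
  refine ⟨w, hw, fun x hx => ?_⟩
  have h2 := ((g.1 - Φ).norm_coe_le_norm ⟨x, hx⟩).trans_lt hg
  have h3 := e ⟨x, hx⟩
  rw [mul_one] at h3
  rw [ContinuousMap.sub_apply, h3, Real.norm_eq_abs] at h2
  exact h2

/-- Such an `f` is orthogonal to the span of the modes, hence by uniform approximation to every test
function. -/
theorem ae_eq_zero_of_integral_mul_mode {a : Plane} (ha : ∀ i, 0 < a i) {f : Plane → ℝ}
    (hf : MemLp f 2 (volume.restrict (rect 0 a)))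
    (h : ∀ k, ∫ x in rect 0 a, f x * mode a k x = 0) : f =ᵐ[volume.restrict (rect 0 a)] 0 := by
  have hf1 : Integrable f (volume.restrict (rect 0 a)) := hf.integrable (by norm_num)
  have hW : ∀ w ∈ Submodule.span ℝ (range fun (k : Fin 2 → ℕ) (x : Plane) =>
      ∏ i, Real.cos (freq (a i) (k i) * x i)),
      Continuous w ∧ ∫ x in rect 0 a, f x * w x = 0 := by
    intro w hw
    have hint : ∀ v : Plane → ℝ, Continuous v →
        Integrable (fun x => f x * v x) (volume.restrict (rect 0 a)) := fun v hv =>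
      hf.integrable_mul (memLp_of_continuous hv 2 0 a)
    induction hw using Submodule.span_induction with
    | mem w hw =>
      obtain ⟨k, rfl⟩ := hw
      refine ⟨by fun_prop, ?_⟩
      have hc : (∏ i, modeConst (a i) (k i)) ≠ 0 :=
        Finset.prod_ne_zero_iff.2 fun i _ => (modeConst_pos (ha i) _).ne'
      have h1 := h k
      have h2 : ∀ x, f x * mode a k x = (∏ i, modeConst (a i) (k i)) *
          (f x * ∏ i, Real.cos (freq (a i) (k i) * x i)) := by
        intro x
        rw [mode, tensor]; simp only [cosMode]; rw [Finset.prod_mul_distrib]; ring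
      simp only [h2] at h1
      rw [integral_const_mul] at h1
      exact (mul_eq_zero.1 h1).resolve_left hc
    | zero => exact ⟨continuous_const, by simp⟩
    | add v w _ _ hv hw =>
      refine ⟨hv.1.add hw.1, ?_⟩
      simp only [Pi.add_apply, mul_add]
      rw [integral_add (hint v hv.1) (hint w hw.1), hv.2, hw.2, add_zero]
    | smul c w _ hw =>
      refine ⟨hw.1.const_smul c, ?_⟩
      simp only [Pi.smul_apply, smul_eq_mul, mul_left_comm _ c]
      rw [integral_const_mul, hw.2, mul_zero]
  have hloc : LocallyIntegrableOn f (rect 0 a) volume := IntegrableOn.locallyIntegrableOn hf1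
  have key := (isOpen_rect 0 a).ae_eq_zero_of_integral_contDiff_smul_eq_zero hloc (fun φ hφ _ hsupp => by
    have hφc : Continuous φ := hφ.continuous
    have e1 : ∫ x, φ x • f x = ∫ x in rect 0 a, φ x • f x := by
      refine (setIntegral_eq_integral_of_forall_compl_eq_zero fun x hx => ?_).symm
      rw [image_eq_zero_of_notMem_tsupport fun h => hx (hsupp h), zero_smul]
    rw [e1]
    have hint2 : ∀ v : Plane → ℝ, Continuous v →
        Integrable (fun x => f x * v x) (volume.restrict (rect 0 a)) := fun v hv =>
      hf.integrable_mul (memLp_of_continuous hv 2 0 a)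
    have hbd : ∀ ε > 0, |∫ x in rect 0 a, φ x • f x| ≤ ε * ∫ x in rect 0 a, |f x| := by
      intro ε hε
      obtain ⟨w, hw, hwε⟩ := exists_span_modes_near ha hφc hε
      have e2 : ∫ x in rect 0 a, φ x • f x = ∫ x in rect 0 a, f x * (φ x - w x) := by
        simp only [mul_sub, smul_eq_mul, mul_comm (φ _)]
        rw [integral_sub (hint2 φ hφc) (hint2 w (hW w hw).1), (hW w hw).2, sub_zero]
      rw [e2, ← integral_const_mul]
      refine (abs_integral_le_integral_abs).trans
        (setIntegral_mono_on (hint2 _ (hφc.sub (hW w hw).1)).abs (hf1.abs.const_mul ε)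
          (measurableSet_rect 0 a) fun x hx => ?_)
      rw [abs_mul, mul_comm]
      refine mul_le_mul_of_nonneg_right ?_ (abs_nonneg _)
      rw [abs_sub_comm]
      exact (hwε x (rect_subset_crect 0 a hx)).le
    have hI : 0 ≤ ∫ x in rect 0 a, |f x| := integral_nonneg fun x => abs_nonneg _
    by_contra hne
    have hpos := abs_pos.2 hne
    have := hbd (|∫ x in rect 0 a, φ x • f x| / (2 * (1 + ∫ x in rect 0 a, |f x|)))
      (by positivity)
    rw [div_mul_eq_mul_div, le_div_iff₀ (by positivity)] at this
    nlinarith)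
  exact (ae_restrict_iff' (measurableSet_rect 0 a)).2 key

/-! ### Weak gradients -/

/-- The classical gradient. -/
def grad (φ : Plane → ℝ) (x : Plane) : Plane :=
  WithLp.toLp 2 fun i => fderiv ℝ φ x (EuclideanSpace.single i 1)

lemma grad_apply (φ : Plane → ℝ) (x : Plane) (i : Fin 2) :
    grad φ x i = fderiv ℝ φ x (EuclideanSpace.single i 1) := rfl

lemma inner_grad (φ : Plane → ℝ) (x v : Plane) : inner ℝ v (grad φ x) = fderiv ℝ φ x v := by
  have hv : v = ∑ i, v i • EuclideanSpace.single i (1 : ℝ) := by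
    ext j; fin_cases j <;> simp [Fin.sum_univ_two]
  conv_rhs => rw [hv, map_sum]
  simp only [PiLp.inner_apply, grad_apply, map_smul, smul_eq_mul]
  refine Finset.sum_congr rfl fun i _ => ?_
  simp [mul_comm]

lemma continuous_grad {φ : Plane → ℝ} (hφ : ContDiff ℝ 1 φ) : Continuous (grad φ) := by
  have : Continuous fun x => fderiv ℝ φ x := hφ.continuous_fderiv (by simp)
  unfold grad
  refine (PiLp.continuous_toLp 2 _).comp (continuous_pi fun i => ?_)
  exact this.clm_apply continuous_const

lemma setIntegral_mul_of_tsupport_subset {U : Set Plane} {f φ : Plane → ℝ} (h : tsupport φ ⊆ U) :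
    ∫ x in U, f x * φ x = ∫ x, f x * φ x :=
  setIntegral_eq_integral_of_forall_compl_eq_zero fun x hx => by
    rw [image_eq_zero_of_notMem_tsupport fun hx' => hx (h hx'), mul_zero]

lemma tsupport_fderiv_apply_subset' (φ : Plane → ℝ) (v : Plane) :
    tsupport (fun x => fderiv ℝ φ x v) ⊆ tsupport φ :=
  tsupport_fderiv_apply_subset ℝ v

lemma isWeakGradient_grad (U : Set Plane) {f : Plane → ℝ} (hf : ContDiff ℝ 1 f) :
    IsWeakGradient U f (grad f) := by
  intro φ hφ hc hs i
  have hφ1 : ContDiff ℝ 1 φ := hφ.of_le (by exact_mod_cast le_top)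
  have hd := hφ1.continuous_fderiv (by simp)
  have hdf := hf.continuous_fderiv (by simp)
  rw [setIntegral_mul_of_tsupport_subset ((tsupport_fderiv_apply_subset' φ _).trans hs),
    setIntegral_mul_of_tsupport_subset hs]
  simp only [grad_apply]
  refine integral_mul_fderiv_eq_neg_fderiv_mul_of_integrable ?_ ?_ ?_
    (fun x _ => hf.differentiable (by simp) x) fun x _ => hφ1.differentiable (by simp) x
  · exact ((hdf.clm_apply continuous_const).mul hφ1.continuous).integrable_of_hasCompactSupport
      hc.mul_left
  · exact (hf.continuous.mul (hd.clm_apply continuous_const)).integrable_of_hasCompactSupport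
      (hc.fderiv_apply ℝ _).mul_left
  · exact (hf.continuous.mul hφ1.continuous).integrable_of_hasCompactSupport hc.mul_left

lemma IsL2Gradient.memLp {U : Set Plane} {f : Plane → ℝ} {g : Plane → Plane}
    (h : IsL2Gradient U f g) : MemLp g 2 (volume.restrict U) := h.1

lemma memLp_restrict_of_hasCompactSupport {φ : Plane → ℝ} (hφ : Continuous φ)
    (hc : HasCompactSupport φ) (U : Set Plane) : MemLp φ 2 (volume.restrict U) :=
  (hφ.memLp_of_hasCompactSupport hc).restrict U

lemma MemLp.coord {U : Set Plane} {g : Plane → Plane} (hg : MemLp g 2 (volume.restrict U))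
    (i : Fin 2) : MemLp (fun x => g x i) 2 (volume.restrict U) :=
  (EuclideanSpace.proj (𝕜 := ℝ) i : Plane →L[ℝ] ℝ).comp_memLp' hg

lemma IsL2Gradient.integrable_coord_mul {U : Set Plane} {f : Plane → ℝ} {g : Plane → Plane}
    (hg : IsL2Gradient U f g) {φ : Plane → ℝ} (hφ : Continuous φ) (hc : HasCompactSupport φ)
    (i : Fin 2) : Integrable (fun x => g x i * φ x) (volume.restrict U) :=
  (MemLp.coord hg.1 i).integrable_mul (memLp_restrict_of_hasCompactSupport hφ hc U)

lemma IsL2Gradient.congr {U : Set Plane} {f f' : Plane → ℝ} {g g' : Plane → Plane}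
    (h : IsL2Gradient U f g) (hf : f =ᵐ[volume.restrict U] f')
    (hg : g =ᵐ[volume.restrict U] g') : IsL2Gradient U f' g' := by
  refine ⟨h.1.ae_eq hg, fun φ hφ hc hs i => ?_⟩
  have e1 : ∫ x in U, f' x * fderiv ℝ φ x (EuclideanSpace.single i 1) =
      ∫ x in U, f x * fderiv ℝ φ x (EuclideanSpace.single i 1) :=
    integral_congr_ae (hf.mono fun x hx => by simp only [hx])
  have e2 : ∫ x in U, g' x i * φ x = ∫ x in U, g x i * φ x :=
    integral_congr_ae (hg.mono fun x hx => by simp only [hx])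
  rw [e1, e2, h.2 φ hφ hc hs i]

/-- Makes the choice in `weakGrad` immaterial. -/
lemma IsL2Gradient.ae_unique {U : Set Plane} (hU : IsOpen U) {f : Plane → ℝ} {g g' : Plane → Plane}
    (hg : IsL2Gradient U f g) (hg' : IsL2Gradient U f g') : g =ᵐ[volume.restrict U] g' := by
  have key : ∀ i : Fin 2, ∀ᵐ x ∂(volume.restrict U), g x i - g' x i = 0 := by
    intro i
    have hm : MemLp (fun x => g x i - g' x i) 2 (volume.restrict U) :=
      (MemLp.coord hg.1 i).sub (MemLp.coord hg'.1 i)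
    have hloc : LocallyIntegrableOn (fun x => g x i - g' x i) U volume :=
      locallyIntegrableOn_of_locallyIntegrable_restrict (hm.locallyIntegrable (by norm_num))
    refine (ae_restrict_iff' hU.measurableSet).2
      (hU.ae_eq_zero_of_integral_contDiff_smul_eq_zero hloc fun φ hφ hc hs => ?_)
    have hφc : Continuous φ := hφ.continuous
    simp only [smul_eq_mul, mul_comm (φ _)]
    rw [← setIntegral_mul_of_tsupport_subset hs]
    simp only [sub_mul]
    rw [integral_sub (hg.integrable_coord_mul hφc hc i) (hg'.integrable_coord_mul hφc hc i),
      sub_eq_zero, ← neg_inj, ← hg.2 φ hφ hc hs i, ← hg'.2 φ hφ hc hs i]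
  filter_upwards [key 0, key 1] with x h0 h1
  ext i
  fin_cases i
  · exact sub_eq_zero.1 h0
  · exact sub_eq_zero.1 h1

lemma isL2Gradient_weakGrad {U : Set Plane} {f : Plane → ℝ} (hf : MemH1 U f) :
    IsL2Gradient U f (weakGrad U f) := by
  rw [weakGrad, dif_pos hf.2]
  exact hf.2.choose_spec

lemma IsL2Gradient.weakGrad_ae_eq {U : Set Plane} (hU : IsOpen U) {f : Plane → ℝ}
    {g : Plane → Plane} (hg : IsL2Gradient U f g) : weakGrad U f =ᵐ[volume.restrict U] g := by
  have h : ∃ g, IsL2Gradient U f g := ⟨g, hg⟩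
  rw [weakGrad, dif_pos h]
  exact h.choose_spec.ae_unique hU hg

lemma MemH1.congr {U : Set Plane} {f f' : Plane → ℝ} (h : MemH1 U f)
    (hf : f =ᵐ[volume.restrict U] f') : MemH1 U f' :=
  ⟨h.1.ae_eq hf, h.2.imp fun _ hg => hg.congr hf EventuallyEq.rfl⟩

lemma IsL2Gradient.linear {U : Set Plane} {f f' : Plane → ℝ} {g g' : Plane → Plane}
    (hf : MemLp f 2 (volume.restrict U)) (hf' : MemLp f' 2 (volume.restrict U))
    (hg : IsL2Gradient U f g) (hg' : IsL2Gradient U f' g') (r s : ℝ) :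
    IsL2Gradient U (fun x => r * f x + s * f' x) (fun x => r • g x + s • g' x) := by
  refine ⟨(hg.1.const_smul r).add (hg'.1.const_smul s), fun φ hφ hc hs i => ?_⟩
  have hφ1 : ContDiff ℝ 1 φ := hφ.of_le (by exact_mod_cast le_top)
  have hd : Continuous fun x => fderiv ℝ φ x (EuclideanSpace.single i 1) :=
    (hφ1.continuous_fderiv (by simp)).clm_apply continuous_const
  have hdL := memLp_restrict_of_hasCompactSupport hd (hc.fderiv_apply ℝ _) U
  simp only [PiLp.add_apply, PiLp.smul_apply, smul_eq_mul, add_mul, mul_assoc]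
  have i1 : Integrable (fun x => f x * fderiv ℝ φ x (EuclideanSpace.single i 1))
    (volume.restrict U) := hf.integrable_mul hdL
  have i2 : Integrable (fun x => f' x * fderiv ℝ φ x (EuclideanSpace.single i 1))
    (volume.restrict U) := hf'.integrable_mul hdL
  rw [integral_add (i1.const_mul r) (i2.const_mul s),
    integral_add ((hg.integrable_coord_mul hφ1.continuous hc i).const_mul r)
      ((hg'.integrable_coord_mul hφ1.continuous hc i).const_mul s), integral_const_mul,
    integral_const_mul, integral_const_mul, integral_const_mul, hg.2 φ hφ hc hs i,
    hg'.2 φ hφ hc hs i]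
  ring

lemma MemH1.linear {U : Set Plane} {f f' : Plane → ℝ} (hf : MemH1 U f) (hf' : MemH1 U f')
    (r s : ℝ) : MemH1 U (fun x => r * f x + s * f' x) :=
  ⟨(hf.1.const_mul r).add (hf'.1.const_mul s),
    ⟨_, IsL2Gradient.linear hf.1 hf'.1 (isL2Gradient_weakGrad hf) (isL2Gradient_weakGrad hf') r s⟩⟩

lemma MemH1.sub {U : Set Plane} {f f' : Plane → ℝ} (hf : MemH1 U f) (hf' : MemH1 U f') :
    MemH1 U (fun x => f x - f' x) := by
  simpa [sub_eq_add_neg] using hf.linear hf' 1 (-1)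

lemma MemH1.const_mul {U : Set Plane} {f : Plane → ℝ} (hf : MemH1 U f) (r : ℝ) :
    MemH1 U (fun x => r * f x) := by
  simpa using hf.linear hf r 0

lemma memH1_of_contDiff (l r : Plane) {f : Plane → ℝ} (hf : ContDiff ℝ 1 f) :
    MemH1 (rect l r) f :=
  ⟨memLp_of_continuous hf.continuous 2 l r, grad f,
    memLp_of_continuous (continuous_grad hf) 2 l r, isWeakGradient_grad _ hf⟩

/-! ### The norm of `H¹` and restriction to a smaller open set. -/

lemma h1Norm_nonneg (U : Set Plane) (f : Plane → ℝ) : 0 ≤ h1Norm U f := Real.sqrt_nonneg _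

lemma h1Norm_sq (U : Set Plane) (f : Plane → ℝ) :
    h1Norm U f ^ 2 = (∫ x in U, f x ^ 2) + ∫ x in U, ‖weakGrad U f x‖ ^ 2 :=
  Real.sq_sqrt (add_nonneg (integral_nonneg fun _ => sq_nonneg _)
    (integral_nonneg fun _ => sq_nonneg _))

/-- A test function supported in `V` is one on `U`, so the weak gradient restricts. This passes from
the decay on the whole rectangle to the decay on the subrectangle. -/
lemma h1Norm_mono {U V : Set Plane} (hV : IsOpen V) (hVU : V ⊆ U) {f : Plane → ℝ}
    (hf : MemH1 U f) : h1Norm V f ≤ h1Norm U f := by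
  have hg := isL2Gradient_weakGrad hf
  have hr : volume.restrict V ≤ volume.restrict U := Measure.restrict_mono hVU le_rfl
  have hgV : IsL2Gradient V f (weakGrad U f) := by
    refine ⟨hg.1.mono_measure hr, fun φ hφ hc hs i => ?_⟩
    rw [setIntegral_mul_of_tsupport_subset ((tsupport_fderiv_apply_subset' φ _).trans hs),
      setIntegral_mul_of_tsupport_subset hs, ← setIntegral_mul_of_tsupport_subset (hs.trans hVU),
      ← setIntegral_mul_of_tsupport_subset (((tsupport_fderiv_apply_subset' φ _).trans hs).trans
        hVU)]
    exact hg.2 φ hφ hc (hs.trans hVU) i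
  have hae := hgV.weakGrad_ae_eq hV
  refine Real.sqrt_le_sqrt (add_le_add ?_ ?_)
  · exact integral_mono_measure hr (Eventually.of_forall fun _ => sq_nonneg _) hf.1.integrable_sq
  · have e : ∫ x in V, ‖weakGrad V f x‖ ^ 2 = ∫ x in V, ‖weakGrad U f x‖ ^ 2 :=
      integral_congr_ae (hae.mono fun x hx => by simp only [hx])
    rw [e]
    exact integral_mono_measure hr (Eventually.of_forall fun _ => sq_nonneg _)
      (hg.1.integrable_norm_pow (by norm_num))

/-! ### Expansion in the modes -/

/-- The coefficients with respect to the modes. -/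
def coef (a : Plane) (f : Plane → ℝ) (k : Fin 2 → ℕ) : ℝ := ∫ x in rect 0 a, f x * mode a k x

lemma integrable_mul_mode {a : Plane} {f : Plane → ℝ}
    (hf : MemLp f 2 (volume.restrict (rect 0 a))) (k : Fin 2 → ℕ) :
    Integrable (fun x => f x * mode a k x) (volume.restrict (rect 0 a)) :=
  hf.integrable_mul (memLp_of_continuous (continuous_mode a k) 2 0 a)

lemma coef_linear {a : Plane} {f f' : Plane → ℝ} (hf : MemLp f 2 (volume.restrict (rect 0 a)))
    (hf' : MemLp f' 2 (volume.restrict (rect 0 a))) (r s : ℝ) (k : Fin 2 → ℕ) :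
    coef a (fun x => r * f x + s * f' x) k = r * coef a f k + s * coef a f' k := by
  simp only [coef, add_mul, mul_assoc]
  rw [integral_add ((integrable_mul_mode hf k).const_mul r)
    ((integrable_mul_mode hf' k).const_mul s), integral_const_mul, integral_const_mul]

lemma coef_sub {a : Plane} {f f' : Plane → ℝ} (hf : MemLp f 2 (volume.restrict (rect 0 a)))
    (hf' : MemLp f' 2 (volume.restrict (rect 0 a))) (k : Fin 2 → ℕ) :
    coef a (fun x => f x - f' x) k = coef a f k - coef a f' k := by
  have := coef_linear hf hf' 1 (-1) k
  simpa [sub_eq_add_neg] using this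

lemma coef_const_mul (a : Plane) (f : Plane → ℝ) (r : ℝ) (k : Fin 2 → ℕ) :
    coef a (fun x => r * f x) k = r * coef a f k := by
  simp only [coef, mul_assoc]
  rw [integral_const_mul]

lemma coef_mode {a : Plane} (ha : ∀ i, 0 < a i) (k k' : Fin 2 → ℕ) :
    coef a (mode a k) k' = if k = k' then 1 else 0 := integral_mode_mul ha k k'

lemma ae_eq_of_coef_eq {a : Plane} (ha : ∀ i, 0 < a i) {f f' : Plane → ℝ}
    (hf : MemLp f 2 (volume.restrict (rect 0 a))) (hf' : MemLp f' 2 (volume.restrict (rect 0 a)))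
    (h : ∀ k, coef a f k = coef a f' k) : f =ᵐ[volume.restrict (rect 0 a)] f' := by
  have := ae_eq_zero_of_integral_mul_mode ha (hf.sub hf') fun k => by
    have := coef_sub hf hf' k
    rw [h k, sub_self] at this
    exact this
  filter_upwards [this] with x hx
  exact sub_eq_zero.1 hx

lemma inner_toLp {E : Type*} [NormedAddCommGroup E] [InnerProductSpace ℝ E] {μ : Measure Plane}
    {f g : Plane → E} (hf : MemLp f 2 μ) (hg : MemLp g 2 μ) :
    inner ℝ (hf.toLp f) (hg.toLp g) = ∫ x, inner ℝ (f x) (g x) ∂μ := by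
  rw [L2.inner_def]
  refine integral_congr_ae ?_
  filter_upwards [hf.coeFn_toLp, hg.coeFn_toLp] with x h1 h2
  rw [h1, h2]

lemma inner_toLp_real {μ : Measure Plane} {f g : Plane → ℝ} (hf : MemLp f 2 μ) (hg : MemLp g 2 μ) :
    inner ℝ (hf.toLp f) (hg.toLp g) = ∫ x, f x * g x ∂μ := by
  rw [inner_toLp]
  congr 1; ext x
  simp [mul_comm]

lemma memLp_mode (a : Plane) (k : Fin 2 → ℕ) : MemLp (mode a k) 2 (volume.restrict (rect 0 a)) :=
  memLp_of_continuous (continuous_mode a k) 2 0 a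

/-- Parseval's identity in `L²`. -/
theorem hasSum_coef_mul_coef {a : Plane} (ha : ∀ i, 0 < a i) {f f' : Plane → ℝ}
    (hf : MemLp f 2 (volume.restrict (rect 0 a))) (hf' : MemLp f' 2 (volume.restrict (rect 0 a))) :
    HasSum (fun k => coef a f k * coef a f' k) (∫ x in rect 0 a, f x * f' x) := by
  classical
  set v : (Fin 2 → ℕ) → Lp ℝ 2 (volume.restrict (rect 0 a)) :=
    fun k => (memLp_mode a k).toLp (mode a k) with hv
  have horth : Orthonormal ℝ v := by
    rw [orthonormal_iff_ite]
    intro k k'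
    rw [hv, inner_toLp_real]
    exact integral_mode_mul ha k k'
  have hbot : (Submodule.span ℝ (range v))ᗮ = ⊥ := by
    rw [Submodule.eq_bot_iff]
    intro F hF
    rw [Lp.eq_zero_iff_ae_eq_zero]
    refine ae_eq_zero_of_integral_mul_mode ha (Lp.memLp F) fun k => ?_
    have h1 := hF (v k) (Submodule.subset_span ⟨k, rfl⟩)
    rw [← Lp.toLp_coeFn F (Lp.memLp F), hv, inner_toLp_real] at h1
    simpa [mul_comm] using h1
  have h := (HilbertBasis.mkOfOrthogonalEqBot horth hbot).hasSum_inner_mul_inner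
    (hf.toLp f) (hf'.toLp f')
  rw [inner_toLp_real] at h
  refine h.congr_fun fun k => ?_
  rw [HilbertBasis.coe_mkOfOrthogonalEqBot, hv, inner_toLp_real, inner_toLp_real, coef, coef]
  simp only [mul_comm]

/-! ### `H¹` as a Hilbert space with the modes as a basis. -/

/-- The space of pairs of a square integrable function and a square integrable vector field. -/
abbrev PairSpace (a : Plane) : Type :=
  WithLp 2 (Lp ℝ 2 (volume.restrict (rect 0 a)) × Lp Plane 2 (volume.restrict (rect 0 a)))

/-- The pair formed by a function and a vector field. -/
def mkPair {a : Plane} {f : Plane → ℝ} {g : Plane → Plane}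
    (hf : MemLp f 2 (volume.restrict (rect 0 a))) (hg : MemLp g 2 (volume.restrict (rect 0 a))) :
    PairSpace a := WithLp.toLp 2 (hf.toLp f, hg.toLp g)

lemma inner_mkPair {a : Plane} {f f' : Plane → ℝ} {g g' : Plane → Plane}
    (hf : MemLp f 2 (volume.restrict (rect 0 a))) (hg : MemLp g 2 (volume.restrict (rect 0 a)))
    (hf' : MemLp f' 2 (volume.restrict (rect 0 a)))
    (hg' : MemLp g' 2 (volume.restrict (rect 0 a))) :
    inner ℝ (mkPair hf hg) (mkPair hf' hg') =
      (∫ x in rect 0 a, f x * f' x) + ∫ x in rect 0 a, inner ℝ (g x) (g' x) := by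
  rw [WithLp.prod_inner_apply, ← inner_toLp_real hf hf', ← inner_toLp hg hg']
  rfl

lemma mkPair_coeFn {a : Plane} (F : PairSpace a) :
    mkPair (Lp.memLp F.fst) (Lp.memLp F.snd) = F := by
  rw [mkPair, Lp.toLp_coeFn, Lp.toLp_coeFn]
  rfl

lemma memLp_fderiv_test {a : Plane} {φ : Plane → ℝ} (hφ : ContDiff ℝ (⊤ : ℕ∞) φ) (v : Plane) :
    MemLp (fun x => fderiv ℝ φ x v) 2 (volume.restrict (rect 0 a)) :=
  memLp_of_continuous ((hφ.continuous_fderiv (by simp)).clm_apply continuous_const) 2 0 a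

lemma memLp_smul_test {a : Plane} {φ : Plane → ℝ} (hφ : ContDiff ℝ (⊤ : ℕ∞) φ) (v : Plane) :
    MemLp (fun x => φ x • v) 2 (volume.restrict (rect 0 a)) :=
  memLp_of_continuous (hφ.continuous.smul continuous_const) 2 0 a

/-- The Sobolev space as the closed subspace of the pairs `(f, ∇f)`. -/
def sobolev (a : Plane) : Submodule ℝ (PairSpace a) :=
  (Submodule.span ℝ {F | ∃ (φ : Plane → ℝ) (hφ : ContDiff ℝ (⊤ : ℕ∞) φ) (i : Fin 2),
    HasCompactSupport φ ∧ tsupport φ ⊆ rect 0 a ∧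
      F = mkPair (memLp_fderiv_test hφ (EuclideanSpace.single i 1))
        (memLp_smul_test hφ (EuclideanSpace.single i 1))})ᗮ

/-- Orthogonality to the pairs `(∂ᵢφ, φ eᵢ)` is the integration by parts that defines the weak
gradient. As an orthogonal complement, `H¹` is closed and hence complete. -/
lemma mkPair_mem_sobolev_iff {a : Plane} {f : Plane → ℝ} {g : Plane → Plane}
    (hf : MemLp f 2 (volume.restrict (rect 0 a))) (hg : MemLp g 2 (volume.restrict (rect 0 a))) :
    mkPair hf hg ∈ sobolev a ↔ IsWeakGradient (rect 0 a) f g := by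
  have e1 : ∀ (φ : Plane → ℝ) (i : Fin 2),
      ∫ x in rect 0 a, fderiv ℝ φ x (EuclideanSpace.single i 1) * f x =
      ∫ x in rect 0 a, f x * fderiv ℝ φ x (EuclideanSpace.single i 1) := by
    intro φ i; simp only [mul_comm]
  have e2 : ∀ (φ : Plane → ℝ) (i : Fin 2),
      ∫ x in rect 0 a, inner ℝ (φ x • EuclideanSpace.single i (1 : ℝ)) (g x) =
      ∫ x in rect 0 a, g x i * φ x := by
    intro φ i
    congr 1; ext x
    rw [real_inner_smul_left, EuclideanSpace.inner_single_left]; simp [mul_comm]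
  rw [sobolev, Submodule.mem_orthogonal]
  constructor
  · intro h φ hφ hc hs i
    have h1 := h _ (Submodule.subset_span ⟨φ, hφ, i, hc, hs, rfl⟩)
    rw [inner_mkPair, e1, e2] at h1
    linarith
  · intro h F hF
    induction hF using Submodule.span_induction with
    | mem F hF =>
      obtain ⟨φ, hφ, i, hc, hs, rfl⟩ := hF
      rw [inner_mkPair, e1, e2, h φ hφ hc hs i]
      ring
    | zero => exact inner_zero_left _
    | add F G _ _ hF hG => rw [inner_add_left, hF, hG, add_zero]
    | smul c F _ hF => rw [real_inner_smul_left, hF, mul_zero]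

lemma memLp_grad_mode (a : Plane) (k : Fin 2 → ℕ) :
    MemLp (grad (mode a k)) 2 (volume.restrict (rect 0 a)) :=
  memLp_of_continuous (continuous_grad (contDiff_mode a k)) 2 0 a

lemma integral_inner_grad_mode {a : Plane} (ha : ∀ i, 0 < a i) {f : Plane → ℝ}
    {g : Plane → Plane} (hf : MemLp f 2 (volume.restrict (rect 0 a)))
    (hg : IsL2Gradient (rect 0 a) f g) (k : Fin 2 → ℕ) :
    ∫ x in rect 0 a, inner ℝ (g x) (grad (mode a k) x) = eig a k * coef a f k := by
  have e : ∀ x, inner ℝ (g x) (grad (mode a k) x) =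
      ∑ i, g x i * fderiv ℝ (mode a k) x (EuclideanSpace.single i 1) := by
    intro x
    simp only [PiLp.inner_apply, grad_apply]
    exact Finset.sum_congr rfl fun i _ => by simp [mul_comm]
  simp only [e]
  rw [integral_finsetSum]
  · simp only [integral_mul_fderiv_mode ha hf hg k, eig, Finset.sum_mul, coef]
  · intro i _
    exact (MemLp.coord hg.1 i).integrable_mul (memLp_fderiv_test (contDiff_mode a k) _)

/-- The normalized modes in the Sobolev space. -/
def sobolevMode (a : Plane) (k : Fin 2 → ℕ) : sobolev a :=
  ⟨(√(1 + eig a k))⁻¹ • mkPair (memLp_mode a k) (memLp_grad_mode a k),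
    Submodule.smul_mem _ _
      ((mkPair_mem_sobolev_iff _ _).2 (isWeakGradient_grad _ (contDiff_mode a k)))⟩

/-- By Green's formula the `H¹` product with a mode is `1 + eig a k` times the `L²` coefficient; the
normalization leaves the square root. -/
lemma inner_sobolevMode {a : Plane} (ha : ∀ i, 0 < a i) {f : Plane → ℝ} {g : Plane → Plane}
    (hf : MemLp f 2 (volume.restrict (rect 0 a))) (hg : IsL2Gradient (rect 0 a) f g)
    (k : Fin 2 → ℕ) :
    inner ℝ ((⟨mkPair hf hg.memLp, (mkPair_mem_sobolev_iff hf hg.memLp).2 hg.2⟩ : sobolev a))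
      (sobolevMode a k) = √(1 + eig a k) * coef a f k := by
  have hpos : 0 < 1 + eig a k := by linarith [eig_nonneg a k]
  rw [sobolevMode, Submodule.coe_inner, real_inner_smul_right, inner_mkPair,
    integral_inner_grad_mode ha hf hg, ← coef]
  have h2 : coef a f k + eig a k * coef a f k = √(1 + eig a k) * √(1 + eig a k) * coef a f k := by
    rw [Real.mul_self_sqrt hpos.le]; ring
  rw [h2, ← mul_assoc, ← mul_assoc, inv_mul_cancel₀ (Real.sqrt_pos.2 hpos).ne', one_mul]

lemma orthonormal_sobolevMode {a : Plane} (ha : ∀ i, 0 < a i) : Orthonormal ℝ (sobolevMode a) := by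
  classical
  rw [orthonormal_iff_ite]
  intro k k'
  have hpos : 0 < 1 + eig a k := by linarith [eig_nonneg a k]
  have h := inner_sobolevMode ha (memLp_mode a k)
    ⟨memLp_grad_mode a k, isWeakGradient_grad (rect 0 a) (contDiff_mode a k)⟩ k'
  rw [Submodule.coe_inner] at h ⊢
  have e : (sobolevMode a k : PairSpace a) =
      (√(1 + eig a k))⁻¹ • mkPair (memLp_mode a k) (memLp_grad_mode a k) := rfl
  rw [e, real_inner_smul_left, h, coef_mode ha]
  split_ifs with hk
  · subst hk
    rw [mul_one, inv_mul_cancel₀ (Real.sqrt_pos.2 hpos).ne']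
  · simp

lemma sobolev_pair {a : Plane} (F : sobolev a) :
    IsL2Gradient (rect 0 a) (F : PairSpace a).fst (F : PairSpace a).snd ∧
      ∀ h, F = ⟨mkPair (Lp.memLp (F : PairSpace a).fst) (Lp.memLp (F : PairSpace a).snd), h⟩ := by
  have h : mkPair (Lp.memLp (F : PairSpace a).fst) (Lp.memLp (F : PairSpace a).snd) ∈ sobolev a := by
    rw [mkPair_coeFn]; exact F.2
  exact ⟨⟨Lp.memLp _, (mkPair_mem_sobolev_iff _ _).1 h⟩,
    fun h => Subtype.ext (mkPair_coeFn (F : PairSpace a)).symm⟩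

instance (a : Plane) : CompleteSpace (sobolev a) :=
  (Submodule.isClosed_orthogonal _).completeSpace_coe

/-- Orthogonality in `H¹` forces all `L²` coefficients to vanish, so completeness in `L²` kills the
function, and uniqueness of weak gradients kills its gradient. -/
lemma span_sobolevMode_orthogonal {a : Plane} (ha : ∀ i, 0 < a i) :
    (Submodule.span ℝ (range (sobolevMode a)))ᗮ = ⊥ := by
  rw [Submodule.eq_bot_iff]
  intro F hF
  obtain ⟨hg, hFe⟩ := sobolev_pair F
  have hcoef : ∀ k, coef a (F : PairSpace a).fst k = 0 := by
    intro k
    have h1 := hF (sobolevMode a k) (Submodule.subset_span ⟨k, rfl⟩)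
    rw [real_inner_comm, hFe ((mkPair_mem_sobolev_iff _ _).2 hg.2),
      inner_sobolevMode ha (Lp.memLp _) hg] at h1
    have hpos : 0 < 1 + eig a k := by linarith [eig_nonneg a k]
    exact (mul_eq_zero.1 h1).resolve_left (Real.sqrt_pos.2 hpos).ne'
  have h0 := ae_eq_zero_of_integral_mul_mode ha (Lp.memLp (F : PairSpace a).fst) hcoef
  have hz : IsL2Gradient (rect 0 a) (F : PairSpace a).fst (fun _ => 0) := by
    have : IsL2Gradient (rect 0 a) (fun _ => 0) (fun _ => 0) :=
      ⟨MemLp.zero', fun φ _ _ _ i => by simp⟩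
    exact this.congr h0.symm EventuallyEq.rfl
  have h1 := hg.ae_unique (isOpen_rect 0 a) hz
  have e1 : (F : PairSpace a).fst = 0 := (Lp.eq_zero_iff_ae_eq_zero).2 h0
  have e2 : (F : PairSpace a).snd = 0 := (Lp.eq_zero_iff_ae_eq_zero).2 h1
  refine Subtype.ext ?_
  change (F : PairSpace a) = 0
  rw [← WithLp.toLp_ofLp 2 (F : PairSpace a)]
  exact congrArg (WithLp.toLp 2) (Prod.ext e1 e2)

/-- The normalized modes form a Hilbert basis of the Sobolev space. -/
def sobolevBasis {a : Plane} (ha : ∀ i, 0 < a i) : HilbertBasis (Fin 2 → ℕ) ℝ (sobolev a) :=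
  HilbertBasis.mkOfOrthogonalEqBot (orthonormal_sobolevMode ha) (span_sobolevMode_orthogonal ha)

lemma coe_sobolevBasis {a : Plane} (ha : ∀ i, 0 < a i) : ⇑(sobolevBasis ha) = sobolevMode a :=
  HilbertBasis.coe_mkOfOrthogonalEqBot _ _

/-- Parseval's identity in `H¹`. -/
theorem hasSum_one_add_eig_mul {a : Plane} (ha : ∀ i, 0 < a i) {f f' : Plane → ℝ}
    {g g' : Plane → Plane}
    (hf : MemLp f 2 (volume.restrict (rect 0 a))) (hf' : MemLp f' 2 (volume.restrict (rect 0 a)))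
    (hg : IsL2Gradient (rect 0 a) f g) (hg' : IsL2Gradient (rect 0 a) f' g') :
    HasSum (fun k => (1 + eig a k) * (coef a f k * coef a f' k))
      ((∫ x in rect 0 a, f x * f' x) + ∫ x in rect 0 a, inner ℝ (g x) (g' x)) := by
  have h := (sobolevBasis ha).hasSum_inner_mul_inner
    ⟨mkPair hf hg.memLp, (mkPair_mem_sobolev_iff hf hg.memLp).2 hg.2⟩
    ⟨mkPair hf' hg'.memLp, (mkPair_mem_sobolev_iff hf' hg'.memLp).2 hg'.2⟩
  rw [Submodule.coe_inner, inner_mkPair] at h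
  refine h.congr_fun fun k => ?_
  have hpos : 0 ≤ 1 + eig a k := by linarith [eig_nonneg a k]
  rw [coe_sobolevBasis, inner_sobolevMode ha hf hg, real_inner_comm, inner_sobolevMode ha hf' hg',
    mul_mul_mul_comm, Real.mul_self_sqrt hpos]

theorem hasSum_h1Norm_sq {a : Plane} (ha : ∀ i, 0 < a i) {f : Plane → ℝ}
    (hf : MemH1 (rect 0 a) f) :
    HasSum (fun k => (1 + eig a k) * coef a f k ^ 2) (h1Norm (rect 0 a) f ^ 2) := by
  have hg := isL2Gradient_weakGrad hf
  have h := hasSum_one_add_eig_mul ha hf.1 hf.1 hg hg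
  rw [h1Norm_sq]
  simpa only [real_inner_self_eq_norm_sq, ← sq] using h

/-- The difference of the two Parseval identities. No boundary condition on `φ` is needed, in
accordance with the natural Neumann condition of the weak formulation. -/
theorem hasSum_eig_mul_coef {a : Plane} (ha : ∀ i, 0 < a i) {f φ : Plane → ℝ}
    (hf : MemH1 (rect 0 a) f) (hφ : ContDiff ℝ (⊤ : ℕ∞) φ) :
    HasSum (fun k => eig a k * (coef a f k * coef a φ k))
      (∫ x in rect 0 a, fderiv ℝ φ x (weakGrad (rect 0 a) f x)) := by
  have hg := isL2Gradient_weakGrad hf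
  have hφ1 : ContDiff ℝ 1 φ := hφ.of_le (by exact_mod_cast le_top)
  have hφL := memLp_of_continuous hφ.continuous 2 0 a
  have h := hasSum_one_add_eig_mul ha hf.1 hφL hg
    ⟨memLp_of_continuous (continuous_grad hφ1) 2 0 a, isWeakGradient_grad _ hφ1⟩
  have h2 := h.sub (hasSum_coef_mul_coef ha hf.1 hφL)
  simp only [inner_grad, add_sub_cancel_left] at h2
  refine h2.congr_fun ?_
  intro k; ring

/-- The Riesz–Fischer theorem in `H¹`. -/
theorem exists_memH1_of_summable {a : Plane} (ha : ∀ i, 0 < a i) {c : (Fin 2 → ℕ) → ℝ}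
    (hc : Summable fun k => (1 + eig a k) * c k ^ 2) :
    ∃ f, MemH1 (rect 0 a) f ∧ ∀ k, coef a f k = c k := by
  have hpos : ∀ k, 0 < 1 + eig a k := fun k => by linarith [eig_nonneg a k]
  have hmem : Memℓp (fun k => √(1 + eig a k) * c k) 2 := by
    rw [memℓp_gen_iff (by norm_num)]
    refine hc.congr fun k => ?_
    simp [mul_pow, Real.sq_sqrt (hpos k).le]
  set F := (sobolevBasis ha).repr.symm ⟨_, hmem⟩ with hF
  obtain ⟨hg, hFe⟩ := sobolev_pair F
  refine ⟨(F : PairSpace a).fst, ⟨Lp.memLp _, _, hg⟩, fun k => ?_⟩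
  have h1 : (sobolevBasis ha).repr F k = √(1 + eig a k) * c k := by
    rw [hF, LinearIsometryEquiv.apply_symm_apply]
  rw [HilbertBasis.repr_apply_apply, coe_sobolevBasis, real_inner_comm,
    hFe ((mkPair_mem_sobolev_iff _ _).2 hg.2), inner_sobolevMode ha (Lp.memLp _) hg] at h1
  exact mul_left_cancel₀ (Real.sqrt_pos.2 (hpos k)).ne' h1

lemma abs_coef_le_h1Norm {a : Plane} (ha : ∀ i, 0 < a i) {f : Plane → ℝ}
    (hf : MemH1 (rect 0 a) f) (k : Fin 2 → ℕ) : |coef a f k| ≤ h1Norm (rect 0 a) f := by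
  have h := le_hasSum (hasSum_h1Norm_sq ha hf) k fun j _ =>
    mul_nonneg (by linarith [eig_nonneg a j]) (sq_nonneg _)
  refine abs_le_of_sq_le_sq ?_ (h1Norm_nonneg _ _)
  nlinarith [eig_nonneg a k, sq_nonneg (coef a f k)]

/-! ### Sums over the spectrum -/

lemma summable_inv_one_add_freq_sq {a : ℝ} (ha : 0 < a) :
    Summable fun m : ℕ => (1 + freq a m ^ 2)⁻¹ := by
  rw [← summable_nat_add_iff 1]
  have hc : 0 < Real.pi / a := div_pos Real.pi_pos ha
  have h1 : Summable fun m : ℕ => ((Real.pi / a) ^ 2)⁻¹ * (((m + 1 : ℕ) : ℝ) ^ 2)⁻¹ :=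
    ((summable_nat_add_iff 1).2 (Real.summable_nat_pow_inv.2 one_lt_two)).mul_left _
  refine h1.of_nonneg_of_le (fun m => by positivity) fun m => ?_
  rw [← mul_inv]
  have e : freq a (m + 1) ^ 2 = (Real.pi / a) ^ 2 * ((m + 1 : ℕ) : ℝ) ^ 2 := by
    unfold freq; ring
  rw [← e]
  have : 0 < freq a (m + 1) ^ 2 := by rw [e]; positivity
  gcongr
  linarith

lemma summable_prod_fin_two {f : Fin 2 → ℕ → ℝ} (hf : ∀ i, Summable (f i)) (h0 : ∀ i m, 0 ≤ f i m) :
    Summable fun k : Fin 2 → ℕ => ∏ i, f i (k i) := by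
  rw [← (finTwoArrowEquiv ℕ).symm.summable_iff]
  refine ((hf 0).mul_of_nonneg (hf 1) (h0 0) (h0 1)).congr fun p => ?_
  simp [Fin.prod_univ_two, finTwoArrowEquiv]

lemma summable_prod_inv {a : Plane} (ha : ∀ i, 0 < a i) :
    Summable fun k : Fin 2 → ℕ => ∏ i, (1 + freq (a i) (k i) ^ 2)⁻¹ :=
  summable_prod_fin_two (f := fun i m => (1 + freq (a i) m ^ 2)⁻¹) (fun i => summable_inv_one_add_freq_sq (ha i)) fun i m => by positivity

/-- Since `(1 + x)(1 + y) ≤ (1 + x + y)²` for `x, y ≥ 0`, the double series is dominated by a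
product of two convergent simple ones. The exponent 2 suffices because the dimension is two. -/
lemma summable_inv_one_add_eig_sq {a : Plane} (ha : ∀ i, 0 < a i) :
    Summable fun k : Fin 2 → ℕ => ((1 + eig a k) ^ 2)⁻¹ := by
  refine (summable_prod_inv ha).of_nonneg_of_le (fun k => by positivity) fun k => ?_
  rw [Finset.prod_inv_distrib]
  have : (∏ i, (1 + freq (a i) (k i) ^ 2)) ≤ (1 + eig a k) ^ 2 := by
    simp only [Fin.prod_univ_two, eig, Fin.sum_univ_two]
    nlinarith [sq_nonneg (freq (a 0) (k 0)), sq_nonneg (freq (a 1) (k 1)),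
      mul_nonneg (sq_nonneg (freq (a 0) (k 0))) (sq_nonneg (freq (a 1) (k 1)))]
  gcongr

/-- Comparison with the previous series through `exp (-y) ≤ 2 / y²` at `y = (1 + eig a k) t`. -/
lemma summable_exp_eig {a : Plane} (ha : ∀ i, 0 < a i) {t : ℝ} (ht : 0 < t) :
    Summable fun k : Fin 2 → ℕ => Real.exp (-eig a k * t) := by
  refine ((summable_inv_one_add_eig_sq ha).mul_left (Real.exp t * (2 / t ^ 2))).of_nonneg_of_le
    (fun k => (Real.exp_pos _).le) fun k => ?_
  have hpos : 0 < 1 + eig a k := by linarith [eig_nonneg a k]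
  set y := (1 + eig a k) * t with hy
  have hy0 : 0 < y := mul_pos hpos ht
  have h1 : y ^ 2 / 2 ≤ Real.exp y := by
    have := Real.quadratic_le_exp_of_nonneg hy0.le
    linarith
  have h2 : Real.exp (-eig a k * t) = Real.exp t * (Real.exp y)⁻¹ := by
    rw [← Real.exp_neg, ← Real.exp_add]; congr 1; rw [hy]; ring
  rw [h2, mul_assoc]
  refine mul_le_mul_of_nonneg_left ?_ (Real.exp_pos t).le
  calc (Real.exp y)⁻¹ ≤ (y ^ 2 / 2)⁻¹ := by gcongr
    _ = 2 / t ^ 2 * ((1 + eig a k) ^ 2)⁻¹ := by rw [hy]; field_simp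

lemma exists_spectral_gap {a : Plane} (ha : ∀ i, 0 < a i) :
    ∃ lam, 0 < lam ∧ ∀ k, k ≠ 0 → lam ≤ eig a k := by
  have hpos : ∀ i, 0 < freq (a i) 1 ^ 2 := fun i => by
    unfold freq; have := ha i; have := Real.pi_pos; positivity
  refine ⟨min (freq (a 0) 1 ^ 2) (freq (a 1) 1 ^ 2), lt_min (hpos 0) (hpos 1), fun k hk => ?_⟩
  have : ∃ i, k i ≠ 0 := by
    by_contra hcon
    push Not at hcon
    exact hk (funext hcon)
  obtain ⟨i, hi⟩ := this
  have h1 : freq (a i) 1 ^ 2 ≤ eig a k := by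
    calc freq (a i) 1 ^ 2 ≤ freq (a i) (k i) ^ 2 := by
          have h2 : freq (a i) 1 ≤ freq (a i) (k i) := by
            unfold freq
            have := ha i
            have : (1 : ℝ) ≤ k i := by exact_mod_cast Nat.one_le_iff_ne_zero.2 hi
            have := Real.pi_pos
            push_cast
            gcongr
          exact pow_le_pow_left₀ (freq_nonneg (ha i) 1) h2 2
      _ ≤ eig a k := Finset.single_le_sum (f := fun i => freq (a i) (k i) ^ 2)
          (fun j _ => sq_nonneg _) (Finset.mem_univ i)
  refine le_trans ?_ h1
  fin_cases i
  · exact min_le_left _ _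
  · exact min_le_right _ _

/-- The spectral gap makes `eig` comparable with `1 + eig` away from `k = 0`; the constant mode
contributes `0⁻¹ = 0`. -/
lemma summable_inv_eig_sq {a : Plane} (ha : ∀ i, 0 < a i) :
    Summable fun k : Fin 2 → ℕ => (eig a k ^ 2)⁻¹ := by
  obtain ⟨lam, hlam, hl⟩ := exists_spectral_gap ha
  refine ((summable_inv_one_add_eig_sq ha).mul_left ((1 + lam⁻¹) ^ 2)).of_nonneg_of_le
    (fun k => by positivity) fun k => ?_
  by_cases hk : k = 0
  · subst hk
    rw [eig_zero]; simp; positivity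
  have h1 := hl k hk
  have h0 : 0 < eig a k := hlam.trans_le h1
  have h2 : 1 + eig a k ≤ (1 + lam⁻¹) * eig a k := by
    have : 1 ≤ lam⁻¹ * eig a k := by
      rw [inv_mul_eq_div, le_div_iff₀ hlam]; linarith
    linarith
  have h3 : (1 + eig a k) ^ 2 ≤ (1 + lam⁻¹) ^ 2 * eig a k ^ 2 := by
    rw [← mul_pow]; exact pow_le_pow_left₀ (by linarith) h2 2
  rw [inv_eq_one_div, ← div_eq_mul_inv, div_le_div_iff₀ (by positivity) (by positivity)]
  linarith

lemma summable_abs_mul_exp {a : Plane} (ha : ∀ i, 0 < a i) {z : (Fin 2 → ℕ) → ℝ} {S : ℝ}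
    (hz : ∀ k, |z k| ≤ S) {t : ℝ} (ht : 0 < t) :
    Summable fun k => |z k| * Real.exp (-eig a k * t) :=
  ((summable_exp_eig ha ht).mul_left S).of_nonneg_of_le
    (fun _ => mul_nonneg (abs_nonneg _) (Real.exp_pos _).le)
    fun k => mul_le_mul_of_nonneg_right (hz k) (Real.exp_pos _).le

/-- Weighted inequality of the means. With `s` an upper bound of the `ℓ²` norm of `z`, summation
gives a bound linear in `s`, as Cauchy–Schwarz would. -/
lemma abs_div_eig_le {a : Plane} {z : (Fin 2 → ℕ) → ℝ} {s : ℝ} (hs : 0 < s) (k : Fin 2 → ℕ) :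
    |z k| / eig a k ≤ 1 / 2 * (s⁻¹ * z k ^ 2 + s * (eig a k ^ 2)⁻¹) := by
  have h1 : |z k| / eig a k = |z k| * (eig a k)⁻¹ := div_eq_mul_inv _ _
  have h2 : s⁻¹ * z k ^ 2 + s * (eig a k ^ 2)⁻¹ - 2 * (|z k| * (eig a k)⁻¹) =
      s⁻¹ * (|z k| - s * (eig a k)⁻¹) ^ 2 := by
    rw [← sq_abs (z k), ← inv_pow]
    generalize (eig a k)⁻¹ = v
    field_simp
    ring
  have h3 : 0 ≤ s⁻¹ * (|z k| - s * (eig a k)⁻¹) ^ 2 := by positivity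
  rw [h1]; linarith

lemma summable_abs_div_eig {a : Plane} (ha : ∀ i, 0 < a i) {z : (Fin 2 → ℕ) → ℝ}
    (hz : Summable fun k => z k ^ 2) : Summable fun k => |z k| / eig a k :=
  (((hz.mul_left 1⁻¹).add ((summable_inv_eig_sq ha).mul_left 1)).mul_left
    (1 / 2)).of_nonneg_of_le
    (fun k => div_nonneg (abs_nonneg _) (eig_nonneg a k)) fun k => abs_div_eig_le one_pos k

lemma tsum_abs_div_eig_le {a : Plane} (ha : ∀ i, 0 < a i) {z : (Fin 2 → ℕ) → ℝ}
    (hz : Summable fun k => z k ^ 2) {s : ℝ} (hs : 0 ≤ s) (hzs : ∑' k, z k ^ 2 ≤ s ^ 2) :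
    ∑' k, |z k| / eig a k ≤ (1 + ∑' k, (eig a k ^ 2)⁻¹) * s := by
  have hS : 0 ≤ ∑' k, (eig a k ^ 2)⁻¹ := tsum_nonneg fun k => by positivity
  rcases hs.eq_or_lt with rfl | hs
  · have h0 : ∀ k, z k = 0 := by
      intro k
      have h1 := hz.le_tsum k fun j _ => sq_nonneg _
      have : z k ^ 2 ≤ 0 := by linarith
      exact pow_eq_zero_iff two_ne_zero |>.1 (le_antisymm this (sq_nonneg _))
    simp [h0]
  · have h1 := (summable_abs_div_eig ha hz).tsum_le_tsum (fun k => abs_div_eig_le (a := a) hs k)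
      (((hz.mul_left s⁻¹).add ((summable_inv_eig_sq ha).mul_left s)).mul_left (1 / 2))
    rw [tsum_mul_left, (hz.mul_left s⁻¹).tsum_add ((summable_inv_eig_sq ha).mul_left s),
      tsum_mul_left, tsum_mul_left] at h1
    have h2 : s⁻¹ * ∑' k, z k ^ 2 ≤ s := by
      rw [inv_mul_eq_div, div_le_iff₀ hs]; linarith
    nlinarith

lemma summable_coef_sq {a : Plane} (ha : ∀ i, 0 < a i) {f : Plane → ℝ}
    (hf : MemLp f 2 (volume.restrict (rect 0 a))) : Summable fun k => coef a f k ^ 2 := by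
  have h := (hasSum_coef_mul_coef ha hf hf).summable
  simpa only [← sq] using h

lemma tsum_coef_sq_le {a : Plane} (ha : ∀ i, 0 < a i) {f : Plane → ℝ}
    (hf : MemH1 (rect 0 a) f) : ∑' k, coef a f k ^ 2 ≤ h1Norm (rect 0 a) f ^ 2 := by
  have h := hasSum_h1Norm_sq ha hf
  rw [← h.tsum_eq]
  refine (summable_coef_sq ha hf.1).tsum_le_tsum (fun k => ?_) h.summable
  nlinarith [eig_nonneg a k, sq_nonneg (coef a f k)]

/-! ### Series of modes -/

/-- The sum of the series with coefficients `c`. -/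
def series (a : Plane) (c : (Fin 2 → ℕ) → ℝ) (x : Plane) : ℝ := ∑' k, c k * mode a k x

section series

variable {a : Plane} {c : (Fin 2 → ℕ) → ℝ}

lemma norm_mul_mode_le (ha : ∀ i, 0 < a i) (k : Fin 2 → ℕ) (x : Plane) :
    ‖c k * mode a k x‖ ≤ |c k| * modeBound a := by
  rw [norm_mul, Real.norm_eq_abs, Real.norm_eq_abs]
  exact mul_le_mul_of_nonneg_left (abs_mode_le ha k x) (abs_nonneg _)

lemma continuous_series (ha : ∀ i, 0 < a i) (hc : Summable fun k => |c k|) :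
    Continuous (series a c) :=
  continuous_tsum (fun k => continuous_const.mul (continuous_mode a k))
    (hc.mul_right (modeBound a)) fun k x => norm_mul_mode_le ha k x

lemma hasSum_integral_series_mul (ha : ∀ i, 0 < a i) (hc : Summable fun k => |c k|)
    {μ : Measure Plane} [IsFiniteMeasure μ] {g : Plane → ℝ} (hg : Continuous g) {G : ℝ}
    (hG : ∀ x, |g x| ≤ G) :
    HasSum (fun k => c k * ∫ x, g x * mode a k x ∂μ) (∫ x, g x * series a c x ∂μ) := by
  have hG0 : 0 ≤ G := (abs_nonneg _).trans (hG 0)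
  have hB : 0 ≤ modeBound a := (abs_nonneg _).trans (abs_mode_le ha 0 0)
  have hb : ∀ k x, ‖c k * (g x * mode a k x)‖ ≤ |c k| * (G * modeBound a) := by
    intro k x
    rw [norm_mul, norm_mul, Real.norm_eq_abs, Real.norm_eq_abs, Real.norm_eq_abs]
    have := hG x
    have := abs_mode_le ha k x
    gcongr
  have hcont : ∀ k, Continuous fun x => c k * (g x * mode a k x) := fun k =>
    continuous_const.mul (hg.mul (continuous_mode a k))
  have hint : ∀ k, Integrable (fun x => c k * (g x * mode a k x)) μ := fun k =>
    Integrable.of_bound (hcont k).aestronglyMeasurable _ (Eventually.of_forall (hb k))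
  have h := hasSum_integral_of_summable_integral_norm hint (by
    refine (hc.mul_right (G * modeBound a * μ.real univ)).of_nonneg_of_le
      (fun k => integral_nonneg fun x => norm_nonneg _) fun k => ?_
    have := integral_mono (hint k).norm (integrable_const (|c k| * (G * modeBound a))) (hb k)
    rw [integral_const, smul_eq_mul] at this
    linarith)
  simp only [integral_const_mul] at h
  have e : ∀ x, g x * series a c x = ∑' k, c k * (g x * mode a k x) := by
    intro x
    rw [series, ← tsum_mul_left]
    exact tsum_congr fun k => by ring
  simpa only [e] using h

lemma coef_series (ha : ∀ i, 0 < a i) (hc : Summable fun k => |c k|) (k : Fin 2 → ℕ) :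
    coef a (series a c) k = c k := by
  have h := hasSum_integral_series_mul ha hc (μ := volume.restrict (rect 0 a))
    (continuous_mode a k) (abs_mode_le ha k)
  simp only [integral_mode_mul ha] at h
  have h2 := h.unique (hasSum_single (f := fun k' => c k' * if k = k' then 1 else 0) k
    (fun k' hk' => by simp [Ne.symm hk']))
  rw [coef]
  simp only [mul_comm _ (mode a k _), h2]
  simp

lemma memLp_series (ha : ∀ i, 0 < a i) (hc : Summable fun k => |c k|) :
    MemLp (series a c) 2 (volume.restrict (rect 0 a)) :=
  memLp_of_continuous (continuous_series ha hc) 2 0 a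

lemma ae_eq_series (ha : ∀ i, 0 < a i) {f : Plane → ℝ}
    (hf : MemLp f 2 (volume.restrict (rect 0 a))) (hc : Summable fun k => |coef a f k|) :
    f =ᵐ[volume.restrict (rect 0 a)] series a (coef a f) :=
  ae_eq_of_coef_eq ha hf (memLp_series ha hc) fun k => (coef_series ha hc k).symm

/-- The filament may be a null set of the plane, so equality almost everywhere does not determine
the output; continuity upgrades it to equality everywhere. -/
lemma eqOn_series (ha : ∀ i, 0 < a i) {f : Plane → ℝ}
    (hf : MemLp f 2 (volume.restrict (rect 0 a))) (hfc : ContinuousOn f (rect 0 a))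
    (hc : Summable fun k => |coef a f k|) : EqOn f (series a (coef a f)) (rect 0 a) :=
  Measure.eqOn_open_of_ae_eq (ae_eq_series ha hf hc) (isOpen_rect 0 a) hfc
    (continuous_series ha hc).continuousOn

end series

/-! ### Filament sensors -/

/-- The set `σ` can be used as a filament sensor on `rect 0 a`. -/
structure IsFilament (a : Plane) (σ : Set Plane) : Prop where
  isCompact : IsCompact σ
  subset : σ ⊆ rect 0 a
  lt_top : μH[1] σ < ⊤
  pos : 0 < μH[1] σ

lemma exists_lipschitzOnWith {γ : ℝ → Plane} (hγ : ContDiffOn ℝ 1 γ (Icc 0 1)) :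
    ∃ K, LipschitzOnWith K γ (Icc 0 1) := by
  have hd := hγ.continuousOn_derivWithin (uniqueDiffOn_Icc zero_lt_one) le_rfl
  obtain ⟨C, hC⟩ := isCompact_Icc.exists_bound_of_continuousOn hd
  refine ⟨C.toNNReal, (convex_Icc (0 : ℝ) 1).lipschitzOnWith_of_nnnorm_derivWithin_le
    (hγ.differentiableOn (by simp)) fun x hx => ?_⟩
  rw [← NNReal.coe_le_coe, coe_nnnorm]
  exact (hC x hx).trans (Real.le_coe_toNNReal C)

/-- The distance from a point of `σ` is 1-Lipschitz, so it does not increase the measure, and by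
connectedness its image contains a nondegenerate interval. -/
lemma hausdorffMeasure_pos_of_isPreconnected {σ : Set Plane} (hc : IsPreconnected σ)
    (hn : σ.Nontrivial) : 0 < μH[1] σ := by
  obtain ⟨p, hp, q, hq, hpq⟩ := hn
  have hl : LipschitzOnWith 1 (fun x => dist x p) σ :=
    (LipschitzWith.dist_left p).lipschitzOnWith
  have h1 := hl.hausdorffMeasure_image_le (d := 1) zero_le_one
  have h2 : IsPreconnected ((fun x => dist x p) '' σ) :=
    hc.image _ (by fun_prop)
  have h3 : Icc 0 (dist q p) ⊆ (fun x => dist x p) '' σ :=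
    h2.Icc_subset ⟨p, hp, dist_self p⟩ ⟨q, hq, rfl⟩
  have h4 : 0 < (μH[1] : Measure ℝ) (Icc 0 (dist q p)) := by
    rw [hausdorffMeasure_real, Real.volume_Icc]
    simpa using hpq.symm
  have h5 := (h4.trans_le (measure_mono h3)).trans_le h1
  simpa using h5

lemma isFilament_image {a : Plane} {γ : ℝ → Plane} (hγ : ContDiffOn ℝ 1 γ (Icc 0 1))
    (hn : (γ '' Icc 0 1).Nontrivial) (hs : γ '' Icc 0 1 ⊆ rect 0 a) :
    IsFilament a (γ '' Icc 0 1) where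
  isCompact := isCompact_Icc.image_of_continuousOn hγ.continuousOn
  subset := hs
  lt_top := by
    obtain ⟨K, hK⟩ := exists_lipschitzOnWith hγ
    refine (hK.hausdorffMeasure_image_le (d := 1) zero_le_one).trans_lt ?_
    rw [hausdorffMeasure_real, Real.volume_Icc]
    simp
  pos := hausdorffMeasure_pos_of_isPreconnected (isPreconnected_Icc.image _ hγ.continuousOn) hn

section filament

variable {a : Plane} {σ : Set Plane}

lemma IsFilament.isFiniteMeasure (hσ : IsFilament a σ) :
    IsFiniteMeasure ((μH[1] : Measure Plane).restrict σ) :=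
  ⟨by rw [Measure.restrict_apply_univ]; exact hσ.lt_top⟩

/-- The output of a mode. -/
def modeOutput (a : Plane) (σ : Set Plane) (k : Fin 2 → ℕ) : ℝ := filamentOutput σ (mode a k)

lemma IsFilament.abs_modeOutput_le (hσ : IsFilament a σ) (ha : ∀ i, 0 < a i) (k : Fin 2 → ℕ) :
    |modeOutput a σ k| ≤ modeBound a * (μH[1] : Measure Plane).real σ :=
  norm_setIntegral_le_of_norm_le_const (f := mode a k) hσ.lt_top fun x _ => abs_mode_le ha k x

/-- The mode is a positive constant, so its output is that constant times the length. Thus the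
sensor detects the only mode that does not decay. -/
lemma IsFilament.modeOutput_zero_pos (hσ : IsFilament a σ) (ha : ∀ i, 0 < a i) :
    0 < modeOutput a σ 0 := by
  have e : ∀ x, mode a 0 x = ∏ i, modeConst (a i) 0 := by
    intro x; simp [mode, tensor, cosMode, freq]
  simp only [modeOutput, filamentOutput, e]
  rw [setIntegral_const, smul_eq_mul]
  exact mul_pos (ENNReal.toReal_pos hσ.pos.ne' hσ.lt_top.ne)
    (Finset.prod_pos fun i _ => modeConst_pos (ha i) 0)

lemma IsFilament.filamentOutput_congr (hσ : IsFilament a σ) {f g : Plane → ℝ}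
    (h : EqOn f g (rect 0 a)) : filamentOutput σ f = filamentOutput σ g :=
  setIntegral_congr_fun hσ.isCompact.measurableSet fun _ hx => h (hσ.subset hx)

lemma IsFilament.filamentOutput_series (hσ : IsFilament a σ) (ha : ∀ i, 0 < a i)
    {c : (Fin 2 → ℕ) → ℝ} (hc : Summable fun k => |c k|) :
    filamentOutput σ (series a c) = ∑' k, modeOutput a σ k * c k := by
  have := hσ.isFiniteMeasure
  have h := hasSum_integral_series_mul ha hc (μ := (μH[1] : Measure Plane).restrict σ)
    (continuous_const (y := (1 : ℝ))) (G := 1) (by simp)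
  simp only [one_mul] at h
  rw [filamentOutput, ← h.tsum_eq]
  congr 1; ext k
  rw [mul_comm]; rfl

end filament

/-! ### A smooth gain -/

/-- Two integrations by parts without boundary terms, as `p` and its derivative vanish at the
endpoints: the operator `1 - d²/dy²` multiplies the coefficient by `1 + freq a m ^ 2`. -/
lemma abs_integral_mul_cosMode_le {a : ℝ} (ha : 0 < a) {p : ℝ → ℝ} (hp : ContDiff ℝ (⊤ : ℕ∞) p)
    (hs : tsupport p ⊆ Ioo 0 a) :
    ∃ M, 0 ≤ M ∧ ∀ m, |∫ y in Ioo 0 a, p y * cosMode a m y| ≤ M * (1 + freq a m ^ 2)⁻¹ := by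
  have hp1 : ContDiff ℝ (⊤ : ℕ∞) (deriv p) := hp.deriv'
  have hp2 : ContDiff ℝ (⊤ : ℕ∞) (deriv (deriv p)) := hp1.deriv'
  have hz : ∀ y, y ∉ Ioo 0 a → p y = 0 ∧ deriv p y = 0 := fun y hy =>
    ⟨image_eq_zero_of_notMem_tsupport fun h => hy (hs h),
      image_eq_zero_of_notMem_tsupport fun h => hy (hs
        (closure_minimal support_deriv_subset (isClosed_tsupport p) h))⟩
  have h0 := hz 0 (by simp)
  have h1 := hz a (by simp)
  obtain ⟨C, hC⟩ := (isCompact_Icc (a := (0 : ℝ)) (b := a)).exists_bound_of_continuousOn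
    (hp.continuous.sub hp2.continuous).continuousOn
  have hC0 : 0 ≤ C := (norm_nonneg _).trans (hC 0 ⟨le_rfl, ha.le⟩)
  refine ⟨C * √(2 / a) * a, by positivity, fun m => ?_⟩
  have hcd : ∀ y, HasDerivAt (cosMode a m) (sinMode a m y) y := fun y => by
    rw [← deriv_cosMode]
    exact ((contDiff_cosMode a m (n := 1)).differentiable (by simp) y).hasDerivAt
  have hsd : ∀ y, HasDerivAt (sinMode a m) (-freq a m ^ 2 * cosMode a m y) y := fun y => by
    rw [← deriv_sinMode]
    exact ((contDiff_sinMode a m (n := 1)).differentiable (by simp) y).hasDerivAt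
  have hpd : ∀ y, HasDerivAt p (deriv p y) y := fun y =>
    (hp.differentiable (by simp) y).hasDerivAt
  have hpd1 : ∀ y, HasDerivAt (deriv p) (deriv (deriv p) y) y := fun y =>
    (hp1.differentiable (by simp) y).hasDerivAt
  have hcc := (contDiff_cosMode a m (n := 0)).continuous
  have hsc := (contDiff_sinMode a m (n := 0)).continuous
  have i1 := intervalIntegral.integral_mul_deriv_eq_deriv_mul (a := 0) (b := a)
    (fun y _ => hpd y) (fun y _ => hsd y) (hp1.continuous.intervalIntegrable _ _)
    ((continuous_const.mul hcc).intervalIntegrable _ _)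
  have i2 := intervalIntegral.integral_mul_deriv_eq_deriv_mul (a := 0) (b := a)
    (fun y _ => hpd1 y) (fun y _ => hcd y) (hp2.continuous.intervalIntegrable _ _)
    (hsc.intervalIntegrable _ _)
  rw [h0.1, h1.1] at i1
  rw [h0.2, h1.2] at i2
  have i3 : (1 + freq a m ^ 2) * ∫ y in (0 : ℝ)..a, p y * cosMode a m y =
      ∫ y in (0 : ℝ)..a, (p y - deriv (deriv p) y) * cosMode a m y := by
    simp only [sub_mul]
    have j1 : IntervalIntegrable (fun y => p y * cosMode a m y) volume 0 a :=
      (hp.continuous.mul hcc).intervalIntegrable _ _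
    have j2 : IntervalIntegrable (fun y => deriv (deriv p) y * cosMode a m y) volume 0 a :=
      (hp2.continuous.mul hcc).intervalIntegrable _ _
    rw [intervalIntegral.integral_sub j1 j2]
    have e : ∫ y in (0 : ℝ)..a, p y * (-freq a m ^ 2 * cosMode a m y) =
        -freq a m ^ 2 * ∫ y in (0 : ℝ)..a, p y * cosMode a m y := by
      rw [← intervalIntegral.integral_const_mul]; congr 1; ext y; ring
    rw [e] at i1
    linarith
  rw [← integral_Ioc_eq_integral_Ioo, ← intervalIntegral.integral_of_le ha.le]
  have hpos : 0 < 1 + freq a m ^ 2 := by positivity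
  rw [← div_eq_mul_inv, le_div_iff₀ hpos, ← abs_of_pos hpos, ← abs_mul, mul_comm, i3]
  have := intervalIntegral.norm_integral_le_of_norm_le_const (a := 0) (b := a)
    (f := fun y => (p y - deriv (deriv p) y) * cosMode a m y) (C := C * √(2 / a)) (fun y hy => by
      rw [uIoc_of_le ha.le] at hy
      rw [norm_mul]
      exact mul_le_mul (hC y ⟨hy.1.le, hy.2⟩) (abs_cosMode_le ha m y) (abs_nonneg _) hC0)
  simpa [abs_of_pos ha] using this

lemma coef_tensor (a : Plane) (p : Fin 2 → ℝ → ℝ) (k : Fin 2 → ℕ) :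
    coef a (tensor p) k = ∏ i, ∫ y in Ioo 0 (a i), p i y * cosMode (a i) (k i) y := by
  simp only [coef, mode, tensor_mul, integral_tensor]
  rfl

/-- There are smooth gains supported in a given subrectangle with absolutely summable coefficients
and positive mean. -/
lemma exists_gain {a α β : Plane} (hα : ∀ k, 0 ≤ α k) (hαβ : ∀ k, α k < β k)
    (hβ : ∀ k, β k ≤ a k) :
    ∃ h : Plane → ℝ, MemH1 (rect 0 a) h ∧ (∀ x, x ∉ rect α β → h x = 0) ∧
      (Summable fun k => |coef a h k|) ∧ 0 < coef a h 0 := by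
  have ha : ∀ i, 0 < a i := fun i => ((hα i).trans_lt (hαβ i)).trans_le (hβ i)
  -- The outer radius is a quarter of the side, so the support stays inside the open side even when
  -- the subrectangle touches the boundary of `rect 0 a`.
  let b : ∀ i : Fin 2, ContDiffBump ((α i + β i) / 2) := fun i =>
    ⟨(β i - α i) / 8, (β i - α i) / 4, by linarith [hαβ i], by linarith [hαβ i]⟩
  let p : Fin 2 → ℝ → ℝ := fun i => b i
  have hp : ∀ i, ContDiff ℝ (⊤ : ℕ∞) (p i) := fun i => (b i).contDiff
  have hts : ∀ i, tsupport (p i) ⊆ Ioo (α i) (β i) := by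
    intro i y hy
    have h1 : y ∈ Metric.closedBall ((α i + β i) / 2) ((β i - α i) / 4) := by
      have := (b i).tsupport_eq
      rwa [this] at hy
    rw [Real.closedBall_eq_Icc] at h1
    constructor <;> linarith [h1.1, h1.2, hαβ i]
  have hts' : ∀ i, tsupport (p i) ⊆ Ioo 0 (a i) := fun i =>
    (hts i).trans (Ioo_subset_Ioo (hα i) (hβ i))
  refine ⟨tensor p, memH1_of_contDiff 0 a (contDiff_tensor fun i => (hp i).of_le
    (by exact_mod_cast le_top)), ?_, ?_, ?_⟩
  · intro x hx
    have : ∃ i, x i ∉ Ioo (α i) (β i) := by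
      by_contra hcon
      push Not at hcon
      exact hx fun i => hcon i
    obtain ⟨i, hi⟩ := this
    exact Finset.prod_eq_zero (Finset.mem_univ i)
      (image_eq_zero_of_notMem_tsupport fun h => hi (hts i h))
  · choose M hM0 hM using fun i => abs_integral_mul_cosMode_le (ha i) (hp i) (hts' i)
    refine ((summable_prod_inv ha).mul_left (∏ i, M i)).of_nonneg_of_le
      (fun _ => abs_nonneg _) fun k => ?_
    rw [coef_tensor, Finset.abs_prod, ← Finset.prod_mul_distrib]
    exact Finset.prod_le_prod (fun i _ => abs_nonneg _) fun i _ => hM i (k i)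
  · rw [coef_tensor]
    refine Finset.prod_pos fun i _ => ?_
    have e : ∀ y, p i y * cosMode (a i) ((0 : Fin 2 → ℕ) i) y = modeConst (a i) 0 * p i y := by
      intro y
      simp only [cosMode, freq, Pi.zero_apply, Nat.cast_zero, zero_mul, zero_div, Real.cos_zero,
        mul_one]
      ring
    simp only [e]
    rw [integral_const_mul]
    refine mul_pos (modeConst_pos (ha i) 0) ?_
    have e2 : ∫ y in Ioo 0 (a i), p i y = ∫ y, p i y :=
      setIntegral_eq_integral_of_forall_compl_eq_zero fun y hy =>
        image_eq_zero_of_notMem_tsupport fun h => hy (hts' i h)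
    rw [e2]
    exact (b i).integral_pos

/-! ### Solutions and their coefficients -/

/-- The coefficients at time `t` of the solution with initial coefficients `z`, gain coefficients
`h` and input `u`. -/
def modal (a : Plane) (z h : (Fin 2 → ℕ) → ℝ) (u : ℝ → ℝ) (t : ℝ) (k : Fin 2 → ℕ) : ℝ :=
  Real.exp (-eig a k * t) * z k + h k * duhamel (eig a k) u t

section modal

variable {a : Plane} {z h : (Fin 2 → ℕ) → ℝ} {u : ℝ → ℝ}

lemma modal_zero_time (k : Fin 2 → ℕ) : modal a z h u 0 k = z k := by
  simp [modal, duhamel_zero_right]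

lemma abs_exp_neg_eig_mul_le {t : ℝ} (ht : 0 ≤ t) (k : Fin 2 → ℕ) :
    |Real.exp (-eig a k * t) * z k| ≤ |z k| := by
  rw [abs_mul, abs_of_pos (Real.exp_pos _)]
  refine mul_le_of_le_one_left (abs_nonneg _) (Real.exp_le_one_iff.2 ?_)
  nlinarith [eig_nonneg a k]

lemma abs_modal_le (hu : LocInt u) {t T : ℝ} (ht : 0 ≤ t) (hT : t ≤ T) (k : Fin 2 → ℕ) :
    |modal a z h u t k| ≤ |z k| + |h k| * ∫ s in (0 : ℝ)..T, |u s| := by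
  refine (abs_add_le _ _).trans (add_le_add (abs_exp_neg_eig_mul_le ht k) ?_)
  rw [abs_mul]
  exact mul_le_mul_of_nonneg_left ((abs_duhamel_le hu (eig_nonneg a k) ht).trans
    (hu.integral_abs_mono ht hT)) (abs_nonneg _)

lemma continuousOn_modal (hu : LocInt u) (k : Fin 2 → ℕ) :
    ContinuousOn (fun t => modal a z h u t k) (Ici 0) :=
  (by fun_prop : Continuous fun t => Real.exp (-eig a k * t) * z k).continuousOn.add
    (continuousOn_const.mul (continuousOn_duhamel hu _))

lemma modal_integral_eq (hu : LocInt u) {t : ℝ} (ht : 0 ≤ t) (k : Fin 2 → ℕ) :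
    modal a z h u t k - z k =
      -eig a k * (∫ s in (0 : ℝ)..t, modal a z h u s k) + (∫ s in (0 : ℝ)..t, u s) * h k := by
  have hd := LocInt.of_continuousOn (continuousOn_duhamel hu (eig a k))
  have he : LocInt fun s => Real.exp (-eig a k * s) * z k := LocInt.of_continuousOn (by fun_prop)
  simp only [modal]
  rw [intervalIntegral.integral_add (he.intervalIntegrable le_rfl ht)
    ((hd.const_mul _).intervalIntegrable le_rfl ht), intervalIntegral.integral_const_mul,
    intervalIntegral.integral_mul_const]
  have h1 := duhamel_integral_eq hu (eig a k) ht
  have h2 : -eig a k * ∫ s in (0 : ℝ)..t, Real.exp (-eig a k * s) =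
      Real.exp (-eig a k * t) - 1 := by
    by_cases h0 : eig a k = 0
    · simp [h0]
    · rw [integral_exp_mul (neg_ne_zero.2 h0), mul_div_cancel₀ _ (neg_ne_zero.2 h0)]
  linear_combination h k * h1 - z k * h2

lemma summable_abs_modal (ha : ∀ i, 0 < a i) {S : ℝ} (hz : ∀ k, |z k| ≤ S)
    (hh : Summable fun k => |h k|) (hu : LocInt u) {t : ℝ} (ht : 0 < t) :
    Summable fun k => |modal a z h u t k| := by
  refine ((summable_abs_mul_exp ha hz ht).add
    (hh.mul_right (∫ s in (0 : ℝ)..t, |u s|))).of_nonneg_of_le (fun _ => abs_nonneg _) fun k => ?_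
  refine (abs_add_le _ _).trans (add_le_add ?_ ?_)
  · rw [abs_mul, abs_of_pos (Real.exp_pos _), mul_comm]
  · rw [abs_mul]
    exact mul_le_mul_of_nonneg_left (abs_duhamel_le hu (eig_nonneg a k) ht.le) (abs_nonneg _)

lemma summable_one_add_eig_mul_add_sq {f g : (Fin 2 → ℕ) → ℝ}
    (hf : Summable fun k => (1 + eig a k) * f k ^ 2)
    (hg : Summable fun k => (1 + eig a k) * g k ^ 2) (r s : ℝ) :
    Summable fun k => (1 + eig a k) * (r * |f k| + s * |g k|) ^ 2 := by
  refine ((hf.mul_left (2 * r ^ 2)).add (hg.mul_left (2 * s ^ 2))).of_nonneg_of_le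
    (fun k => mul_nonneg (by linarith [eig_nonneg a k]) (sq_nonneg _)) fun k => ?_
  have h1 : (r * |f k| + s * |g k|) ^ 2 ≤ 2 * r ^ 2 * f k ^ 2 + 2 * s ^ 2 * g k ^ 2 := by
    rw [← sq_abs (f k), ← sq_abs (g k)]
    nlinarith [sq_nonneg (r * |f k| - s * |g k|)]
  calc (1 + eig a k) * (r * |f k| + s * |g k|) ^ 2
      ≤ (1 + eig a k) * (2 * r ^ 2 * f k ^ 2 + 2 * s ^ 2 * g k ^ 2) :=
        mul_le_mul_of_nonneg_left h1 (by linarith [eig_nonneg a k])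
    _ = _ := by ring

lemma summable_of_abs_le {f g : (Fin 2 → ℕ) → ℝ}
    (hf : Summable fun k => (1 + eig a k) * f k ^ 2) (h : ∀ k, |g k| ≤ f k) :
    Summable fun k => (1 + eig a k) * g k ^ 2 := by
  refine hf.of_nonneg_of_le (fun k => mul_nonneg (by linarith [eig_nonneg a k]) (sq_nonneg _))
    fun k => mul_le_mul_of_nonneg_left ?_ (by linarith [eig_nonneg a k])
  exact sq_le_sq' (neg_le_of_abs_le (h k)) (le_of_abs_le (h k))

/-- Convergence in `H¹` from convergence of the coefficients and domination. -/
lemma tendsto_h1Norm_zero (ha : ∀ i, 0 < a i) {F : Filter ℝ} {f : ℝ → Plane → ℝ}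
    {b : (Fin 2 → ℕ) → ℝ} (hf : ∀ᶠ s in F, MemH1 (rect 0 a) (f s))
    (hb : Summable fun k => (1 + eig a k) * b k ^ 2)
    (hfb : ∀ᶠ s in F, ∀ k, |coef a (f s) k| ≤ b k)
    (hlim : ∀ k, Tendsto (fun s => coef a (f s) k) F (𝓝 0)) :
    Tendsto (fun s => h1Norm (rect 0 a) (f s)) F (𝓝 0) := by
  have h1 : Tendsto (fun s => ∑' k, (1 + eig a k) * coef a (f s) k ^ 2) F
      (𝓝 (∑' _ : Fin 2 → ℕ, (0 : ℝ))) := by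
    refine tendsto_tsum_of_dominated_convergence hb (fun k => ?_) ?_
    · simpa using ((hlim k).pow 2).const_mul (1 + eig a k)
    · filter_upwards [hfb] with s hs k
      have hpos : 0 ≤ 1 + eig a k := by linarith [eig_nonneg a k]
      rw [Real.norm_eq_abs, abs_of_nonneg (mul_nonneg hpos (sq_nonneg _))]
      exact mul_le_mul_of_nonneg_left
        (sq_le_sq' (neg_le_of_abs_le (hs k)) (le_of_abs_le (hs k))) hpos
  rw [tsum_zero] at h1
  have h2 := h1.sqrt
  rw [Real.sqrt_zero] at h2
  refine h2.congr' ?_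
  filter_upwards [hf] with s hs
  rw [(hasSum_h1Norm_sq ha hs).tsum_eq, Real.sqrt_sq (h1Norm_nonneg _ _)]

end modal

lemma IsSolution.congr_input {Ω : Set Plane} {h : Plane → ℝ} {u v : ℝ → ℝ} {z₀ : Plane → ℝ}
    {z : ℝ → Plane → ℝ} (hz : IsSolution Ω h u z₀ z) (huv : ∀ t, 0 < t → u t = v t) :
    IsSolution Ω h v z₀ z where
  initial := hz.initial
  mem_h1 := hz.mem_h1
  continuous_h1 := hz.continuous_h1
  continuousOn := hz.continuousOn
  integrable_input := LocInt.congr hz.integrable_input huv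
  weak_eq φ hφ t ht := by
    rw [← integral_congr_Ioi huv ht]
    exact hz.weak_eq φ hφ t ht

section solution

variable {a : Plane} {h z₀ : Plane → ℝ} {u : ℝ → ℝ} {z : ℝ → Plane → ℝ}

lemma IsSolution.coef_eq (ha : ∀ i, 0 < a i) (hz : IsSolution (rect 0 a) h u z₀ z) {t : ℝ}
    (ht : 0 ≤ t) (k : Fin 2 → ℕ) :
    coef a (z t) k = modal a (coef a z₀) (coef a h) u t k := by
  have hcont : ContinuousOn (fun t => coef a (z t) k) (Ici 0) := by
    intro t ht
    have h1 := hz.continuous_h1 t ht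
    rw [ContinuousWithinAt, tendsto_iff_norm_sub_tendsto_zero]
    refine squeeze_zero' (Eventually.of_forall fun _ => norm_nonneg _) ?_ h1
    filter_upwards [self_mem_nhdsWithin] with s hs
    have hs' := hz.mem_h1 s hs
    have ht' := hz.mem_h1 t ht
    rw [Real.norm_eq_abs, ← coef_sub hs'.1 ht'.1]
    exact abs_coef_le_h1Norm ha (hs'.sub ht') k
  have hu : LocInt u := hz.integrable_input
  have heq : ∀ t, 0 ≤ t → coef a (z t) k = coef a z₀ k -
      eig a k * (∫ s in (0 : ℝ)..t, coef a (z s) k) + ∫ s in (0 : ℝ)..t, coef a h k * u s := by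
    intro t ht
    -- The mode is itself admissible in the weak formulation, and Green's formula turns the gradient
    -- term into `eig a k` times the coefficient.
    have h1 := hz.weak_eq (mode a k) (contDiff_mode a k) t ht
    have h2 : ∫ s in (0 : ℝ)..t, ∫ x in rect 0 a,
        fderiv ℝ (mode a k) x (weakGrad (rect 0 a) (z s) x) =
        ∫ s in (0 : ℝ)..t, eig a k * coef a (z s) k := by
      refine integral_congr_Ioi (u := fun s => ∫ x in rect 0 a,
        fderiv ℝ (mode a k) x (weakGrad (rect 0 a) (z s) x)) (fun s hs => ?_) ht
      have hs' := hz.mem_h1 s hs.le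
      rw [← integral_inner_grad_mode ha hs'.1 (isL2Gradient_weakGrad hs') k]
      simp only [inner_grad]
    rw [h2, intervalIntegral.integral_const_mul] at h1
    rw [intervalIntegral.integral_const_mul]
    change coef a (z t) k - coef a z₀ k = _ + _ * coef a h k at h1
    linarith
  rw [eq_duhamel_of_integral_eq hcont (hu.const_mul _) heq ht, duhamel_const_mul]
  rfl

lemma IsSolution.summable_abs_coef (ha : ∀ i, 0 < a i) (hz : IsSolution (rect 0 a) h u z₀ z)
    (hz₀ : MemH1 (rect 0 a) z₀) (hh : Summable fun k => |coef a h k|) {t : ℝ} (ht : 0 < t) :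
    Summable fun k => |coef a (z t) k| := by
  simp only [hz.coef_eq ha ht.le]
  exact summable_abs_modal ha (abs_coef_le_h1Norm ha hz₀) hh hz.integrable_input ht

lemma IsSolution.eqOn_series (ha : ∀ i, 0 < a i) (hz : IsSolution (rect 0 a) h u z₀ z)
    (hz₀ : MemH1 (rect 0 a) z₀) (hh : Summable fun k => |coef a h k|) {t : ℝ} (ht : 0 < t) :
    EqOn (z t) (series a (coef a (z t))) (rect 0 a) :=
  FilamentObs.eqOn_series ha (hz.mem_h1 t ht.le).1 (hz.continuousOn t ht)
    (hz.summable_abs_coef ha hz₀ hh ht)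

lemma IsSolution.filamentOutput_eq (ha : ∀ i, 0 < a i) {σ : Set Plane} (hσ : IsFilament a σ)
    (hz : IsSolution (rect 0 a) h u z₀ z)
    (hz₀ : MemH1 (rect 0 a) z₀) (hh : Summable fun k => |coef a h k|) {t : ℝ} (ht : 0 < t) :
    filamentOutput σ (z t) =
      ∑' k, modeOutput a σ k * modal a (coef a z₀) (coef a h) u t k := by
  rw [hσ.filamentOutput_congr (hz.eqOn_series ha hz₀ hh ht),
    hσ.filamentOutput_series ha (hz.summable_abs_coef ha hz₀ hh ht)]
  exact tsum_congr fun k => by rw [hz.coef_eq ha ht.le]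

/-- Every initial datum and every input give rise to a solution. -/
theorem exists_isSolution (ha : ∀ i, 0 < a i) (hz₀ : MemH1 (rect 0 a) z₀)
    (hh1 : MemH1 (rect 0 a) h) (hh : Summable fun k => |coef a h k|) (hu : LocInt u) :
    ∃ z, z 0 = z₀ ∧ IsSolution (rect 0 a) h u z₀ z := by
  set c : ℝ → (Fin 2 → ℕ) → ℝ := modal a (coef a z₀) (coef a h) u with hc
  have hcS : ∀ t, 0 < t → Summable fun k => |c t k| := fun t ht =>
    summable_abs_modal ha (abs_coef_le_h1Norm ha hz₀) hh hu ht
  -- At time 0 the datum itself is used, since its series of modes need not converge pointwise.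
  let z : ℝ → Plane → ℝ := fun t => if t ≤ 0 then z₀ else series a (c t)
  have hz0 : z 0 = z₀ := if_pos le_rfl
  have hzt : ∀ t, 0 < t → z t = series a (c t) := fun t ht => if_neg (not_le.2 ht)
  have hbS : ∀ r s : ℝ, Summable fun k =>
      (1 + eig a k) * (r * |coef a z₀ k| + s * |coef a h k|) ^ 2 := fun r s =>
    summable_one_add_eig_mul_add_sq (hasSum_h1Norm_sq ha hz₀).summable
      (hasSum_h1Norm_sq ha hh1).summable r s
  have hcb : ∀ s T, 0 ≤ s → s ≤ T → ∀ k,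
      |c s k| ≤ 1 * |coef a z₀ k| + (∫ r in (0 : ℝ)..T, |u r|) * |coef a h k| := by
    intro s T hs hT k
    rw [one_mul, mul_comm (∫ r in (0 : ℝ)..T, |u r|)]
    exact abs_modal_le hu hs hT k
  have hmem : ∀ t, 0 ≤ t → MemH1 (rect 0 a) (z t) := by
    intro t ht
    rcases ht.eq_or_lt with rfl | ht
    · rw [hz0]; exact hz₀
    · obtain ⟨f, hf, hfc⟩ := exists_memH1_of_summable ha (c := c t)
        (summable_of_abs_le (hbS 1 _) (hcb t t ht.le le_rfl))
      refine hf.congr ?_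
      rw [hzt t ht]
      exact ae_eq_of_coef_eq ha hf.1 (memLp_series ha (hcS t ht)) fun k => by
        rw [hfc, coef_series ha (hcS t ht)]
  have hcoef : ∀ t, 0 ≤ t → ∀ k, coef a (z t) k = c t k := by
    intro t ht k
    rcases ht.eq_or_lt with rfl | ht
    · rw [hz0, hc, modal_zero_time]
    · rw [hzt t ht, coef_series ha (hcS t ht)]
  refine ⟨z, hz0, ⟨by rw [hz0], hmem, fun t ht => ?_, fun t ht => ?_, hu, fun φ hφ t ht => ?_⟩⟩
  · have hsub : ∀ s, 0 ≤ s → ∀ k, coef a (fun x => z s x - z t x) k = c s k - c t k := by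
      intro s hs k
      rw [coef_sub (hmem s hs).1 (hmem t ht).1, hcoef s hs, hcoef t ht]
    refine tendsto_h1Norm_zero ha
      (b := fun k => 2 * |coef a z₀ k| + (2 * ∫ r in (0 : ℝ)..(t + 1), |u r|) * |coef a h k|)
      ?_ (hbS _ _) ?_ fun k => ?_
    · filter_upwards [self_mem_nhdsWithin] with s hs
      exact (hmem s hs).sub (hmem t ht)
    · filter_upwards [self_mem_nhdsWithin, mem_nhdsWithin_of_mem_nhds (Iio_mem_nhds
        (lt_add_one t))] with s hs hs' k
      rw [hsub s hs]
      have h1 := hcb s (t + 1) hs (le_of_lt hs') k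
      have h2 := hcb t (t + 1) ht (by linarith) k
      have h3 := abs_sub (c s k) (c t k)
      linarith
    · have h1 : Tendsto (fun s => c s k) (𝓝[Ici 0] t) (𝓝 (c t k)) :=
        continuousOn_modal hu k t ht
      have h2 := h1.sub_const (c t k)
      rw [sub_self] at h2
      refine h2.congr' ?_
      filter_upwards [self_mem_nhdsWithin] with s hs
      rw [hsub s hs]
  · rw [hzt t ht]
    exact (continuous_series ha (hcS t ht)).continuousOn
  · have hφL := memLp_of_continuous hφ.continuous 2 0 a
    have hφ1 : MemH1 (rect 0 a) φ := memH1_of_contDiff 0 a (hφ.of_le (by exact_mod_cast le_top))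
    have s1 := hasSum_coef_mul_coef ha (hmem t ht).1 hφL
    have s2 := hasSum_coef_mul_coef ha hz₀.1 hφL
    have s3 := hasSum_coef_mul_coef ha hh1.1 hφL
    set U := ∫ r in (0 : ℝ)..t, |u r| with hU
    -- Sum and time integral are exchanged by domination, `eig |c φ| ≤ (1 + eig)(X² + φ²)`, where
    -- `X` bounds the coefficients uniformly on `[0, t]` and both terms are summable by Parseval in
    -- `H¹`.
    have s4 : HasSum (fun k => ∫ s in (0 : ℝ)..t, eig a k * (c s k * coef a φ k))
        (∫ s in (0 : ℝ)..t, ∫ x in rect 0 a, fderiv ℝ φ x (weakGrad (rect 0 a) (z s) x)) := by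
      refine intervalIntegral.hasSum_integral_of_dominated_convergence
        (fun k _ => (1 + eig a k) * (1 * |coef a z₀ k| + U * |coef a h k|) ^ 2 +
          (1 + eig a k) * coef a φ k ^ 2) (fun k => ?_) (fun k => ?_) ?_ ?_ ?_
      · have h1 : LocInt fun s => eig a k * (c s k * coef a φ k) :=
          LocInt.of_continuousOn (continuousOn_const.mul
            ((continuousOn_modal hu k).mul continuousOn_const))
        have h2 := h1.intervalIntegrable le_rfl ht
        rw [uIoc_of_le ht]
        exact h2.1.1
      · refine Eventually.of_forall fun s hs => ?_
        rw [uIoc_of_le ht] at hs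
        have h1 := hcb s t hs.1.le hs.2 k
        have he := eig_nonneg a k
        rw [Real.norm_eq_abs, abs_mul, abs_mul, abs_of_nonneg he]
        set X := 1 * |coef a z₀ k| + U * |coef a h k|
        have h2 : |c s k| * |coef a φ k| ≤ X ^ 2 + coef a φ k ^ 2 := by
          rw [← sq_abs (coef a φ k)]
          have h3 : |c s k| * |coef a φ k| ≤ X * |coef a φ k| :=
            mul_le_mul_of_nonneg_right h1 (abs_nonneg _)
          nlinarith [sq_nonneg (X - |coef a φ k|), sq_nonneg X, sq_nonneg |coef a φ k|]
        calc eig a k * (|c s k| * |coef a φ k|) ≤ (1 + eig a k) * (X ^ 2 + coef a φ k ^ 2) :=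
              mul_le_mul (by linarith) h2 (by positivity) (by linarith)
          _ = _ := by ring
      · exact Eventually.of_forall fun s _ =>
          (hbS 1 U).add (hasSum_h1Norm_sq ha hφ1).summable
      · exact intervalIntegrable_const
      · refine Eventually.of_forall fun s hs => ?_
        rw [uIoc_of_le ht] at hs
        have h1 := hasSum_eig_mul_coef ha (hmem s hs.1.le) hφ
        simpa only [hcoef s hs.1.le] using h1
    have s5 := (s4.neg).add (s3.mul_left (∫ s in (0 : ℝ)..t, u s))
    refine (s1.sub s2).unique (s5.congr_fun fun k => ?_)
    rw [hcoef t ht, intervalIntegral.integral_const_mul, intervalIntegral.integral_mul_const]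
    have h1 := modal_integral_eq (a := a) (z := coef a z₀) (h := coef a h) hu ht k
    rw [← sub_mul]
    simp only [hc]
    rw [h1]; ring

end solution

/-! ### The diffusion system -/

lemma memH1_zero (l r : Plane) : MemH1 (rect l r) 0 := memH1_of_contDiff l r contDiff_const

lemma coef_zero (a : Plane) : coef a 0 = 0 := by
  ext k; simp [coef]

lemma abs_le_of_summable_sq {ι : Type*} {z : ι → ℝ} (hz : Summable fun k => z k ^ 2) (k : ι) :
    |z k| ≤ √(∑' k, z k ^ 2) :=
  Real.abs_le_sqrt (hz.le_tsum k fun _ _ => sq_nonneg _)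

section state

variable {a : Plane} {z₀ : Plane → ℝ} {z : ℝ → Plane → ℝ}

lemma modal_zero_gain (ζ : (Fin 2 → ℕ) → ℝ) (u : ℝ → ℝ) (t : ℝ) (k : Fin 2 → ℕ) :
    modal a ζ 0 u t k = Real.exp (-eig a k * t) * ζ k := by
  simp [modal]

lemma IsState.coef_eq (ha : ∀ i, 0 < a i) (hz : IsState (rect 0 a) z₀ z) {t : ℝ} (ht : 0 ≤ t)
    (k : Fin 2 → ℕ) : coef a (z t) k = Real.exp (-eig a k * t) * coef a z₀ k := by
  rw [IsSolution.coef_eq ha hz ht, coef_zero, modal_zero_gain]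

lemma summable_abs_coef_zero (a : Plane) : Summable fun k => |coef a 0 k| := by
  simp [coef_zero]

lemma IsState.filamentOutput_eq (ha : ∀ i, 0 < a i) {σ : Set Plane} (hσ : IsFilament a σ)
    (hz₀ : MemH1 (rect 0 a) z₀) (hz : IsState (rect 0 a) z₀ z) {t : ℝ} (ht : 0 < t) :
    filamentOutput σ (z t) = freeOutput (modeOutput a σ) (eig a) (coef a z₀) t := by
  rw [IsSolution.filamentOutput_eq ha hσ hz hz₀ (summable_abs_coef_zero a) ht, coef_zero]
  simp only [modal_zero_gain]
  rfl

/-- The diffusion system is well posed. -/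
theorem wellPosed_isState (ha : ∀ i, 0 < a i) : WellPosed (rect 0 a) (IsState (rect 0 a)) := by
  intro z₀ hz₀
  refine ⟨?_, fun z z' hz hz' t ht => ?_⟩
  · obtain ⟨z, -, hz⟩ := exists_isSolution ha hz₀ (memH1_zero 0 a) (summable_abs_coef_zero a)
      (u := 0) (LocInt.of_continuousOn continuousOn_const)
    exact ⟨z, hz⟩
  · have h1 := IsSolution.eqOn_series ha hz hz₀ (summable_abs_coef_zero a) ht
    have h2 := IsSolution.eqOn_series ha hz' hz₀ (summable_abs_coef_zero a) ht
    have e : coef a (z t) = coef a (z' t) := by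
      ext k; rw [IsState.coef_eq ha hz ht.le, IsState.coef_eq ha hz' ht.le]
    rw [e] at h1
    exact h1.trans h2.symm

/-- A state is an observer of itself. -/
lemma IsState.isObserver {Ω : Set Plane} (hz : IsState Ω z₀ z) (σ : Set Plane) (h : Plane → ℝ) :
    IsObserver Ω σ h (fun t => filamentOutput σ (z t)) z₀ z where
  initial := hz.initial
  mem_h1 := hz.mem_h1
  continuous_h1 := hz.continuous_h1
  continuousOn := hz.continuousOn
  integrable_input t ht := by simp
  weak_eq φ hφ t ht := by
    have := hz.weak_eq φ hφ t ht
    simpa using this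

end state

/-! ### Observers with a small gain -/

/-- A gain that is small in comparison with the spectral gap `lam`. -/
structure IsSmallGain (a : Plane) (σ : Set Plane) (lam : ℝ) (h : Plane → ℝ) : Prop where
  memH1 : MemH1 (rect 0 a) h
  summable : Summable fun k => |coef a h k|
  coef_zero_pos : 0 < coef a h 0
  mul_le : coef a h 0 * modeOutput a σ 0 ≤ lam
  small : modeBound a * (μH[1] : Measure Plane).real σ * (∑' k, |coef a h k|) * (2 / lam) ≤ 1 / 6

lemma exists_isSmallGain {a α β : Plane} (hα : ∀ k, 0 ≤ α k) (hαβ : ∀ k, α k < β k)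
    (hβ : ∀ k, β k ≤ a k) {σ : Set Plane} (hσ : IsFilament a σ) {lam : ℝ} (hlam : 0 < lam) :
    ∃ h : Plane → ℝ, IsSmallGain a σ lam h ∧ ∀ x, x ∉ rect α β → h x = 0 := by
  have ha : ∀ i, 0 < a i := fun i => ((hα i).trans_lt (hαβ i)).trans_le (hβ i)
  obtain ⟨g, hg, hg0, hgs, hgp⟩ := exists_gain hα hαβ hβ
  have hγ := hσ.modeOutput_zero_pos ha
  set B := modeBound a * (μH[1] : Measure Plane).real σ with hB
  have hB0 : 0 ≤ B := (abs_nonneg _).trans (hσ.abs_modeOutput_le ha 0)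
  set S := ∑' k, |coef a g k| with hS
  have hS0 : 0 ≤ S := tsum_nonneg fun k => abs_nonneg _
  -- After scaling by `lam / D` the two smallness conditions read `g₀γ₀ ≤ D` and `2BS / D ≤ 1 / 6`;
  -- hence the summand `12 * B * S`.
  set D := coef a g 0 * modeOutput a σ 0 + 12 * B * S + 1 with hD
  have hp : 0 < coef a g 0 * modeOutput a σ 0 := mul_pos hgp hγ
  have hBS : 0 ≤ B * S := mul_nonneg hB0 hS0
  have hD0 : 0 < D := by rw [hD]; linarith
  set ε := lam / D with hε
  have hε0 : 0 < ε := div_pos hlam hD0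
  refine ⟨fun x => ε * g x, ⟨hg.const_mul ε, ?_, ?_, ?_, ?_⟩, fun x hx => by
    simp only [hg0 x hx, mul_zero]⟩
  · simp only [coef_const_mul, abs_mul]
    exact hgs.mul_left _
  · rw [coef_const_mul]; exact mul_pos hε0 hgp
  · rw [coef_const_mul, mul_assoc, hε, div_mul_eq_mul_div, div_le_iff₀ hD0]
    exact mul_le_mul_of_nonneg_left (by rw [hD]; linarith) hlam.le
  · simp only [coef_const_mul, abs_mul, abs_of_pos hε0]
    rw [tsum_mul_left, ← hS]
    have e : B * (ε * S) * (2 / lam) = 2 * (B * S) / D := by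
      rw [hε]; field_simp
    rw [e, div_le_iff₀ hD0, hD]
    linarith

section observer

variable {a : Plane} {σ : Set Plane} {lam : ℝ} {h : Plane → ℝ}

lemma summable_mode_mul_coef (ha : ∀ i, 0 < a i) (hσ : IsFilament a σ)
    (hh : Summable fun k => |coef a h k|) :
    Summable fun k => |modeOutput a σ k * coef a h k| := by
  refine (hh.mul_left (modeBound a * (μH[1] : Measure Plane).real σ)).of_nonneg_of_le
    (fun _ => abs_nonneg _) fun k => ?_
  rw [abs_mul]
  exact mul_le_mul_of_nonneg_right (hσ.abs_modeOutput_le ha k) (abs_nonneg _)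

lemma tsum_modeOutput_mul_modal (ha : ∀ i, 0 < a i) (hσ : IsFilament a σ)
    (hh : Summable fun k => |coef a h k|) {ζ : (Fin 2 → ℕ) → ℝ} {S : ℝ} (hζ : ∀ k, |ζ k| ≤ S)
    {u : ℝ → ℝ} (hu : LocInt u) {t : ℝ} (ht : 0 < t) :
    ∑' k, modeOutput a σ k * modal a ζ (coef a h) u t k =
      freeOutput (modeOutput a σ) (eig a) ζ t +
        response (fun k => modeOutput a σ k * coef a h k) (eig a) u t := by
  rw [freeOutput, response, ← (summable_freeOutput (hσ.abs_modeOutput_le ha)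
    (summable_abs_mul_exp ha hζ ht)).tsum_add
    (summable_response (eig_nonneg a) (summable_mode_mul_coef ha hσ hh) hu ht.le)]
  exact tsum_congr fun k => by rw [modal]; ring

lemma freeOutput_sub (ha : ∀ i, 0 < a i) (hσ : IsFilament a σ) {ζ ξ : (Fin 2 → ℕ) → ℝ} {S T : ℝ}
    (hζ : ∀ k, |ζ k| ≤ S) (hξ : ∀ k, |ξ k| ≤ T) {t : ℝ} (ht : 0 < t) :
    freeOutput (modeOutput a σ) (eig a) (fun k => ζ k - ξ k) t =
      freeOutput (modeOutput a σ) (eig a) ζ t - freeOutput (modeOutput a σ) (eig a) ξ t := by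
  simp only [freeOutput]
  rw [← (summable_freeOutput (hσ.abs_modeOutput_le ha)
    (summable_abs_mul_exp ha hζ ht)).tsum_sub (summable_freeOutput (hσ.abs_modeOutput_le ha)
    (summable_abs_mul_exp ha hξ ht))]
  exact tsum_congr fun k => by ring

/-- Existence of observers for outputs of the diffusion system. -/
theorem exists_isObserver (ha : ∀ i, 0 < a i) (hσ : IsFilament a σ) (hh1 : MemH1 (rect 0 a) h)
    (hh : Summable fun k => |coef a h k|) {ζ : (Fin 2 → ℕ) → ℝ} (hζ : Summable fun k => ζ k ^ 2)
    {y : ℝ → ℝ} (hy : ∀ t, 0 < t → y t = freeOutput (modeOutput a σ) (eig a) ζ t)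
    {w₀ : Plane → ℝ} (hw₀ : MemH1 (rect 0 a) w₀) :
    ∃ w, w 0 = w₀ ∧ IsObserver (rect 0 a) σ h y w₀ w := by
  obtain ⟨lam, hlam, hgap⟩ := exists_spectral_gap ha
  have hbw := abs_coef_le_h1Norm ha hw₀
  have hbζ := abs_le_of_summable_sq hζ
  have hsw := summable_coef_sq ha hw₀.1
  set ξ : (Fin 2 → ℕ) → ℝ := fun k => ζ k - coef a w₀ k with hξ
  have hbξ : ∀ k, |ξ k| ≤ √(∑' k, ζ k ^ 2) + h1Norm (rect 0 a) w₀ := fun k =>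
    (abs_sub _ _).trans (add_le_add (hbζ k) (hbw k))
  have hsξ : Summable fun k => ξ k ^ 2 := by
    refine ((hζ.mul_left 2).add (hsw.mul_left 2)).of_nonneg_of_le (fun _ => sq_nonneg _)
      fun k => ?_
    simp only [hξ]
    nlinarith [sq_nonneg (ζ k + coef a w₀ k)]
  -- The closed loop input `u = y - Cw` equals the free output of `ζ - w₀` minus the response to `u`
  -- itself, which is the Volterra equation solved next.
  obtain ⟨hfL, C, hC⟩ := locInt_freeOutput (z := ξ) (k₀ := 0) (hσ.abs_modeOutput_le ha) (eig_zero a)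
    hlam hgap (fun t ht => summable_abs_mul_exp ha hbξ ht) (summable_abs_div_eig ha hsξ)
  obtain ⟨u, hu, hueq⟩ := exists_volterra (eig_nonneg a) (summable_mode_mul_coef ha hσ hh) hfL hC
  obtain ⟨w, hw0, hw⟩ := exists_isSolution ha hw₀ hh1 hh hu
  refine ⟨w, hw0, hw.congr_input fun t ht => ?_⟩
  rw [hueq t ht, hw.filamentOutput_eq ha hσ hw₀ hh ht, tsum_modeOutput_mul_modal ha hσ hh hbw hu ht,
    hy t ht, freeOutput_sub ha hσ hbζ hbw ht]
  ring

/-- Two observers of the same output approach each other. -/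
lemma IsObserver.abs_coef_sub_le (ha : ∀ i, 0 < a i) (hσ : IsFilament a σ) (hlam : 0 < lam)
    (hgap : ∀ k, k ≠ 0 → lam ≤ eig a k) (hh : IsSmallGain a σ lam h) {y : ℝ → ℝ}
    {w₀ w₀' : Plane → ℝ} {w w' : ℝ → Plane → ℝ} (hw₀ : MemH1 (rect 0 a) w₀)
    (hw₀' : MemH1 (rect 0 a) w₀') (hw : IsObserver (rect 0 a) σ h y w₀ w)
    (hw' : IsObserver (rect 0 a) σ h y w₀' w') {t : ℝ} (ht : 0 ≤ t) (k : Fin 2 → ℕ) :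
    |coef a (w t) k - coef a (w' t) k| ≤
      Real.exp (-(coef a h 0 * modeOutput a σ 0 / 2) * t) *
        (|coef a w₀ k - coef a w₀' k| + |coef a h k| *
          (4 / coef a h 0 * |coef a w₀ 0 - coef a w₀' 0| +
            12 * (modeBound a * (μH[1] : Measure Plane).real σ) *
              ∑' k, |coef a w₀ k - coef a w₀' k| / eig a k)) := by
  have hb := abs_coef_le_h1Norm ha hw₀
  have hb' := abs_coef_le_h1Norm ha hw₀'
  set ζ : (Fin 2 → ℕ) → ℝ := fun k => coef a w₀ k - coef a w₀' k with hζ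
  have hbζ : ∀ k, |ζ k| ≤ h1Norm (rect 0 a) w₀ + h1Norm (rect 0 a) w₀' := fun k =>
    (abs_sub _ _).trans (add_le_add (hb k) (hb' k))
  have hsζ : Summable fun k => ζ k ^ 2 := by
    have := summable_coef_sq ha (hw₀.sub hw₀').1
    simpa only [coef_sub hw₀.1 hw₀'.1] using this
  have hu1 : LocInt fun t => y t - filamentOutput σ (w t) := IsSolution.integrable_input hw
  have hu2 : LocInt fun t => y t - filamentOutput σ (w' t) := IsSolution.integrable_input hw'
  -- The measured output cancels, so the difference of the observers is driven by its own output
  -- alone.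
  set u : ℝ → ℝ := fun t => (y t - filamentOutput σ (w t)) - (y t - filamentOutput σ (w' t)) with hu
  have huL : LocInt u := hu1.sub hu2
  have hmodal : ∀ t, 0 ≤ t → ∀ k, coef a (w t) k - coef a (w' t) k =
      Real.exp (-eig a k * t) * ζ k + coef a h k * duhamel (eig a k) u t := by
    intro t ht k
    rw [IsSolution.coef_eq ha hw ht, IsSolution.coef_eq ha hw' ht, modal, modal, hu,
      duhamel_sub hu1 hu2 _ ht]
    ring
  rw [hmodal t ht k]
  refine abs_le_of_small_feedback (hσ.abs_modeOutput_le ha) (eig_zero a) hlam hgap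
    (hσ.modeOutput_zero_pos ha) hh.summable hh.coef_zero_pos hh.mul_le hh.small
    (fun t ht => summable_abs_mul_exp ha hbζ ht) (summable_abs_div_eig ha hsζ) huL
    (fun t ht => ?_) ht k
  have s1 : ∀ (v₀ : Plane → ℝ) (v : ℝ → Plane → ℝ), MemH1 (rect 0 a) v₀ →
      IsObserver (rect 0 a) σ h y v₀ v →
      Summable (fun k => modeOutput a σ k * coef a (v t) k) ∧
        filamentOutput σ (v t) = ∑' k, modeOutput a σ k * coef a (v t) k := by
    intro v₀ v hv₀ hv
    have hs := IsSolution.summable_abs_coef ha hv hv₀ hh.summable ht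
    refine ⟨?_, ?_⟩
    · refine (hs.mul_left (modeBound a * (μH[1] : Measure Plane).real σ)).of_norm_bounded
        fun k => ?_
      rw [Real.norm_eq_abs, abs_mul]
      exact mul_le_mul_of_nonneg_right (hσ.abs_modeOutput_le ha k) (abs_nonneg _)
    · rw [hσ.filamentOutput_congr (IsSolution.eqOn_series ha hv hv₀ hh.summable ht),
        hσ.filamentOutput_series ha hs]
  obtain ⟨a1, a2⟩ := s1 w₀ w hw₀ hw
  obtain ⟨b1, b2⟩ := s1 w₀' w' hw₀' hw'
  have e : u t = -(filamentOutput σ (w t) - filamentOutput σ (w' t)) := by simp only [hu]; ring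
  rw [e, a2, b2, ← a1.tsum_sub b1]
  congr 1
  exact tsum_congr fun k => by rw [← hmodal t ht.le k]; ring

theorem wellPosed_isObserver (ha : ∀ i, 0 < a i) (hσ : IsFilament a σ) (hlam : 0 < lam)
    (hgap : ∀ k, k ≠ 0 → lam ≤ eig a k) (hh : IsSmallGain a σ lam h) {z₀ : Plane → ℝ}
    {z : ℝ → Plane → ℝ} (hz₀ : MemH1 (rect 0 a) z₀) (hz : IsState (rect 0 a) z₀ z) :
    WellPosed (rect 0 a) (IsObserver (rect 0 a) σ h fun t => filamentOutput σ (z t)) := by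
  intro w₀ hw₀
  refine ⟨?_, fun w w' hw hw' t ht => ?_⟩
  · obtain ⟨w, -, hw⟩ := exists_isObserver ha hσ hh.memH1 hh.summable (summable_coef_sq ha hz₀.1)
      (fun t ht => IsState.filamentOutput_eq ha hσ hz₀ hz ht) hw₀
    exact ⟨w, hw⟩
  · have h1 := IsSolution.eqOn_series ha hw hw₀ hh.summable ht
    have h2 := IsSolution.eqOn_series ha hw' hw₀ hh.summable ht
    -- With equal initial data the right side of the decay estimate is zero.
    have e : coef a (w t) = coef a (w' t) := by
      ext k
      have := IsObserver.abs_coef_sub_le ha hσ hlam hgap hh hw₀ hw₀ hw hw' ht.le k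
      simp only [sub_self, abs_zero, zero_div, tsum_zero, mul_zero, add_zero] at this
      exact sub_eq_zero.1 (abs_eq_zero.1 (le_antisymm this (abs_nonneg _)))
    rw [e] at h1
    exact h1.trans h2.symm

/-- The estimates of the modes are squared and summed with the weights `1 + eig a k`. The part with
`|ζ k|` sums to the norm of the initial difference, the part with `|coef a h k|` to the norm of the
gain. -/
theorem exists_forall_h1Norm_sub_le (ha : ∀ i, 0 < a i) (hσ : IsFilament a σ) (hlam : 0 < lam)
    (hgap : ∀ k, k ≠ 0 → lam ≤ eig a k) (hh : IsSmallGain a σ lam h) :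
    ∃ F κ : ℝ, 0 < F ∧ 0 < κ ∧ ∀ (y : ℝ → ℝ) (w₀ w₀' : Plane → ℝ) (w w' : ℝ → Plane → ℝ),
      MemH1 (rect 0 a) w₀ → MemH1 (rect 0 a) w₀' → IsObserver (rect 0 a) σ h y w₀ w →
      IsObserver (rect 0 a) σ h y w₀' w' → ∀ t, 0 ≤ t →
        h1Norm (rect 0 a) (fun x => w t x - w' t x) ≤
          F * Real.exp (-κ * t) * h1Norm (rect 0 a) (fun x => w₀ x - w₀' x) := by
  set B := modeBound a * (μH[1] : Measure Plane).real σ with hB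
  have hB0 : 0 ≤ B := (abs_nonneg _).trans (hσ.abs_modeOutput_le ha 0)
  set κ := coef a h 0 * modeOutput a σ 0 / 2 with hκ
  have hκ0 : 0 < κ := half_pos (mul_pos hh.coef_zero_pos (hσ.modeOutput_zero_pos ha))
  set S := ∑' k, (eig a k ^ 2)⁻¹ with hS
  have hS0 : 0 ≤ S := tsum_nonneg fun k => by positivity
  set M := 4 / coef a h 0 + 12 * B * (1 + S) with hM
  have hh0 := hh.coef_zero_pos
  have hM0 : 0 ≤ M := by positivity
  set H := h1Norm (rect 0 a) h with hH
  -- This constant arises for the squared norms. Being at least 1 it is below its own square, so it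
  -- also serves for the norms.
  refine ⟨2 + 2 * (M * H) ^ 2, κ, by positivity, hκ0, ?_⟩
  intro y w₀ w₀' w w' hw₀ hw₀' hw hw' t ht
  have hd := hw₀.sub hw₀'
  set E := h1Norm (rect 0 a) (fun x => w₀ x - w₀' x) with hE
  have hE0 : 0 ≤ E := h1Norm_nonneg _ _
  have hdt := (IsSolution.mem_h1 hw t ht).sub (IsSolution.mem_h1 hw' t ht)
  have hcd := coef_sub hw₀.1 hw₀'.1
  set ζ : (Fin 2 → ℕ) → ℝ := fun k => coef a w₀ k - coef a w₀' k with hζ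
  have hsq : Summable fun k => ζ k ^ 2 := by
    have := summable_coef_sq ha hd.1
    simpa only [hcd] using this
  have hsqE : ∑' k, ζ k ^ 2 ≤ E ^ 2 := by
    have := tsum_coef_sq_le ha hd
    simpa only [hcd] using this
  have hME : 4 / coef a h 0 * |ζ 0| + 12 * B * ∑' k, |ζ k| / eig a k ≤ M * E := by
    have h1 : |ζ 0| ≤ E := by
      have := abs_coef_le_h1Norm ha hd 0
      rwa [hcd] at this
    have h2 := tsum_abs_div_eig_le ha hsq hE0 hsqE
    calc 4 / coef a h 0 * |ζ 0| + 12 * B * ∑' k, |ζ k| / eig a k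
        ≤ 4 / coef a h 0 * E + 12 * B * ((1 + S) * E) := by gcongr
      _ = _ := by rw [hM]; ring
  have hpt : ∀ k, |coef a (fun x => w t x - w' t x) k| ≤
      Real.exp (-κ * t) * (|ζ k| + |coef a h k| * (M * E)) := by
    intro k
    rw [coef_sub (IsSolution.mem_h1 hw t ht).1 (IsSolution.mem_h1 hw' t ht).1]
    refine (IsObserver.abs_coef_sub_le ha hσ hlam hgap hh hw₀ hw₀' hw hw' ht k).trans ?_
    refine mul_le_mul_of_nonneg_left ?_ (Real.exp_pos _).le
    exact add_le_add le_rfl (mul_le_mul_of_nonneg_left hME (abs_nonneg _))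
  set X := Real.exp (-κ * t) with hX
  have hX0 : 0 < X := Real.exp_pos _
  have hs1 : HasSum (fun k => (1 + eig a k) * ζ k ^ 2) (E ^ 2) := by
    have := hasSum_h1Norm_sq ha hd
    simpa only [hcd] using this
  have hs2 := hasSum_h1Norm_sq ha hh.memH1
  have hs3 := (hs1.mul_left (2 * X ^ 2)).add (hs2.mul_left (2 * X ^ 2 * (M * E) ^ 2))
  have hle : h1Norm (rect 0 a) (fun x => w t x - w' t x) ^ 2 ≤
      2 * X ^ 2 * E ^ 2 + 2 * X ^ 2 * (M * E) ^ 2 * H ^ 2 := by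
    refine hasSum_le (fun k => ?_) (hasSum_h1Norm_sq ha hdt) hs3
    have hp := hpt k
    have hpos : 0 ≤ 1 + eig a k := by linarith [eig_nonneg a k]
    have h1 : coef a (fun x => w t x - w' t x) k ^ 2 ≤
        (X * (|ζ k| + |coef a h k| * (M * E))) ^ 2 :=
      sq_le_sq' (neg_le_of_abs_le hp) (le_of_abs_le hp)
    have h2 : (|ζ k| + |coef a h k| * (M * E)) ^ 2 ≤
        2 * ζ k ^ 2 + 2 * (M * E) ^ 2 * coef a h k ^ 2 := by
      rw [← sq_abs (ζ k), ← sq_abs (coef a h k)]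
      nlinarith [sq_nonneg (|ζ k| - |coef a h k| * (M * E))]
    calc (1 + eig a k) * coef a (fun x => w t x - w' t x) k ^ 2
        ≤ (1 + eig a k) * (X ^ 2 * (2 * ζ k ^ 2 + 2 * (M * E) ^ 2 * coef a h k ^ 2)) := by
          refine mul_le_mul_of_nonneg_left (h1.trans ?_) hpos
          rw [mul_pow]
          exact mul_le_mul_of_nonneg_left h2 (sq_nonneg _)
      _ = _ := by ring
  refine le_of_abs_le (abs_le_of_sq_le_sq (hle.trans ?_) (by positivity))
  have e : 2 * X ^ 2 * E ^ 2 + 2 * X ^ 2 * (M * E) ^ 2 * H ^ 2 =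
      (2 + 2 * (M * H) ^ 2) * (X * E) ^ 2 := by ring
  rw [e, mul_assoc _ X E, mul_pow _ (X * E)]
  refine mul_le_mul_of_nonneg_right ?_ (sq_nonneg _)
  nlinarith [sq_nonneg (M * H)]

/-! ### Behaviour at time zero and the domain of the generator. -/

lemma tendsto_integral_div {u : ℝ → ℝ} (hu : LocInt u) {L : ℝ}
    (hL : Tendsto u (𝓝[>] 0) (𝓝 L)) :
    Tendsto (fun t => (∫ s in (0 : ℝ)..t, u s) / t) (𝓝[>] 0) (𝓝 L) := by
  rw [Metric.tendsto_nhds]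
  intro ε hε
  have h1 := (Metric.tendsto_nhds.1 hL) (ε / 2) (half_pos hε)
  rw [eventually_nhdsWithin_iff, Metric.eventually_nhds_iff] at h1
  obtain ⟨δ, hδ, h1⟩ := h1
  filter_upwards [self_mem_nhdsWithin, mem_nhdsWithin_of_mem_nhds (Iio_mem_nhds hδ)] with t ht htδ
  have ht0 : (0 : ℝ) < t := ht
  have htd : t < δ := htδ
  have h2 := intervalIntegral.norm_integral_le_of_norm_le_const (a := 0) (b := t)
    (f := fun s => u s - L) (C := ε / 2) (fun s hs => by
      rw [uIoc_of_le ht0.le] at hs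
      have := h1 (y := s) (by rw [Real.dist_eq, sub_zero, abs_of_pos hs.1]; linarith [hs.2]) hs.1
      exact this.le)
  rw [intervalIntegral.integral_sub (hu t ht0) intervalIntegrable_const,
    intervalIntegral.integral_const, sub_zero, smul_eq_mul, abs_of_pos ht0, Real.norm_eq_abs] at h2
  rw [Real.dist_eq]
  have h3 : (∫ s in (0 : ℝ)..t, u s) / t - L = ((∫ s in (0 : ℝ)..t, u s) - t * L) / t := by
    field_simp
  rw [h3, abs_div, abs_of_pos ht0, div_lt_iff₀ ht0]
  nlinarith

/-- Divide the integrated equation by `t`: the term with `l` is a mean of the response, which tends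
to 0. -/
lemma tendsto_duhamel_div {u : ℝ → ℝ} (hu : LocInt u) {L : ℝ}
    (hL : Tendsto u (𝓝[>] 0) (𝓝 L)) (l : ℝ) :
    Tendsto (fun t => duhamel l u t / t) (𝓝[>] 0) (𝓝 L) := by
  have hc := continuousOn_duhamel hu l
  have h0 : Tendsto (duhamel l u) (𝓝[>] 0) (𝓝 0) := by
    have := (hc 0 (mem_Ici.2 le_rfl)).tendsto
    rw [duhamel_zero_right] at this
    exact this.mono_left (nhdsWithin_mono _ Ioi_subset_Ici_self)
  have h1 := ((tendsto_integral_div (LocInt.of_continuousOn hc) h0).const_mul (-l)).add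
    (tendsto_integral_div hu hL)
  rw [mul_zero, zero_add] at h1
  refine h1.congr' ?_
  filter_upwards [self_mem_nhdsWithin] with t ht
  have ht0 : (0 : ℝ) < t := ht
  rw [duhamel_integral_eq hu l ht0.le]
  ring

lemma tendsto_exp_sub_one_div (l : ℝ) :
    Tendsto (fun t => (Real.exp (-l * t) - 1) / t) (𝓝[>] 0) (𝓝 (-l)) := by
  have h : HasDerivAt (fun t : ℝ => Real.exp (-l * t)) (-l) 0 := by
    simpa using ((hasDerivAt_id (0 : ℝ)).const_mul (-l)).exp
  refine h.tendsto_slope_zero_right.congr fun t => ?_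
  simp [div_eq_inv_mul]

lemma memH1_quotient {Ω : Set Plane} {f f₀ g : Plane → ℝ} (hf : MemH1 Ω f) (hf₀ : MemH1 Ω f₀)
    (hg : MemH1 Ω g) (t : ℝ) : MemH1 Ω (fun x => (f x - f₀ x) / t - g x) := by
  simpa only [div_eq_inv_mul] using ((hf.sub hf₀).const_mul t⁻¹).sub hg

lemma coef_quotient {f f₀ g : Plane → ℝ} (hf : MemH1 (rect 0 a) f) (hf₀ : MemH1 (rect 0 a) f₀)
    (hg : MemH1 (rect 0 a) g) (t : ℝ) (k : Fin 2 → ℕ) :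
    coef a (fun x => (f x - f₀ x) / t - g x) k =
      (coef a f k - coef a f₀ k) / t - coef a g k := by
  have h1 := coef_sub ((hf.sub hf₀).const_mul t⁻¹).1 hg.1 k
  rw [coef_const_mul, coef_sub hf.1 hf₀.1] at h1
  simpa only [div_eq_inv_mul] using h1

/-- The domain of the generator of the diffusion system is contained in that of the generator of
the observer. -/
theorem inDomain_isObserver (ha : ∀ i, 0 < a i) (hσ : IsFilament a σ)
    (hh1 : MemH1 (rect 0 a) h) (hh : Summable fun k => |coef a h k|) {z₀ : Plane → ℝ}
    (hz₀D : InDomain (rect 0 a) (IsState (rect 0 a)) z₀) :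
    InDomain (rect 0 a) (IsObserver (rect 0 a) σ h 0) z₀ := by
  obtain ⟨hz₀, z, hz, g, hg, hlim⟩ := hz₀D
  -- Convergence in `H¹` implies convergence of each coefficient, which identifies `g` with `Δz₀`.
  have hgk : ∀ k, coef a g k = -eig a k * coef a z₀ k := by
    intro k
    have h1 : Tendsto (fun t => (coef a (z t) k - coef a z₀ k) / t - coef a g k) (𝓝[>] 0)
        (𝓝 0) := by
      rw [tendsto_zero_iff_abs_tendsto_zero]
      refine squeeze_zero' (Eventually.of_forall fun _ => abs_nonneg _) ?_ hlim
      filter_upwards [self_mem_nhdsWithin] with t ht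
      have hzt := IsSolution.mem_h1 hz t (le_of_lt ht)
      simp only [Function.comp]
      rw [← coef_quotient hzt hz₀ hg]
      exact abs_coef_le_h1Norm ha (memH1_quotient hzt hz₀ hg t) k
    have h2 : Tendsto (fun t => (coef a (z t) k - coef a z₀ k) / t - coef a g k) (𝓝[>] 0)
        (𝓝 (-eig a k * coef a z₀ k - coef a g k)) := by
      refine (((tendsto_exp_sub_one_div (eig a k)).mul_const (coef a z₀ k)).sub_const
        (coef a g k)).congr' ?_
      filter_upwards [self_mem_nhdsWithin] with t ht
      rw [IsState.coef_eq ha hz (le_of_lt ht)]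
      ring
    have := tendsto_nhds_unique h1 h2
    linarith
  -- Off the constant mode `|z₀ k| = |g k| / eig a k`, which is summable because `g` is square
  -- integrable. So for `z₀` in the domain the output has a limit at time 0.
  have hzS : Summable fun k => |coef a z₀ k| := by
    obtain ⟨lam, hlam, hgap⟩ := exists_spectral_gap ha
    have h1 := (summable_abs_div_eig ha (summable_coef_sq ha hg.1)).add
      (hasSum_ite_eq (0 : Fin 2 → ℕ) |coef a z₀ 0|).summable
    refine h1.of_nonneg_of_le (fun _ => abs_nonneg _) fun k => ?_
    by_cases hk : k = 0
    · subst hk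
      simp [eig_zero]
    · have hpos : 0 < eig a k := hlam.trans_le (hgap k hk)
      rw [if_neg hk, add_zero, hgk, abs_mul, abs_neg, abs_of_pos hpos, mul_div_cancel_left₀ _
        hpos.ne']
  obtain ⟨w, hw0, hw⟩ := exists_isObserver ha hσ hh1 hh (ζ := 0) (by simp)
    (y := 0) (fun t _ => by simp [freeOutput]) hz₀
  set u : ℝ → ℝ := fun t => (0 : ℝ → ℝ) t - filamentOutput σ (w t) with hu
  have huL : LocInt u := IsSolution.integrable_input hw
  set c₀ := ∑' k, modeOutput a σ k * coef a z₀ k with hc₀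
  set p : (Fin 2 → ℕ) → ℝ := fun k => modeOutput a σ k * coef a h k with hp
  have hpS := summable_mode_mul_coef ha hσ hh
  have hulim : Tendsto u (𝓝[>] 0) (𝓝 (-c₀)) := by
    have h1 : Tendsto (freeOutput (modeOutput a σ) (eig a) (coef a z₀)) (𝓝[>] 0) (𝓝 c₀) := by
      refine tendsto_tsum_of_dominated_convergence
        (hzS.mul_left (modeBound a * (μH[1] : Measure Plane).real σ)) (fun k => ?_) ?_
      · have : Continuous fun t : ℝ => modeOutput a σ k * (Real.exp (-eig a k * t) * coef a z₀ k) := by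
          fun_prop
        have h2 := (this.tendsto 0).mono_left (nhdsWithin_le_nhds (s := Ioi 0))
        simpa using h2
      · filter_upwards [self_mem_nhdsWithin] with t ht k
        rw [Real.norm_eq_abs, abs_mul]
        exact mul_le_mul (hσ.abs_modeOutput_le ha k) (abs_exp_neg_eig_mul_le (le_of_lt ht) k)
          (abs_nonneg _) ((abs_nonneg _).trans (hσ.abs_modeOutput_le ha k))
    have h2 : Tendsto (response p (eig a) u) (𝓝[>] 0) (𝓝 0) := by
      have h3 := (continuousOn_response (eig_nonneg a) hpS huL 0 (mem_Ici.2 le_rfl)).tendsto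
      have h4 : response p (eig a) u 0 = 0 := by simp [response, duhamel_zero_right]
      rw [h4] at h3
      exact h3.mono_left (nhdsWithin_mono _ Ioi_subset_Ici_self)
    have h5 := (h1.add h2).neg
    rw [add_zero] at h5
    refine h5.congr' ?_
    filter_upwards [self_mem_nhdsWithin] with t ht
    rw [← tsum_modeOutput_mul_modal ha hσ hh (abs_coef_le_h1Norm ha hz₀) huL ht,
      ← IsSolution.filamentOutput_eq ha hσ hw hz₀ hh ht]
    simp [hu]
  -- The derivative at time 0 is `Δz₀ - (Cz₀) h`, with `c₀` in the role of `Cz₀`; it lies in `H¹`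
  -- because `g` and `h` do.
  refine ⟨hz₀, w, hw, fun x => 1 * g x + -c₀ * h x, hg.linear hh1 1 (-c₀), ?_⟩
  have hg' := hg.linear hh1 1 (-c₀)
  have hcoef : ∀ t, 0 < t → ∀ k,
      coef a (fun x => (w t x - z₀ x) / t - (1 * g x + -c₀ * h x)) k =
        ((Real.exp (-eig a k * t) - 1) / t * coef a z₀ k - coef a g k) +
          coef a h k * (duhamel (eig a k) u t / t + c₀) := by
    intro t ht k
    rw [coef_quotient (IsSolution.mem_h1 hw t ht.le) hz₀ hg', coef_linear hg.1 hh1.1,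
      IsSolution.coef_eq ha hw ht.le, modal]
    ring
  refine tendsto_h1Norm_zero ha
    -- The quotient of the free part is at most `|g k|`, as `|exp (-l t) - 1| ≤ l t`. The response
    -- divided by `t` is at most the mean of `|u|` over `[0, t]`, eventually below `|c₀| + 1`.
    (b := fun k => 2 * |coef a g k| + (2 * |c₀| + 1) * |coef a h k|) ?_
    (summable_one_add_eig_mul_add_sq (hasSum_h1Norm_sq ha hg).summable
      (hasSum_h1Norm_sq ha hh1).summable _ _) ?_ fun k => ?_
  · filter_upwards [self_mem_nhdsWithin] with t ht
    exact memH1_quotient (IsSolution.mem_h1 hw t (le_of_lt ht)) hz₀ hg' t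
  · have h1 := tendsto_integral_div huL.abs hulim.abs
    rw [abs_neg] at h1
    filter_upwards [self_mem_nhdsWithin, h1.eventually_le_const (lt_add_one |c₀|)] with t ht h2 k
    have ht0 : (0 : ℝ) < t := ht
    have he := eig_nonneg a k
    rw [hcoef t ht0]
    have h3 : |(Real.exp (-eig a k * t) - 1) / t * coef a z₀ k| ≤ |coef a g k| := by
      rw [abs_mul, abs_div, abs_of_pos ht0, hgk, abs_mul, abs_neg, abs_of_nonneg he]
      refine mul_le_mul_of_nonneg_right ?_ (abs_nonneg _)
      rw [div_le_iff₀ ht0, abs_sub_comm, abs_of_nonneg]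
      · have := Real.add_one_le_exp (-eig a k * t)
        linarith
      · rw [sub_nonneg, Real.exp_le_one_iff]
        nlinarith
    have h4 : |duhamel (eig a k) u t / t| ≤ |c₀| + 1 := by
      rw [abs_div, abs_of_pos ht0]
      refine le_trans ?_ h2
      exact div_le_div_of_nonneg_right (abs_duhamel_le huL he ht0.le) ht0.le
    have h5 : |coef a h k * (duhamel (eig a k) u t / t + c₀)| ≤ |coef a h k| * (2 * |c₀| + 1) := by
      rw [abs_mul]
      refine mul_le_mul_of_nonneg_left ((abs_add_le _ _).trans ?_) (abs_nonneg _)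
      linarith
    have h6 := abs_sub ((Real.exp (-eig a k * t) - 1) / t * coef a z₀ k) (coef a g k)
    have h7 := abs_add_le ((Real.exp (-eig a k * t) - 1) / t * coef a z₀ k - coef a g k)
      (coef a h k * (duhamel (eig a k) u t / t + c₀))
    linarith
  · have h1 := (((tendsto_exp_sub_one_div (eig a k)).mul_const (coef a z₀ k)).sub_const
      (coef a g k)).add (((tendsto_duhamel_div huL hulim (eig a k)).add_const c₀).const_mul
        (coef a h k))
    have h2 : -eig a k * coef a z₀ k - coef a g k + coef a h k * (-c₀ + c₀) = 0 := by
      rw [hgk]; ring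
    rw [h2] at h1
    refine h1.congr' ?_
    filter_upwards [self_mem_nhdsWithin] with t ht
    exact (hcoef t ht k).symm

end observer

theorem isExpEstimator_of_isSmallGain {a α β : Plane} (hα : ∀ k, 0 ≤ α k)
    (hαβ : ∀ k, α k < β k) (hβ : ∀ k, β k ≤ a k) {σ : Set Plane} (hσ : IsFilament a σ)
    {lam : ℝ} (hlam : 0 < lam) (hgap : ∀ k, k ≠ 0 → lam ≤ eig a k) {h : Plane → ℝ}
    (hh : IsSmallGain a σ lam h) : IsExpEstimator (rect 0 a) (rect α β) σ h := by
  have ha : ∀ i, 0 < a i := fun i => ((hα i).trans_lt (hαβ i)).trans_le (hβ i)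
  have hsub : rect α β ⊆ rect 0 a := fun x hx i =>
    ⟨(hα i).trans_lt (hx i).1, (hx i).2.trans_le (hβ i)⟩
  obtain ⟨F, κ, hF, hκ, hest⟩ := exists_forall_h1Norm_sub_le ha hσ hlam hgap hh
  -- The error decays on the whole rectangle, so the growth bound holds with the negative exponent
  -- `-κ`, and the bound on the subrectangle follows by restriction.
  refine ⟨fun z₀ z hz₀ hz => wellPosed_isObserver ha hσ hlam hgap hh hz₀ hz, ⟨F, -κ, ?_⟩,
    ⟨F, κ, hF, hκ, ?_⟩, fun z₀ hz₀ => inDomain_isObserver ha hσ hh.memH1 hh.summable hz₀⟩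
  · intro z₀ z w₀ w hz₀ hz hw₀ hw t ht
    exact hest _ w₀ z₀ w z hw₀ hz₀ hw (hz.isObserver σ h) t ht
  · intro z₀ z w₀ w hz₀ hz hw₀ hw t ht
    refine (h1Norm_mono (isOpen_rect α β) hsub
      ((IsSolution.mem_h1 hw t ht).sub (IsSolution.mem_h1 hz t ht))).trans ?_
    exact hest _ w₀ z₀ w z hw₀ hz₀ hw (hz.isObserver σ h) t ht

end FilamentObs

end

theorem proposition4p5 (a α β b : FilamentObs.Plane) (J : ℕ)
    (hα : ∀ k, 0 ≤ α k) (hαβ : ∀ k, α k < β k) (hβ : ∀ k, β k ≤ a k)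
    (γ : ℝ → FilamentObs.Plane) (hγ : ContDiffOn ℝ 1 γ (Set.Icc 0 1))
    (σ : Set FilamentObs.Plane) (hσ : σ = γ '' Set.Icc 0 1)
    (hσ_nontrivial : σ.Nontrivial) (hσΩ : σ ⊆ FilamentObs.rect 0 a)
    (hsymm : FilamentObs.SymmetricAboutLineThrough b σ)
    (hb₁ : ∀ i : ℕ, 1 ≤ i → i ≤ J →
      ¬ FilamentObs.IsEvenInteger (i * (b 0 - α 0) / (β 0 - α 0)))
    (hb₂ : ∀ j : ℕ, 1 ≤ j → j ≤ J →
      ¬ FilamentObs.IsEvenInteger (j * (b 1 - α 1) / (β 1 - α 1))) :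
    FilamentObs.RegionallyExpObservable (FilamentObs.rect 0 a) (FilamentObs.rect α β) σ := by
  subst hσ
  have ha : ∀ i, 0 < a i := fun i => ((hα i).trans_lt (hαβ i)).trans_le (hβ i)
  have hσ' := FilamentObs.isFilament_image hγ hσ_nontrivial hσΩ
  obtain ⟨lam, hlam, hgap⟩ := FilamentObs.exists_spectral_gap ha
  obtain ⟨h, hh, h0⟩ := FilamentObs.exists_isSmallGain hα hαβ hβ hσ' hlam
  exact ⟨FilamentObs.wellPosed_isState ha, h, hh.memH1, h0,
    FilamentObs.isExpEstimator_of_isSmallGain hα hαβ hβ hσ' hlam hgap hh⟩
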